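/- Let $L>0$ and $\delta>0$. Put $$\zeta_1(z)=\frac{\pi}{L}\lim_{M\to\infty}\sum_{n=-M}^{M}\cot\Big(\frac{\pi}{L}(z-2\mathrm{i}n\delta)\Big),$$ and for $L$-periodic $f:\mathbb R\to\mathbb C$ let $$(Tf)(x)=\frac1\pi\,\mathrm{p.v.}\!\int_{-L/2}^{L/2}\zeta_1(x'-x)f(x')\,\mathrm dx',\qquad (\tilde Tf)(x)=\frac1\pi\int_{-L/2}^{L/2}\zeta_1(x'-x+\mathrm i\delta)f(x')\,\mathrm dx',\qquad P_\pm=-\tfrac12(\mathrm iT\pm1).$$ The periodic non-chiral intermediate long wave (ncILW) equation is $$u_t+2uu_x+Tu_{xx}+\tilde Tv_{xx}=0,\qquad v_t-2vv_x-Tv_{xx}-\tilde Tu_{xx}=0$$ for complex-valued functions $u(x,t),v(x,t)$ that are $L$-periodic in $x$. **Theorem (conservation laws of the periodic non-chiral ILW equation).** (a) For all smooth ($C^\infty$) $L$-periodic functions $u,v:\mathbb R\to\mathbb C$ there is exactly one pair of sequences of functions $W_n,Z_n:\mathbb R\to\mathbb C$ ($n\ge1$) such that, with $W=\sum_{n\ge1}W_n\epsilon^n$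 and $Z=\sum_{n\ge1}Z_n\epsilon^n$, the identities of formal power series in $\epsilon$ $$u=\frac{1-e^{-W}}{\epsilon}-\mathrm iP_-W_x-\frac12\tilde TZ_x,\qquad v=-\frac{1-e^{Z}}{\epsilon}+\mathrm iP_+Z_x+\frac12\tilde TW_x$$ hold, where $\partial_x$, $T$, $\tilde T$ act coefficientwise. The functions $W_n,Z_n$ are smooth and $L$-periodic, and they are computed recursively: $W_1=u$, $Z_1=v$, and for $n\ge1$ $$W_{n+1}=[\epsilon^{n+1}]\exp\Big(-\sum_{k=1}^nW_k\epsilon^k\Big)+\mathrm iP_-W_{n,x}+\tfrac12\tilde TZ_{n,x},\qquad Z_{n+1}=-[\epsilon^{n+1}]\exp\Big(\sum_{k=1}^nZ_k\epsilon^k\Big)-\mathrm iP_+Z_{n,x}-\tfrac12\tilde TW_{n,x},$$ where $[\epsilon^{m}]$ denotes the coefficient of $\epsilon^m$. (b) Put $I_n=\int_{-L/2}^{L/2}(W_n+Z_n)\,\mathrm dx$. If $J\subseteq\mathbb R$ is an open interval (for instance $J=\mathbb R$) and $(u,v)$ is a smooth solution of the periodic ncILW equation on $\mathbb R\times J$,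 $L$-periodic in $x$, then for every $n\ge1$ the quantity $I_n$, formed from $u(\cdot,t),v(\cdot,t)$, does not depend on $t\in J$. The functionals $I_1,I_2,\dots$ on pairs of smooth $L$-periodic functions are linearly independent over $\mathbb C$, so there are infinitely many conservation laws. (c) For all smooth $L$-periodic $u,v$ the first four are $$I_1=\int_{-L/2}^{L/2}(u+v)\,\mathrm dx,\qquad I_2=\int_{-L/2}^{L/2}\tfrac12(u^2-v^2)\,\mathrm dx,$$ $$I_3=\int_{-L/2}^{L/2}\Big(\tfrac13(u^3+v^3)+\tfrac12\big(uTu_x+vTv_x+u\tilde Tv_x+v\tilde Tu_x\big)\Big)\mathrm dx,$$ $$I_4=\int_{-L/2}^{L/2}\Big(\tfrac{u^4-v^4}{4}+\tfrac{u_x^2-v_x^2}{8}+\tfrac38\big((Tu_x)^2-(Tv_x)^2-(\tilde Tu_x)^2+(\tilde Tv_x)^2\big)+\tfrac34\big(u^2Tu_x-v^2Tv_x\big)+\tfrac34\big(u^2\tilde Tv_x-v^2\tilde Tu_x\big)\Big)\mathrm dx.$$ -/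

import Mathlib

open scoped ContDiff Topology

noncomputable section

namespace NcILW

/-- `ζ₁(z | L/2, iδ) = (π/L) lim_{M → ∞} ∑_{n=-M}^{M} cot (π/L (z - 2inδ))`. -/
def zeta1 (L δ : ℝ) (z : ℂ) : ℂ :=
  ((Real.pi / L : ℝ) : ℂ) *
    Filter.limUnder Filter.atTop (fun M : ℕ =>
      ∑ n ∈ Finset.Icc (-(M : ℤ)) (M : ℤ),
        Complex.cot (((Real.pi / L : ℝ) : ℂ) * (z - 2 * Complex.I * (n : ℂ) * (δ : ℂ))))

/-- `(T f)(x) = (1/π) PV ∫_{-L/2}^{L/2} ζ₁(x' - x) f(x') dx'`. The kernel has its singularities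
at the points `x + kL`, `k ∈ ℤ`; the principal value removes symmetric neighbourhoods of these
points from the period `(-L/2, L/2]` (only one of them matters when `-L/2 < x < L/2`). -/
def opT (L δ : ℝ) (f : ℝ → ℂ) (x : ℝ) : ℂ :=
  (1 / (Real.pi : ℂ)) *
    Filter.limUnder (𝓝[>] (0 : ℝ)) (fun η : ℝ =>
      ∫ y in {y : ℝ | y ∈ Set.Ioc (-(L / 2)) (L / 2) ∧ ∀ k : ℤ, η < |y - x - k * L|},
        zeta1 L δ ((y : ℂ) - (x : ℂ)) * f y)

/-- `(T̃ f)(x) = (1/π) ∫_{-L/2}^{L/2} ζ₁(x' - x + iδ) f(x') dx'`. -/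
def opTt (L δ : ℝ) (f : ℝ → ℂ) (x : ℝ) : ℂ :=
  (1 / (Real.pi : ℂ)) *
    ∫ y in (-(L / 2))..(L / 2), zeta1 L δ ((y : ℂ) - (x : ℂ) + Complex.I * (δ : ℂ)) * f y

/-- `P₊ = -(iT + 1)/2`. -/
def opPplus (L δ : ℝ) (f : ℝ → ℂ) (x : ℝ) : ℂ :=
  -(1 / 2) * (Complex.I * opT L δ f x + f x)

/-- `P₋ = -(iT - 1)/2`. -/
def opPminus (L δ : ℝ) (f : ℝ → ℂ) (x : ℝ) : ℂ :=
  -(1 / 2) * (Complex.I * opT L δ f x - f x)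

/-- Smooth `L`-periodic complex-valued functions on `ℝ`. -/
def SmoothPeriodic (L : ℝ) (f : ℝ → ℂ) : Prop :=
  ContDiff ℝ ∞ f ∧ Function.Periodic f L

/-- `u = u(x, t)`, `v = v(x, t)` is a smooth, spatially `L`-periodic solution of
`u_t + 2 u u_x + T u_xx + T̃ v_xx = 0`, `v_t - 2 v v_x - T v_xx - T̃ u_xx = 0`
for `x ∈ ℝ` and `t` in the open set `J` of times. -/
structure IsSolution (L δ : ℝ) (J : Set ℝ) (u v : ℝ → ℝ → ℂ) : Prop where
  smooth_u : ContDiffOn ℝ ∞ (fun p : ℝ × ℝ => u p.1 p.2) (Set.univ ×ˢ J)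
  smooth_v : ContDiffOn ℝ ∞ (fun p : ℝ × ℝ => v p.1 p.2) (Set.univ ×ˢ J)
  periodic_u : ∀ t ∈ J, Function.Periodic (fun x => u x t) L
  periodic_v : ∀ t ∈ J, Function.Periodic (fun x => v x t) L
  eq_u : ∀ x, ∀ t ∈ J,
    deriv (fun s => u x s) t + 2 * u x t * deriv (fun y => u y t) x
      + opT L δ (deriv (deriv (fun y => u y t))) x
      + opTt L δ (deriv (deriv (fun y => v y t))) x = 0
  eq_v : ∀ x, ∀ t ∈ J,
    deriv (fun s => v x s) t - 2 * v x t * deriv (fun y => v y t) x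
      - opT L δ (deriv (deriv (fun y => v y t))) x
      - opTt L δ (deriv (deriv (fun y => u y t))) x = 0

/-- Apply an operator on functions to each coefficient of a formal power series in `ε`. -/
def coeffwise (A : (ℝ → ℂ) → ℝ → ℂ) (F : PowerSeries (ℝ → ℂ)) : PowerSeries (ℝ → ℂ) :=
  PowerSeries.mk fun n => A (PowerSeries.coeff n F)

/-- The formal exponential `exp(S)` of a power series `S` in `ε` without constant term, whose
coefficients are functions of `x`. -/
def formalExp (S : PowerSeries (ℝ → ℂ)) : PowerSeries (ℝ → ℂ) :=
  (PowerSeries.exp (ℝ → ℂ)).subst S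

/-- `W = ∑_{n ≥ 1} W_n ε^n` and `Z = ∑_{n ≥ 1} Z_n ε^n` satisfy, as formal power series in `ε`,
`u = (1 - e^{-W})/ε - i P₋ W_x - T̃ Z_x / 2` and
`v = -(1 - e^{Z})/ε + i P₊ Z_x + T̃ W_x / 2`.
Both relations are written after multiplication by `ε`. -/
structure IsBacklundSeries (L δ : ℝ) (u v : ℝ → ℂ) (W Z : PowerSeries (ℝ → ℂ)) : Prop where
  constCoeff_W : PowerSeries.constantCoeff W = 0
  constCoeff_Z : PowerSeries.constantCoeff Z = 0
  eq_u : PowerSeries.X * PowerSeries.C u =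
    (1 - formalExp (-W))
      - PowerSeries.X * (Complex.I • coeffwise (fun f => opPminus L δ (deriv f)) W)
      - PowerSeries.X * ((1 / 2 : ℂ) • coeffwise (fun f => opTt L δ (deriv f)) Z)
  eq_v : PowerSeries.X * PowerSeries.C v =
    -(1 - formalExp Z)
      + PowerSeries.X * (Complex.I • coeffwise (fun f => opPplus L δ (deriv f)) Z)
      + PowerSeries.X * ((1 / 2 : ℂ) • coeffwise (fun f => opTt L δ (deriv f)) W)

/-- `I_n = ∫_{-L/2}^{L/2} (W_n + Z_n) dx`. -/
def conservedIntegral (L : ℝ) (W Z : PowerSeries (ℝ → ℂ)) (n : ℕ) : ℂ :=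
  ∫ x in (-(L / 2))..(L / 2), (PowerSeries.coeff n W x + PowerSeries.coeff n Z x)

/-- Density of the third conservation law. -/
def density3 (L δ : ℝ) (u v : ℝ → ℂ) (x : ℝ) : ℂ :=
  1 / 3 * (u x ^ 3 + v x ^ 3)
    + 1 / 2 * (u x * opT L δ (deriv u) x + v x * opT L δ (deriv v) x
        + u x * opTt L δ (deriv v) x + v x * opTt L δ (deriv u) x)

/-- Density of the fourth conservation law. -/
def density4 (L δ : ℝ) (u v : ℝ → ℂ) (x : ℝ) : ℂ :=
  (u x ^ 4 - v x ^ 4) / 4 + (deriv u x ^ 2 - deriv v x ^ 2) / 8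
    + 3 / 8 * (opT L δ (deriv u) x ^ 2 - opT L δ (deriv v) x ^ 2
        - opTt L δ (deriv u) x ^ 2 + opTt L δ (deriv v) x ^ 2)
    + 3 / 4 * (u x ^ 2 * opT L δ (deriv u) x - v x ^ 2 * opT L δ (deriv v) x)
    + 3 / 4 * (u x ^ 2 * opTt L δ (deriv v) x - v x ^ 2 * opTt L δ (deriv u) x)

end NcILW

end

open MeasureTheory

/-! Work in the algebra of pairs of smooth periodic functions with componentwise product. Put `U =
(u, -v)` and `Ω = (W, -Z)`, let `D` be differentiation, and let `H` be the matrix operator with rows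
`(T∂, -T̃∂)` and `(T̃∂, -T∂)`. The system becomes one equation of Benjamin-Ono type, `U_t = -2 U DU
- H DU`. The two defining relations become `2εU = 2(1 - e^{-Ω}) - ε(H + iD)Ω`, and `I_n` is the
trace of `Ω_n` for the functional `∫f₁ - ∫f₂`.

The decisive point is that `H` behaves like a Hilbert transform composed with `D`. On the Fourier
mode `m ≠ 0` the operators `T` and `T̃` are multiplication by `i coth(am)` and `i / sinh(am)`, where
`a = 2πδ/L` (`mult_mul_one_sub_ratio_sq`). Hence `H² = -D²`, and the Fourier coefficients of the two
components of `Df - iHf` differ by the factor `e^{-am}`, like the values of one analytic function on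
the two edges of a strip of width `δ`. Such pairs are closed under multiplication
(`IsBoundaryPair.mul`) and satisfy `H = iD` (`matrixH_of_isBoundaryPair`); swapping components gives
the conjugate statement for `Df + iHf`. Together these yield the Cotlar-type identity
`HilbertCalculus.Hc_mul`, the only nonlinear fact about the nonlocal operators that is needed. The
structure `HilbertCalculus` isolates these properties, so that the rest is algebra.

Conservation rests on `HilbertCalculus.evolution`: along solutions, `εΩ_t = -2D(Ω + e^{-Ω}) + ε(-HDΩ
+ DΩ·HΩ)`. The difference `Y` of the two sides satisfies `2e^{-Ω}Y = ε(H + iD)Y`, which forces `Y =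
0` coefficient by coefficient. Under the trace the exact terms disappear, and so does `DΩ·HΩ`,
because `tr(Df·Hg) = -tr(Hf·Dg)`.

The analysis consists in rewriting `T` (a principal value) and `T̃` (on mean-zero functions) as
convolutions `oddOp` with an odd kernel having at most a simple pole. In that form they preserve
joint smoothness, commute with `∂_x` and `∂_t`, and are antisymmetric.

Existence, uniqueness and the recursion follow because the coefficient of `ε^{n+1}` in `e^S` is
`S_{n+1}` plus an expression in lower coefficients. The first four integrals are traces of the first
four recursion steps. For independence take `u = c`, `v = 0`: then `W = -log(1 - cε)` and `I_n = L
cⁿ/n`, and these are independent polynomials in `c`. -/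

namespace NcILW

/-! ### Smooth dependence of integrals on parameters -/

theorem hasFDerivAt_slice {E F : Type} [NormedAddCommGroup E] [NormedSpace ℝ E]
    [NormedAddCommGroup F] [NormedSpace ℝ F] {Φ : E × ℝ → F} {Φ' : E × ℝ →L[ℝ] F} {p : E} {s : ℝ}
    (h : HasFDerivAt Φ Φ' (p, s)) :
    HasFDerivAt (fun q => Φ (q, s)) (Φ'.comp (ContinuousLinearMap.inl ℝ E ℝ)) p :=
  h.comp p (hasFDerivAt_prodMk_left p s)

/-- Dominated differentiation. The kernel need only be integrable, because the derivative of `Φ` in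
the parameter is bounded on the product of a closed ball and the integration interval; finite
dimension of `E` makes the ball compact. -/
theorem hasFDerivAt_integral_kernel_mul {E F : Type} [NormedAddCommGroup E] [NormedSpace ℝ E]
    [FiniteDimensional ℝ E] [NormedAddCommGroup F] [NormedSpace ℂ F] [CompleteSpace F]
    {U : Set E} (hU : IsOpen U) {a b : ℝ} {k : ℝ → ℂ}
    (hk : IntervalIntegrable k volume a b) {Φ : E × ℝ → F}
    (hΦ : ContDiffOn ℝ 1 Φ (U ×ˢ Set.univ)) {p : E} (hp : p ∈ U) :
    HasFDerivAt (fun p => ∫ s in a..b, k s • Φ (p, s))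
      (∫ s in a..b, k s • fderiv ℝ (fun q => Φ (q, s)) p) p := by
  have hUo : IsOpen (U ×ˢ (Set.univ : Set ℝ)) := hU.prod isOpen_univ
  have hcont : ContinuousOn Φ (U ×ˢ Set.univ) := hΦ.continuousOn
  have hdiff : ∀ q ∈ U, ∀ s, HasFDerivAt (fun q => Φ (q, s))
      ((fderiv ℝ Φ (q, s)).comp (ContinuousLinearMap.inl ℝ E ℝ)) q := by
    intro q hq s
    have h1 : HasFDerivAt Φ (fderiv ℝ Φ (q, s)) (q, s) :=
      ((hΦ.differentiableOn one_ne_zero).differentiableAt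
        (hUo.mem_nhds ⟨hq, trivial⟩)).hasFDerivAt
    exact hasFDerivAt_slice h1
  have hcd : ContinuousOn (fun z : E × ℝ => (fderiv ℝ Φ z).comp (ContinuousLinearMap.inl ℝ E ℝ))
      (U ×ˢ Set.univ) :=
    (hΦ.continuousOn_fderiv_of_isOpen hUo le_rfl).clm_comp continuousOn_const
  obtain ⟨r, hr, hball⟩ := Metric.nhds_basis_closedBall.mem_iff.1 (hU.mem_nhds hp)
  have hK : IsCompact (Metric.closedBall p r ×ˢ Set.uIcc a b) :=
    (isCompact_closedBall p r).prod isCompact_uIcc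
  obtain ⟨C, hC⟩ := hK.exists_bound_of_continuousOn
    (hcd.mono (Set.prod_mono hball (Set.subset_univ _)))
  have hslice : ∀ q ∈ U, Continuous fun s => Φ (q, s) := fun q hq =>
    hcont.comp_continuous (by fun_prop) fun s => ⟨hq, trivial⟩
  have hslice' : Continuous fun s => (fderiv ℝ Φ (p, s)).comp (ContinuousLinearMap.inl ℝ E ℝ) :=
    hcd.comp_continuous (by fun_prop : Continuous fun s => (p, s)) fun s => ⟨hp, trivial⟩
  have hint : ∀ {G : Type} [NormedAddCommGroup G] [NormedSpace ℂ G] {g : ℝ → G}, Continuous g →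
      IntervalIntegrable (fun s => k s • g s) volume a b := by
    intro G _ _ g hg
    exact hk.smul_continuousOn hg.continuousOn
  have key := intervalIntegral.hasFDerivAt_integral_of_dominated_of_fderiv_le
    (μ := volume) (a := a) (b := b) (F := fun q s => k s • Φ (q, s))
    (F' := fun q s => k s • (fderiv ℝ Φ (q, s)).comp (ContinuousLinearMap.inl ℝ E ℝ))
    (x₀ := p) (bound := fun s => ‖k s‖ * C) (Metric.closedBall_mem_nhds p hr) ?_ (hint (hslice p hp))
    (intervalIntegrable_iff.1 (hint hslice')).aestronglyMeasurable ?_ (hk.norm.mul_const C) ?_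
  · convert key using 3 with s
    rw [(hdiff p hp s).fderiv]
  · filter_upwards [hU.mem_nhds hp] with q hq
    exact (intervalIntegrable_iff.1 (hint (hslice q hq))).aestronglyMeasurable
  · refine Filter.Eventually.of_forall fun s hs q hq => ?_
    rw [norm_smul]
    exact mul_le_mul_of_nonneg_left (hC (q, s) ⟨hq, Set.uIoc_subset_uIcc hs⟩) (norm_nonneg _)
  · refine Filter.Eventually.of_forall fun s hs q hq => ?_
    exact (hdiff q (hball hq) s).const_smul (k s)

/-- The derivative is an integral of the same shape with values in `E →L[ℝ] F`, so the target space
must vary in the induction. One degree of smoothness of `Φ` is sacrificed, which is harmless for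
`C^∞`. -/
theorem contDiffOn_integral_kernel_mul_nat {E : Type} [NormedAddCommGroup E] [NormedSpace ℝ E]
    [FiniteDimensional ℝ E] {U : Set E} (hU : IsOpen U) {a b : ℝ} {k : ℝ → ℂ}
    (hk : IntervalIntegrable k volume a b) (n : ℕ) :
    ∀ {F : Type} [NormedAddCommGroup F] [NormedSpace ℂ F] [CompleteSpace F] {Φ : E × ℝ → F},
      ContDiffOn ℝ (n + 1) Φ (U ×ˢ Set.univ) →
      ContDiffOn ℝ n (fun p => ∫ s in a..b, k s • Φ (p, s)) U := by
  induction n with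
  | zero =>
    intro F _ _ _ Φ hΦ
    simp only [CharP.cast_eq_zero, contDiffOn_zero]
    exact fun p hp => (hasFDerivAt_integral_kernel_mul hU hk (by simpa using hΦ)
      hp).continuousAt.continuousWithinAt
  | succ n ih =>
    intro F _ _ _ Φ hΦ
    have hΦ1 : ContDiffOn ℝ 1 Φ (U ×ˢ Set.univ) := hΦ.of_le (by simp)
    have hUo : IsOpen (U ×ˢ (Set.univ : Set ℝ)) := hU.prod isOpen_univ
    push_cast
    rw [contDiffOn_succ_iff_fderiv_of_isOpen hU]
    refine ⟨fun p hp => (hasFDerivAt_integral_kernel_mul hU hk hΦ1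
      hp).differentiableAt.differentiableWithinAt, by simp, ?_⟩
    have h2 : ContDiffOn ℝ (n + 1)
        (fun z : E × ℝ => (fderiv ℝ Φ z).comp (ContinuousLinearMap.inl ℝ E ℝ))
        (U ×ˢ Set.univ) :=
      (hΦ.fderiv_of_isOpen hUo (by push_cast; exact le_rfl)).clm_comp contDiffOn_const
    refine (ih h2).congr fun p hp => ?_
    rw [(hasFDerivAt_integral_kernel_mul hU hk hΦ1 hp).fderiv]
    congr 1
    funext s
    have h1 : HasFDerivAt Φ (fderiv ℝ Φ (p, s)) (p, s) :=
      ((hΦ1.differentiableOn one_ne_zero).differentiableAt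
        (hUo.mem_nhds ⟨hp, trivial⟩)).hasFDerivAt
    rw [(hasFDerivAt_slice h1).fderiv]

theorem contDiffOn_integral_kernel_mul {E F : Type} [NormedAddCommGroup E] [NormedSpace ℝ E]
    [FiniteDimensional ℝ E] [NormedAddCommGroup F] [NormedSpace ℂ F] [CompleteSpace F]
    {U : Set E} (hU : IsOpen U) {a b : ℝ} {k : ℝ → ℂ}
    (hk : IntervalIntegrable k volume a b) {Φ : E × ℝ → F}
    (hΦ : ContDiffOn ℝ ∞ Φ (U ×ˢ Set.univ)) :
    ContDiffOn ℝ ∞ (fun p => ∫ s in a..b, k s • Φ (p, s)) U :=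
  contDiffOn_infty.2 fun n => contDiffOn_integral_kernel_mul_nat hU hk n
    (hΦ.of_le (by exact_mod_cast le_top))

/-! ### Cotangent sums and the sine series of the kernels -/

theorem hasSum_of_eq {ι E : Type*} [AddCommMonoid E] [TopologicalSpace E] {f g : ι → E} {s : E}
    (h : ∀ i, f i = g i) (hf : HasSum f s) : HasSum g s := by
  rwa [← funext h]

theorem cot_neg (z : ℂ) : Complex.cot (-z) = -Complex.cot z := by
  simp [Complex.cot, div_neg]

theorem cot_eq_of_im_pos {z : ℂ} (hz : 0 < z.im) :
    Complex.cot z = -Complex.I - 2 * Complex.I *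
      (Complex.exp (2 * Complex.I * z) * (1 - Complex.exp (2 * Complex.I * z))⁻¹) := by
  have hx : ‖Complex.exp (2 * Complex.I * z)‖ < 1 := by
    rw [Complex.norm_exp]
    simpa using hz
  have h1 : 1 - Complex.exp (2 * Complex.I * z) ≠ 0 := by
    intro h
    rw [sub_eq_zero] at h
    rw [← h] at hx
    simp at hx
  rw [Complex.cot_eq_exp_ratio]
  generalize Complex.exp (2 * Complex.I * z) = x at h1
  field_simp
  rw [Complex.I_sq]
  ring

/-- Each cotangent is a constant `±i` plus a geometric series in `e^{2iz}`. The constants of the two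
conjugate points cancel, and the exponentials combine into sines. -/
theorem hasSum_cot_pair (w : ℝ) {s : ℝ} (hs : 0 < s) :
    HasSum (fun j : ℕ => 4 * ((Real.exp (-2 * (j + 1) * s) : ℝ) : ℂ) *
        Complex.sin (2 * (j + 1) * w))
      (Complex.cot (w - Complex.I * s) + Complex.cot (w + Complex.I * s)) := by
  have hsum : ∀ z : ℂ, 0 < z.im → HasSum (fun j : ℕ => Complex.exp (2 * (j + 1) * Complex.I * z))
      (Complex.exp (2 * Complex.I * z) * (1 - Complex.exp (2 * Complex.I * z))⁻¹) := by
    intro z hz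
    have hx : ‖Complex.exp (2 * Complex.I * z)‖ < 1 := by
      rw [Complex.norm_exp]
      simpa using hz
    refine hasSum_of_eq (fun j => ?_)
      ((hasSum_geometric_of_norm_lt_one hx).mul_left (Complex.exp (2 * Complex.I * z)))
    rw [← Complex.exp_nat_mul, ← Complex.exp_add]
    congr 1
    ring
  have hp : 0 < ((w : ℂ) + Complex.I * s).im := by simpa using hs
  have hm : 0 < (-(w : ℂ) + Complex.I * s).im := by simpa using hs
  have e1 : (w : ℂ) - Complex.I * s = -(-w + Complex.I * s) := by ring
  rw [e1, cot_neg, cot_eq_of_im_pos hp, cot_eq_of_im_pos hm]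
  have h := ((hsum _ hm).sub (hsum _ hp)).mul_left (2 * Complex.I)
  have e2 : ∀ A B : ℂ, -(-Complex.I - 2 * Complex.I * A) + (-Complex.I - 2 * Complex.I * B) =
      2 * Complex.I * (A - B) := fun A B => by ring
  rw [e2]
  refine hasSum_of_eq (fun j => ?_) h
  · rw [Complex.sin, Complex.ofReal_exp]
    have a1 : Complex.exp (2 * (j + 1) * Complex.I * (-w + Complex.I * s)) =
        Complex.exp ((-2 * (j + 1) * s : ℝ)) * Complex.exp (-(2 * (j + 1) * w) * Complex.I) := by
      rw [← Complex.exp_add]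
      congr 1
      push_cast
      linear_combination (2 * (j + 1) * s : ℂ) * Complex.I_sq
    have a2 : Complex.exp (2 * (j + 1) * Complex.I * (w + Complex.I * s)) =
        Complex.exp ((-2 * (j + 1) * s : ℝ)) * Complex.exp ((2 * (j + 1) * w) * Complex.I) := by
      rw [← Complex.exp_add]
      congr 1
      push_cast
      linear_combination (2 * (j + 1) * s : ℂ) * Complex.I_sq
    rw [a1, a2]
    ring

/-- Coefficients of the sine series of the regular part of the kernel. -/
noncomputable def sineCoeff (a θ : ℝ) (j : ℕ) : ℝ :=
  Real.exp (-2 * (j + 1) * (θ * a)) / (1 - Real.exp (-2 * (j + 1) * a))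

/-- The sine series of the regular part of the kernel. -/
noncomputable def sineSeries (a θ w : ℝ) : ℂ :=
  ∑' j : ℕ, (sineCoeff a θ j : ℂ) * Complex.sin (2 * (j + 1) * w)

theorem norm_sin_ofReal_le (x : ℝ) : ‖Complex.sin x‖ ≤ 1 := by
  rw [← Complex.ofReal_sin, Complex.norm_real]
  exact Real.abs_sin_le_one x

theorem norm_sin_le (j : ℕ) (w : ℝ) : ‖Complex.sin (2 * (j + 1) * w)‖ ≤ 1 := by
  have := norm_sin_ofReal_le (2 * (j + 1) * w)
  push_cast at this
  exact this

theorem summable_exp_double {a θ : ℝ} (ha : 0 < a) (hθ : 0 < θ) :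
    Summable fun p : ℕ × ℕ => Real.exp (-2 * (p.2 + 1) * ((p.1 + θ) * a)) := by
  have h1 : ∀ {b : ℝ}, 0 < b → Summable fun n : ℕ => Real.exp (-b * n) := by
    intro b hb
    have : Real.exp (-b) < 1 := by simpa using hb
    refine (summable_geometric_of_lt_one (Real.exp_pos _).le this).congr fun n => ?_
    rw [← Real.exp_nat_mul]
    congr 1
    ring
  have h2 := (h1 (b := 2 * a) (by positivity)).mul_of_nonneg (h1 (b := 2 * θ * a) (by positivity))
    (fun n => (Real.exp_pos _).le) (fun n => (Real.exp_pos _).le)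
  refine Summable.of_nonneg_of_le (fun p => (Real.exp_pos _).le) (fun p => ?_) h2
  rw [← Real.exp_add]
  apply Real.exp_le_exp.2
  have : 0 ≤ (p.2 : ℝ) * p.1 * a := by positivity
  have : 0 ≤ θ * a := by positivity
  nlinarith

theorem hasSum_sineCoeff {a θ : ℝ} (ha : 0 < a) (j : ℕ) :
    HasSum (fun n : ℕ => Real.exp (-2 * (j + 1) * ((n + θ) * a))) (sineCoeff a θ j) := by
  have : Real.exp (-2 * (j + 1) * a) < 1 := by
    rw [Real.exp_lt_one_iff]
    have : 0 < (j + 1 : ℝ) * a := by positivity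
    linarith
  refine hasSum_of_eq (fun n => ?_) ((hasSum_geometric_of_lt_one (Real.exp_pos _).le
    this).mul_left (Real.exp (-2 * (j + 1) * (θ * a))))
  rw [← Real.exp_nat_mul, ← Real.exp_add]
  congr 1
  ring

theorem summable_sineCoeff {a θ : ℝ} (ha : 0 < a) (hθ : 0 < θ) : Summable (sineCoeff a θ) := by
  have h := (summable_exp_double ha hθ).prod_symm.prod
  refine h.congr fun j => (hasSum_sineCoeff ha j).tsum_eq

theorem sineCoeff_nonneg {a θ : ℝ} (ha : 0 < a) (j : ℕ) : 0 ≤ sineCoeff a θ j :=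
  (hasSum_sineCoeff ha j).nonneg fun _ => (Real.exp_pos _).le

theorem norm_sineTerm_le {a θ : ℝ} (ha : 0 < a) (j : ℕ) (w : ℝ) :
    ‖(sineCoeff a θ j : ℂ) * Complex.sin (2 * (j + 1) * w)‖ ≤ sineCoeff a θ j := by
  rw [norm_mul, Complex.norm_real, Real.norm_of_nonneg (sineCoeff_nonneg ha j)]
  exact mul_le_of_le_one_right (sineCoeff_nonneg ha j) (norm_sin_le j w)

/-- The double series in the shift `n` and the frequency `j` converges absolutely, so the sum over
`n` may be done first. It is geometric and produces `sineCoeff`. -/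
theorem tendsto_sum_cot_pair {a θ : ℝ} (ha : 0 < a) (hθ : 0 < θ) (w : ℝ) :
    Filter.Tendsto (fun M : ℕ => ∑ n ∈ Finset.range M,
      (Complex.cot (w - Complex.I * ((n + θ) * a : ℝ)) +
        Complex.cot (w + Complex.I * ((n + θ) * a : ℝ))))
      Filter.atTop (𝓝 (4 * sineSeries a θ w)) := by
  have hs : Summable (Function.uncurry fun n j : ℕ =>
      4 * ((Real.exp (-2 * (j + 1) * ((n + θ) * a)) : ℝ) : ℂ) * Complex.sin (2 * (j + 1) * w)) := by
    refine Summable.of_norm_bounded ((summable_exp_double ha hθ).mul_left 4) fun p => ?_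
    simp only [Function.uncurry, norm_mul, Complex.norm_real, Real.norm_eq_abs, Real.abs_exp]
    have := mul_le_mul_of_nonneg_left (norm_sin_le p.2 w)
      (by positivity : 0 ≤ 4 * Real.exp (-2 * (p.2 + 1) * ((p.1 + θ) * a)))
    simpa using this
  have hpos : ∀ n : ℕ, 0 < (n + θ) * a := fun n => by positivity
  have hn := hs.prod
  simp only [Function.uncurry] at hn
  have h1 := hn.hasSum.tendsto_sum_nat
  rw [← hs.tsum_comm] at h1
  convert h1 using 1
  · funext M
    exact Finset.sum_congr rfl fun n _ => (hasSum_cot_pair w (hpos n)).tsum_eq.symm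
  · rw [sineSeries, ← tsum_mul_left]
    congr 1
    refine tsum_congr fun j => ?_
    have := (Complex.hasSum_ofReal.2 (hasSum_sineCoeff (θ := θ) ha j))
    rw [((this.mul_left 4).mul_right (Complex.sin (2 * (j + 1) * w))).tsum_eq]
    ring

theorem sum_Icc_neg_pair (f : ℤ → ℂ) (M : ℕ) :
    ∑ n ∈ Finset.Icc (-(M : ℤ)) M, f n = f 0 + ∑ n ∈ Finset.range M, (f (n + 1) + f (-(n + 1))) := by
  induction M with
  | zero => simp
  | succ M ih =>
    have : Finset.Icc (-((M + 1 : ℕ) : ℤ)) ((M + 1 : ℕ) : ℤ) =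
        insert ((M : ℤ) + 1) (insert (-((M : ℤ) + 1)) (Finset.Icc (-(M : ℤ)) M)) := by
      ext x
      simp only [Finset.mem_Icc, Finset.mem_insert]
      push_cast
      omega
    rw [this, Finset.sum_insert, Finset.sum_insert, ih, Finset.sum_range_succ]
    · ring
    · simp
    · simp only [Finset.mem_insert, Finset.mem_Icc]
      omega

/-- At a point shifted by `iδ` the conjugate partners are the indices `n + 1` and `-n`, not `±n`.
The symmetric partial sum then leaves the index `-M` unpaired. -/
theorem sum_Icc_neg_shift (f : ℤ → ℂ) (M : ℕ) :
    ∑ n ∈ Finset.Icc (-(M : ℤ)) M, f n =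
      f (-(M : ℤ)) + ∑ n ∈ Finset.range M, (f (n + 1) + f (-n)) := by
  rw [sum_Icc_neg_pair]
  induction M with
  | zero => simp
  | succ M ih =>
    rw [Finset.sum_range_succ, Finset.sum_range_succ]
    push_cast
    linear_combination ih

theorem zeta1_ofReal {L δ : ℝ} (hL : 0 < L) (hδ : 0 < δ) (y : ℝ) :
    zeta1 L δ y = (Real.pi / L : ℝ) *
      (Complex.cot ((Real.pi / L * y : ℝ)) +
        4 * sineSeries (2 * Real.pi * δ / L) 1 (Real.pi / L * y)) := by
  have ha : 0 < 2 * Real.pi * δ / L := by positivity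
  rw [zeta1]
  congr 1
  refine Filter.Tendsto.limUnder_eq ?_
  have h := (tendsto_sum_cot_pair ha one_pos (Real.pi / L * y)).const_add
    (Complex.cot ((Real.pi / L * y : ℝ)))
  refine h.congr fun M => ?_
  rw [sum_Icc_neg_pair]
  congr 1
  · congr 1
    push_cast
    ring
  · refine Finset.sum_congr rfl fun n _ => ?_
    congr 2 <;> · push_cast; ring

theorem tendsto_cot_im_atTop (w : ℝ) {b c : ℝ} (hb : 0 < b) :
    Filter.Tendsto (fun M : ℕ => Complex.cot (w + Complex.I * ((M * b + c : ℝ) : ℂ))) Filter.atTop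
      (𝓝 (-Complex.I)) := by
  have hlin : Filter.Tendsto (fun M : ℕ => (M : ℝ) * b + c) Filter.atTop Filter.atTop :=
    Filter.tendsto_atTop_add_const_right _ _
      (tendsto_natCast_atTop_atTop.atTop_mul_const hb)
  have hx : Filter.Tendsto (fun M : ℕ => Complex.exp (2 * Complex.I *
      (w + Complex.I * ((M * b + c : ℝ) : ℂ)))) Filter.atTop (𝓝 0) := by
    rw [tendsto_zero_iff_norm_tendsto_zero]
    simp only [Complex.norm_exp]
    have : ∀ M : ℕ, (2 * Complex.I * (w + Complex.I * ((M * b + c : ℝ) : ℂ))).re =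
        -(2 * (M * b + c)) := by
      intro M
      simp
    simp only [this]
    exact Real.tendsto_exp_neg_atTop_nhds_zero.comp (hlin.const_mul_atTop two_pos)
  have h1 : Filter.Tendsto (fun x : ℂ => -Complex.I - 2 * Complex.I * (x * (1 - x)⁻¹)) (𝓝 0)
      (𝓝 (-Complex.I)) := by
    have : ContinuousAt (fun x : ℂ => -Complex.I - 2 * Complex.I * (x * (1 - x)⁻¹)) 0 := by
      have : (1 : ℂ) - 0 ≠ 0 := by simp
      fun_prop (disch := assumption)
    simpa [ContinuousAt] using this
  refine (h1.comp hx).congr' ?_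
  filter_upwards [hlin.eventually_gt_atTop 0] with M hM
  rw [cot_eq_of_im_pos]
  · rfl
  · simpa using hM

/-- The unpaired cotangent moves up the imaginary axis and tends to `-i`. This is the constant in
the kernel of `T̃`, which only sees the mean of a function. -/
theorem zeta1_ofReal_add {L δ : ℝ} (hL : 0 < L) (hδ : 0 < δ) (y : ℝ) :
    zeta1 L δ (y + Complex.I * δ) = (Real.pi / L : ℝ) *
      (-Complex.I + 4 * sineSeries (2 * Real.pi * δ / L) (1 / 2) (Real.pi / L * y)) := by
  have ha : 0 < 2 * Real.pi * δ / L := by positivity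
  rw [zeta1]
  congr 1
  refine Filter.Tendsto.limUnder_eq ?_
  have h := (tendsto_cot_im_atTop (Real.pi / L * y) (c := (2 * Real.pi * δ / L) / 2) ha).add
    (tendsto_sum_cot_pair ha one_half_pos (Real.pi / L * y))
  refine h.congr fun M => ?_
  rw [sum_Icc_neg_shift]
  congr 1
  · congr 1
    push_cast
    ring
  · refine Finset.sum_congr rfl fun n _ => ?_
    congr 2 <;> · push_cast; ring

theorem continuous_sineSeries {a θ : ℝ} (ha : 0 < a) (hθ : 0 < θ) :
    Continuous (sineSeries a θ) :=
  continuous_tsum (fun j => by fun_prop) (summable_sineCoeff ha hθ) fun j w => norm_sineTerm_le ha j w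

theorem sineSeries_neg (a θ w : ℝ) : sineSeries a θ (-w) = -sineSeries a θ w := by
  simp [sineSeries, tsum_neg]

theorem sineSeries_add_pi (a θ w : ℝ) : sineSeries a θ (w + Real.pi) = sineSeries a θ w := by
  refine tsum_congr fun j => ?_
  congr 1
  have := Complex.sin_add_nat_mul_two_pi (2 * (j + 1) * w) (j + 1)
  rw [← this]
  congr 1
  push_cast
  ring

/-! ### Odd kernels with a simple pole; `T` and `T̃` as odd convolutions -/

/-- A kernel on half a period with at most a simple pole at the origin. -/
structure IsPoleKernel (L : ℝ) (K : ℝ → ℂ) : Prop where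
  measurable : Measurable K
  bound : ∃ C, ∀ s ∈ Set.Icc 0 (L / 2), ‖(s : ℂ) * K s‖ ≤ C

/-- The convolution operator whose kernel is the odd extension of `K`. -/
noncomputable def oddOp (L : ℝ) (K f : ℝ → ℂ) (x : ℝ) : ℂ :=
  (1 / (Real.pi : ℂ)) * ∫ s in (0 : ℝ)..(L / 2), K s * (f (x + s) - f (x - s))

/-- The kernel of `T`. -/
noncomputable def kerT (L δ s : ℝ) : ℂ := zeta1 L δ s

/-- The odd part of the kernel of `T̃`. -/
noncomputable def kerTt (L δ s : ℝ) : ℂ :=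
  (Real.pi / L : ℝ) * (4 * sineSeries (2 * Real.pi * δ / L) (1 / 2) (Real.pi / L * s))

theorem kerT_eq {L δ : ℝ} (hL : 0 < L) (hδ : 0 < δ) (s : ℝ) :
    kerT L δ s = (Real.pi / L : ℝ) *
      (Complex.cot ((Real.pi / L * s : ℝ)) +
        4 * sineSeries (2 * Real.pi * δ / L) 1 (Real.pi / L * s)) := zeta1_ofReal hL hδ s

theorem cot_add_pi (z : ℂ) : Complex.cot (z + Real.pi) = Complex.cot z := by
  simp [Complex.cot, Complex.cos_add_pi, Complex.sin_add_pi, neg_div_neg_eq]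

theorem kerT_neg {L δ : ℝ} (hL : 0 < L) (hδ : 0 < δ) (s : ℝ) : kerT L δ (-s) = -kerT L δ s := by
  rw [kerT_eq hL hδ, kerT_eq hL hδ]
  simp only [mul_neg, Complex.ofReal_neg, cot_neg, sineSeries_neg]
  ring

theorem kerT_add_period {L δ : ℝ} (hL : 0 < L) (hδ : 0 < δ) (s : ℝ) :
    kerT L δ (s + L) = kerT L δ s := by
  rw [kerT_eq hL hδ, kerT_eq hL hδ]
  have : Real.pi / L * (s + L) = Real.pi / L * s + Real.pi := by field_simp
  rw [this, sineSeries_add_pi]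
  push_cast
  rw [cot_add_pi]

theorem continuous_kerTt {L δ : ℝ} (hL : 0 < L) (hδ : 0 < δ) : Continuous (kerTt L δ) := by
  have := continuous_sineSeries (a := 2 * Real.pi * δ / L) (θ := 1 / 2) (by positivity) (by positivity)
  unfold kerTt
  fun_prop

theorem kerTt_neg (L δ s : ℝ) : kerTt L δ (-s) = -kerTt L δ s := by
  simp [kerTt, sineSeries_neg]

/-- Jordan's inequality `sin x ≥ 2x/π` on the quarter period. -/
theorem norm_mul_cot_le {x : ℝ} (hx : x ∈ Set.Icc 0 (Real.pi / 2)) :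
    ‖(x : ℂ) * Complex.cot x‖ ≤ Real.pi / 2 := by
  rcases hx.1.eq_or_lt with rfl | h0
  · simpa using (div_pos Real.pi_pos two_pos).le
  have h1 : 2 / Real.pi * x ≤ Real.sin x := Real.mul_le_sin h0.le hx.2
  have hs : 0 < Real.sin x := lt_of_lt_of_le (by positivity) h1
  rw [Complex.cot, ← Complex.ofReal_cos, ← Complex.ofReal_sin, ← Complex.ofReal_div,
    ← Complex.ofReal_mul, Complex.norm_real, Real.norm_eq_abs, ← mul_div_assoc, abs_div, abs_mul,
    abs_of_pos hs, abs_of_pos h0, div_le_iff₀ hs]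
  have h2 : x * |Real.cos x| ≤ x * 1 := mul_le_mul_of_nonneg_left (Real.abs_cos_le_one x) h0.le
  have h3 : Real.pi / 2 * (2 / Real.pi * x) = x := by field_simp
  have h4 := mul_le_mul_of_nonneg_left h1 (by positivity : 0 ≤ Real.pi / 2)
  linarith

theorem measurable_kerT {L δ : ℝ} (hL : 0 < L) (hδ : 0 < δ) : Measurable (kerT L δ) := by
  have h := (continuous_sineSeries (a := 2 * Real.pi * δ / L) (θ := 1) (by positivity)
    one_pos).measurable
  have e : kerT L δ = fun s => (Real.pi / L : ℝ) *
      (Complex.cos ((Real.pi / L * s : ℝ)) / Complex.sin ((Real.pi / L * s : ℝ)) +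
        4 * sineSeries (2 * Real.pi * δ / L) 1 (Real.pi / L * s)) := funext fun s => kerT_eq hL hδ s
  rw [e]
  fun_prop

theorem isPoleKernel_kerT {L δ : ℝ} (hL : 0 < L) (hδ : 0 < δ) : IsPoleKernel L (kerT L δ) := by
  refine ⟨measurable_kerT hL hδ, ?_⟩
  have hc := continuous_sineSeries (a := 2 * Real.pi * δ / L) (θ := 1) (by positivity) one_pos
  have hc' : Continuous fun s : ℝ => (s : ℂ) * ((Real.pi / L : ℝ) *
      (4 * sineSeries (2 * Real.pi * δ / L) 1 (Real.pi / L * s))) := by fun_prop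
  obtain ⟨C, hC⟩ := (isCompact_Icc (a := (0 : ℝ)) (b := L / 2)).exists_bound_of_continuousOn
    hc'.continuousOn
  refine ⟨Real.pi / 2 + C, fun s hs => ?_⟩
  have hx : Real.pi / L * s ∈ Set.Icc 0 (Real.pi / 2) := by
    refine ⟨mul_nonneg (by positivity) hs.1, ?_⟩
    have := mul_le_mul_of_nonneg_left hs.2 (by positivity : 0 ≤ Real.pi / L)
    have e : Real.pi / L * (L / 2) = Real.pi / 2 := by field_simp
    linarith
  have e : (s : ℂ) * kerT L δ s = ((Real.pi / L * s : ℝ) : ℂ) * Complex.cot ((Real.pi / L * s : ℝ))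
      + (s : ℂ) * ((Real.pi / L : ℝ) *
      (4 * sineSeries (2 * Real.pi * δ / L) 1 (Real.pi / L * s))) := by
    rw [kerT_eq hL hδ]
    push_cast
    ring
  rw [e]
  exact (norm_add_le _ _).trans (add_le_add (norm_mul_cot_le hx) (hC s hs))

theorem isPoleKernel_kerTt {L δ : ℝ} (hL : 0 < L) (hδ : 0 < δ) : IsPoleKernel L (kerTt L δ) := by
  have hc := continuous_kerTt hL hδ
  refine ⟨hc.measurable, ?_⟩
  have hc' : Continuous fun s : ℝ => (s : ℂ) * kerTt L δ s := by fun_prop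
  obtain ⟨C, hC⟩ := (isCompact_Icc (a := (0 : ℝ)) (b := L / 2)).exists_bound_of_continuousOn
    hc'.continuousOn
  exact ⟨C, hC⟩

theorem intervalIntegrable_of_bound {a b C : ℝ} {f : ℝ → ℂ} (hf : Measurable f)
    (h : ∀ s ∈ Set.uIoc a b, ‖f s‖ ≤ C) : IntervalIntegrable f volume a b := by
  rw [intervalIntegrable_iff]
  refine Measure.integrableOn_of_bounded (M := C) (by simp [Set.uIoc]) hf.aestronglyMeasurable ?_
  exact (ae_restrict_iff' measurableSet_uIoc).2 (Filter.Eventually.of_forall h)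

theorem IsPoleKernel.intervalIntegrable {L : ℝ} (hL : 0 < L) {K : ℝ → ℂ} (hK : IsPoleKernel L K) :
    IntervalIntegrable (fun s : ℝ => (s : ℂ) * K s) volume 0 (L / 2) := by
  obtain ⟨C, hC⟩ := hK.bound
  have := hK.measurable
  refine intervalIntegrable_of_bound (C := C) (by fun_prop) fun s hs => hC s ?_
  rw [Set.uIoc_of_le (by positivity)] at hs
  exact Set.Ioc_subset_Icc_self hs

theorem deriv_continuous_of_contDiff_one {f : ℝ → ℂ} (hf : ContDiff ℝ 1 f) : Continuous (deriv f) :=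
  hf.continuous_deriv le_rfl

/-- The explicit factor `s` cancels the pole of the kernel, and the remaining average is regular at
`s = 0`. -/
theorem sub_eq_mul_integral_deriv {f : ℝ → ℂ} (hf : ContDiff ℝ 1 f) (x s : ℝ) :
    f (x + s) - f (x - s) = s * ∫ θ in (-1 : ℝ)..1, deriv f (x + s * θ) := by
  have hd : ∀ θ ∈ Set.uIcc (-1 : ℝ) 1,
      HasDerivAt (fun θ : ℝ => f (x + s * θ)) ((s : ℂ) * deriv f (x + s * θ)) θ := by
    intro θ _
    have h1 : HasDerivAt f (deriv f (x + s * θ)) (x + s * θ) :=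
      (hf.differentiable one_ne_zero _).hasDerivAt
    have h2 : HasDerivAt (fun θ : ℝ => x + s * θ) s θ := by
      simpa using ((hasDerivAt_id θ).const_mul s).const_add x
    have h3 : HasDerivAt (fun θ : ℝ => f (x + s * θ)) _ θ := h1.scomp θ h2
    simpa using h3
  have hc := deriv_continuous_of_contDiff_one hf
  have := intervalIntegral.integral_eq_sub_of_hasDerivAt hd
    (Continuous.intervalIntegrable (by fun_prop) _ _)
  rw [intervalIntegral.integral_const_mul] at this
  rw [this]
  simp [sub_eq_add_neg]

theorem continuous_integral_deriv {f : ℝ → ℂ} (hf : ContDiff ℝ 1 f) :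
    Continuous fun p : ℝ × ℝ => ∫ θ in (-1 : ℝ)..1, deriv f (p.1 + p.2 * θ) := by
  have hc := deriv_continuous_of_contDiff_one hf
  exact intervalIntegral.continuous_parametric_intervalIntegral_of_continuous' (by fun_prop) _ _

theorem intervalIntegrable_oddOp {L : ℝ} (hL : 0 < L) {K : ℝ → ℂ} (hK : IsPoleKernel L K)
    {f : ℝ → ℂ} (hf : ContDiff ℝ 1 f) (x : ℝ) :
    IntervalIntegrable (fun s => K s * (f (x + s) - f (x - s))) volume 0 (L / 2) := by
  have hc : Continuous fun s : ℝ => ∫ θ in (-1 : ℝ)..1, deriv f (x + s * θ) :=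
    (continuous_integral_deriv hf).comp (by fun_prop : Continuous fun s : ℝ => (x, s))
  refine ((hK.intervalIntegrable hL).mul_continuousOn hc.continuousOn).congr ?_
  intro s _
  simp only
  rw [sub_eq_mul_integral_deriv hf]
  ring

/-- Zero mean removes the constant `-iπ/L` of the kernel. By periodicity the integral can be centred
at `x`, where oddness folds it onto half a period. -/
theorem opTt_eq {L δ : ℝ} (hL : 0 < L) (hδ : 0 < δ) {f : ℝ → ℂ} (hf : Continuous f)
    (hp : Function.Periodic f L) (h0 : ∫ x in (-(L / 2))..(L / 2), f x = 0) (x : ℝ) :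
    opTt L δ f x = oddOp L (kerTt L δ) f x := by
  have hk := continuous_kerTt hL hδ
  have hz : ∀ y : ℝ, zeta1 L δ ((y : ℂ) - x + Complex.I * δ) =
      -((Real.pi / L : ℝ) * Complex.I) + kerTt L δ (y - x) := by
    intro y
    rw [← Complex.ofReal_sub, zeta1_ofReal_add hL hδ, kerTt]
    ring
  have hper : Function.Periodic (fun y => kerTt L δ (y - x) * f y) L := by
    intro y
    simp only
    rw [hp y]
    congr 1
    rw [kerTt, kerTt]
    have : Real.pi / L * (y + L - x) = Real.pi / L * (y - x) + Real.pi := by field_simp; ring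
    rw [this, sineSeries_add_pi]
  rw [opTt, oddOp]
  congr 1
  simp only [hz, add_mul]
  rw [intervalIntegral.integral_add (Continuous.intervalIntegrable (by fun_prop) _ _)
    (Continuous.intervalIntegrable (by fun_prop) _ _), intervalIntegral.integral_const_mul, h0,
    mul_zero, zero_add]
  have h1 := hper.intervalIntegral_add_eq (-(L / 2)) (x - L / 2)
  have e1 : -(L / 2) + L = L / 2 := by ring
  have e2 : x - L / 2 = x + -(L / 2) := by ring
  have e3 : x - L / 2 + L = x + L / 2 := by ring
  rw [e1, e3, e2] at h1
  rw [h1, ← intervalIntegral.integral_comp_add_left (fun y => kerTt L δ (y - x) * f y) x]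
  simp only [add_sub_cancel_left]
  have hi : ∀ a b, IntervalIntegrable (fun s => kerTt L δ s * f (x + s)) volume a b :=
    fun a b => Continuous.intervalIntegrable (by fun_prop) _ _
  rw [← intervalIntegral.integral_add_adjacent_intervals (hi (-(L / 2)) 0) (hi 0 (L / 2))]
  have h2 := intervalIntegral.integral_comp_neg (a := 0) (b := L / 2)
    (fun s => kerTt L δ s * f (x + s))
  rw [neg_zero] at h2
  rw [← h2, ← intervalIntegral.integral_add (Continuous.intervalIntegrable (by fun_prop) _ _)
    (hi 0 (L / 2))]
  refine intervalIntegral.integral_congr fun s _ => ?_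
  simp only [kerTt_neg, ← sub_eq_add_neg]
  ring

/-- The truncated integral is centred at `x` by periodicity and folded by oddness into an integral
over `(η, L/2)`. The folded integrand is integrable up to `0`, so the principal value is an ordinary
integral. -/
theorem opT_eq {L δ : ℝ} (hL : 0 < L) (hδ : 0 < δ) {f : ℝ → ℂ} (hf : ContDiff ℝ 1 f)
    (hp : Function.Periodic f L) (x : ℝ) : opT L δ f x = oddOp L (kerT L δ) f x := by
  have hK := isPoleKernel_kerT hL hδ
  have hm := hK.measurable
  have hfm := hf.continuous.measurable
  obtain ⟨C, hC⟩ := hK.bound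
  rw [opT, oddOp]
  congr 1
  refine Filter.Tendsto.limUnder_eq ?_
  have hint := intervalIntegrable_oddOp hL hK hf x
  have hlim : Filter.Tendsto (fun η : ℝ => ∫ s in η..(L / 2), kerT L δ s * (f (x + s) - f (x - s)))
      (𝓝[>] 0) (𝓝 (∫ s in (0 : ℝ)..(L / 2), kerT L δ s * (f (x + s) - f (x - s)))) := by
    -- The limit `η → 0` is continuity of the primitive of an integrable function in its lower
    -- endpoint.
    have hcont := intervalIntegral.continuousOn_primitive_interval_left (a := 0) (b := L / 2)
      (intervalIntegrable_iff_integrableOn_Icc_of_le (by positivity) |>.1 hint |>.mono_set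
        (by rw [Set.uIcc_of_le (by positivity)]))
    have h0 := hcont 0 Set.left_mem_uIcc
    refine h0.mono_left ?_
    rw [Set.uIcc_of_le (by positivity)]
    refine (nhdsWithin_le_of_mem ?_)
    exact Filter.mem_of_superset (Ioo_mem_nhdsGT (by positivity : (0 : ℝ) < L / 2))
      Set.Ioo_subset_Icc_self
  refine hlim.congr' ?_
  have hmem : Set.Ioo 0 (L / 2) ∈ 𝓝[>] (0 : ℝ) := Ioo_mem_nhdsGT (by positivity)
  filter_upwards [hmem] with η hη
  set B : Set ℝ := {y | ∀ k : ℤ, η < |y - x - k * L|} with hB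
  have hBm : MeasurableSet B := by
    have : B = ⋂ k : ℤ, {y : ℝ | η < |y - x - k * L|} := by ext; simp [hB]
    rw [this]
    exact MeasurableSet.iInter fun k => measurableSet_lt measurable_const (by fun_prop)
  have hset : {y : ℝ | y ∈ Set.Ioc (-(L / 2)) (L / 2) ∧ ∀ k : ℤ, η < |y - x - k * L|} =
      Set.Ioc (-(L / 2)) (L / 2) ∩ B := rfl
  -- Since `B` avoids all translates `x + kL`, the cut-off integrand is still periodic and its
  -- period of integration can be moved.
  set G : ℝ → ℂ := B.indicator fun y => kerT L δ (y - x) * f y with hG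
  have hGp : Function.Periodic G L := by
    intro y
    have hiff : y + L ∈ B ↔ y ∈ B := by
      constructor
      · intro h k
        have := h (k + 1)
        push_cast at this
        convert this using 2
        ring
      · intro h k
        have := h (k - 1)
        push_cast at this
        convert this using 2
        ring
    have e : y + L - x = (y - x) + L := by ring
    by_cases hy : y ∈ B
    · rw [hG, Set.indicator_of_mem (hiff.2 hy), Set.indicator_of_mem hy, hp y, e,
        kerT_add_period hL hδ]
    · rw [hG, Set.indicator_of_notMem (fun h => hy (hiff.1 h)), Set.indicator_of_notMem hy]
  have hle : -(L / 2) ≤ L / 2 := by linarith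
  have hstep : ∫ y in Set.Ioc (-(L / 2)) (L / 2) ∩ B, zeta1 L δ ((y : ℂ) - (x : ℂ)) * f y =
      ∫ y in (-(L / 2))..(L / 2), G y := by
    rw [intervalIntegral.integral_of_le hle, hG, setIntegral_indicator hBm]
    simp only [kerT, Complex.ofReal_sub]
  rw [hset, hstep]
  have h1 := hGp.intervalIntegral_add_eq (-(L / 2)) (x - L / 2)
  have e1 : -(L / 2) + L = L / 2 := by ring
  have e2 : x - L / 2 = x + -(L / 2) := by ring
  have e3 : x - L / 2 + L = x + L / 2 := by ring
  rw [e1, e3, e2] at h1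
  rw [h1, ← intervalIntegral.integral_comp_add_left G x]
  -- Only `k = 0` restricts anything here: for `k ≠ 0` the distance `|s - kL|` is at least `L/2 >
  -- η`.
  have hGs : ∀ s, |s| ≤ L / 2 → G (x + s) = if η < |s| then kerT L δ s * f (x + s) else 0 := by
    intro s hs
    have hiff : x + s ∈ B ↔ η < |s| := by
      constructor
      · intro h
        simpa using h 0
      · intro h k
        rw [add_sub_cancel_left]
        by_cases hk : k = 0
        · simpa [hk] using h
        have h3 : (1 : ℝ) ≤ |(k : ℝ)| := by exact_mod_cast Int.one_le_abs hk
        have h4 : |(k : ℝ) * L| = |(k : ℝ)| * L := by rw [abs_mul, abs_of_pos hL]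
        have h5 := abs_sub_abs_le_abs_sub ((k : ℝ) * L) s
        rw [abs_sub_comm] at h5
        have h6 : 1 * L ≤ |(k : ℝ)| * L := mul_le_mul_of_nonneg_right h3 hL.le
        have := hη.2
        linarith
    by_cases h : η < |s|
    · rw [hG, Set.indicator_of_mem (hiff.2 h), if_pos h, add_sub_cancel_left]
    · rw [hG, Set.indicator_of_notMem (fun h' => h (hiff.1 h')), if_neg h]
  obtain ⟨D, hD⟩ := (isCompact_Icc (a := x - L / 2) (b := x + L / 2)).exists_bound_of_continuousOn
    hf.continuous.continuousOn
  have hD0 : 0 ≤ D := (norm_nonneg _).trans (hD x ⟨by linarith, by linarith⟩)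
  -- Outside the removed neighbourhood, `|s| > η` turns the pole bound into the bound `C / η` on the
  -- kernel.
  have hbd : ∀ s, |s| ≤ L / 2 → ‖G (x + s)‖ ≤ C / η * D := by
    intro s hs
    have hC0 : 0 ≤ C := (norm_nonneg _).trans (hC 0 ⟨le_rfl, by positivity⟩)
    rw [hGs s hs]
    split_ifs with h
    · rw [norm_mul]
      have hk : ‖kerT L δ s‖ ≤ C / η := by
        have h7 : ‖kerT L δ s‖ = ‖kerT L δ |s|‖ := by
          rcases abs_choice s with h' | h' <;> rw [h']
          rw [kerT_neg hL hδ, norm_neg]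
        have h8 := hC |s| ⟨abs_nonneg s, hs⟩
        rw [norm_mul, Complex.norm_real, Real.norm_eq_abs, abs_abs] at h8
        rw [h7, le_div_iff₀ hη.1]
        refine le_trans ?_ h8
        rw [mul_comm]
        exact mul_le_mul_of_nonneg_right h.le (norm_nonneg _)
      have h9 := hD (x + s) ⟨by linarith [(abs_le.1 hs).1], by linarith [(abs_le.1 hs).2]⟩
      exact mul_le_mul hk h9 (norm_nonneg _) (div_nonneg hC0 hη.1.le)
    · rw [norm_zero]
      exact mul_nonneg (div_nonneg hC0 hη.1.le) hD0
  have hGm : Measurable G := (by fun_prop : Measurable fun y => kerT L δ (y - x) * f y).indicator hBm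
  have hGi : ∀ a b, -(L / 2) ≤ a → a ≤ b → b ≤ L / 2 →
      IntervalIntegrable (fun s => G (x + s)) volume a b := by
    intro a b ha hab hb
    refine intervalIntegrable_of_bound (by fun_prop) fun s hs => hbd s ?_
    rw [Set.uIoc_of_le hab] at hs
    exact abs_le.2 ⟨by linarith [hs.1], by linarith [hs.2]⟩
  have hp2 : 0 ≤ L / 2 := by positivity
  have i1 := hGi (-(L / 2)) 0 le_rfl (by linarith) hp2
  have i2 := hGi 0 (L / 2) (by linarith) hp2 le_rfl
  have i3 : IntervalIntegrable (fun s => G (x + -s)) volume 0 (L / 2) := by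
    refine intervalIntegrable_of_bound (by fun_prop) fun s hs => hbd (-s) ?_
    rw [Set.uIoc_of_le hp2] at hs
    rw [abs_neg]
    exact abs_le.2 ⟨by linarith [hs.1], by linarith [hs.2]⟩
  rw [← intervalIntegral.integral_add_adjacent_intervals i1 i2]
  have h2 := intervalIntegral.integral_comp_neg (a := 0) (b := L / 2) (fun s => G (x + s))
  rw [neg_zero] at h2
  rw [← h2, ← intervalIntegral.integral_add i3 i2,
    ← intervalIntegral.integral_add_adjacent_intervals (b := η)
      ((i3.add i2).mono_set (by
        rw [Set.uIcc_of_le hη.1.le, Set.uIcc_of_le hp2]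
        exact Set.Icc_subset_Icc_right hη.2.le))
      ((i3.add i2).mono_set (by
        rw [Set.uIcc_of_le hη.2.le, Set.uIcc_of_le hp2]
        exact Set.Icc_subset_Icc_left hη.1.le))]
  have z1 : ∫ s in (0 : ℝ)..η, (G (x + -s) + G (x + s)) = 0 := by
    rw [intervalIntegral.integral_of_le hη.1.le]
    refine setIntegral_eq_zero_of_forall_eq_zero fun s hs => ?_
    have : |s| = s := abs_of_pos hs.1
    have h' : |s| ≤ L / 2 := by linarith [hs.2, hη.2]
    rw [hGs s h', hGs (-s) (by rwa [abs_neg]), abs_neg, if_neg, if_neg, add_zero] <;>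
      · rw [this]; exact not_lt.2 hs.2
  rw [z1, zero_add, intervalIntegral.integral_of_le hη.2.le, intervalIntegral.integral_of_le hη.2.le]
  refine (setIntegral_congr_fun measurableSet_Ioc fun s hs => ?_).symm
  have hs0 : 0 < s := hη.1.trans hs.1
  have h' : |s| ≤ L / 2 := by rw [abs_of_pos hs0]; exact hs.2
  have h'' : η < |s| := by rw [abs_of_pos hs0]; exact hs.1
  rw [hGs s h', hGs (-s) (by rwa [abs_neg]), abs_neg, if_pos h'', if_pos h'', kerT_neg hL hδ,
    ← sub_eq_add_neg]
  ring

/-! ### Families jointly smooth in space and time -/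

/-- A family `F x t` of `L`-periodic functions of `x`, jointly smooth in `x ∈ ℝ` and `t ∈ J`. -/
structure SmoothFamily (L : ℝ) (J : Set ℝ) (F : ℝ → ℝ → ℂ) : Prop where
  smooth : ContDiffOn ℝ ∞ (fun p : ℝ × ℝ => F p.1 p.2) (Set.univ ×ˢ J)
  periodic : ∀ t ∈ J, Function.Periodic (fun x => F x t) L

/-- Partial derivative in space. -/
noncomputable def dX (F : ℝ → ℝ → ℂ) (x t : ℝ) : ℂ := deriv (fun y => F y t) x

/-- Partial derivative in time. -/
noncomputable def dT (F : ℝ → ℝ → ℂ) (x t : ℝ) : ℂ := deriv (fun s => F x s) t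

namespace SmoothFamily

variable {L : ℝ} {J : Set ℝ} {F G : ℝ → ℝ → ℂ}

theorem hasFDerivAt (hJ : IsOpen J) (hF : SmoothFamily L J F) (x : ℝ) {t : ℝ} (ht : t ∈ J) :
    HasFDerivAt (fun p : ℝ × ℝ => F p.1 p.2) (fderiv ℝ (fun p : ℝ × ℝ => F p.1 p.2) (x, t)) (x, t) :=
  ((hF.smooth.differentiableOn (by simp)).differentiableAt
    ((isOpen_univ.prod hJ).mem_nhds ⟨trivial, ht⟩)).hasFDerivAt

theorem hasDerivAt_left (hJ : IsOpen J) (hF : SmoothFamily L J F) (x : ℝ) {t : ℝ} (ht : t ∈ J) :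
    HasDerivAt (fun y => F y t) (fderiv ℝ (fun p : ℝ × ℝ => F p.1 p.2) (x, t) (1, 0)) x := by
  have h : HasDerivAt (fun y : ℝ => (y, t)) ((1 : ℝ), (0 : ℝ)) x :=
    (hasDerivAt_id x).prodMk (hasDerivAt_const x t)
  exact (hF.hasFDerivAt hJ x ht).comp_hasDerivAt x h

theorem hasDerivAt_right (hJ : IsOpen J) (hF : SmoothFamily L J F) (x : ℝ) {t : ℝ} (ht : t ∈ J) :
    HasDerivAt (fun s => F x s) (fderiv ℝ (fun p : ℝ × ℝ => F p.1 p.2) (x, t) (0, 1)) t := by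
  have h : HasDerivAt (fun s : ℝ => (x, s)) ((0 : ℝ), (1 : ℝ)) t :=
    (hasDerivAt_const t x).prodMk (hasDerivAt_id t)
  exact (hF.hasFDerivAt hJ x ht).comp_hasDerivAt t h

theorem dX_eq (hJ : IsOpen J) (hF : SmoothFamily L J F) (x : ℝ) {t : ℝ} (ht : t ∈ J) :
    dX F x t = fderiv ℝ (fun p : ℝ × ℝ => F p.1 p.2) (x, t) (1, 0) :=
  (hF.hasDerivAt_left hJ x ht).deriv

theorem dT_eq (hJ : IsOpen J) (hF : SmoothFamily L J F) (x : ℝ) {t : ℝ} (ht : t ∈ J) :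
    dT F x t = fderiv ℝ (fun p : ℝ × ℝ => F p.1 p.2) (x, t) (0, 1) :=
  (hF.hasDerivAt_right hJ x ht).deriv

theorem congr (hF : SmoothFamily L J F) (h : ∀ x, ∀ t ∈ J, G x t = F x t) : SmoothFamily L J G where
  smooth := hF.smooth.congr fun p hp => h p.1 p.2 hp.2
  periodic t ht x := by
    simp only [h _ t ht]
    exact hF.periodic t ht x

theorem dX (hJ : IsOpen J) (hF : SmoothFamily L J F) : SmoothFamily L J (dX F) where
  smooth := by
    have h1 : ContDiffOn ℝ ∞ (fderiv ℝ (fun p : ℝ × ℝ => F p.1 p.2)) (Set.univ ×ˢ J) :=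
      hF.smooth.fderiv_of_isOpen (isOpen_univ.prod hJ) (by simp)
    exact (h1.clm_apply (contDiffOn_const (c := ((1 : ℝ), (0 : ℝ))))).congr fun p hp =>
      hF.dX_eq hJ p.1 hp.2
  periodic t ht x := by
    have := hF.periodic t ht
    simp only [NcILW.dX]
    rw [← deriv_comp_add_const]
    congr 1
    exact funext this

theorem dT (hJ : IsOpen J) (hF : SmoothFamily L J F) : SmoothFamily L J (dT F) where
  smooth := by
    have h1 : ContDiffOn ℝ ∞ (fderiv ℝ (fun p : ℝ × ℝ => F p.1 p.2)) (Set.univ ×ˢ J) :=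
      hF.smooth.fderiv_of_isOpen (isOpen_univ.prod hJ) (by simp)
    exact (h1.clm_apply (contDiffOn_const (c := ((0 : ℝ), (1 : ℝ))))).congr fun p hp =>
      hF.dT_eq hJ p.1 hp.2
  periodic t ht x := by
    simp only [NcILW.dT]
    refine Filter.EventuallyEq.deriv_eq ?_
    filter_upwards [hJ.mem_nhds ht] with s hs
    exact hF.periodic s hs x

theorem dT_dX (hJ : IsOpen J) (hF : SmoothFamily L J F) (x : ℝ) {t : ℝ} (ht : t ∈ J) :
    NcILW.dT (NcILW.dX F) x t = NcILW.dX (NcILW.dT F) x t := by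
  set Φ := fun p : ℝ × ℝ => F p.1 p.2 with hΦ
  have hmem : (Set.univ ×ˢ J) ∈ 𝓝 (x, t) := (isOpen_univ.prod hJ).mem_nhds ⟨trivial, ht⟩
  have h1 : ContDiffOn ℝ ∞ (fderiv ℝ Φ) (Set.univ ×ˢ J) :=
    hF.smooth.fderiv_of_isOpen (isOpen_univ.prod hJ) (by simp)
  have h2 : HasFDerivAt (fderiv ℝ Φ) (fderiv ℝ (fderiv ℝ Φ) (x, t)) (x, t) :=
    ((h1.differentiableOn (by simp)).differentiableAt hmem).hasFDerivAt
  have hsym : IsSymmSndFDerivAt ℝ Φ (x, t) := by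
    refine (hF.smooth.contDiffAt hmem).isSymmSndFDerivAt ?_
    simp only [minSmoothness_of_isRCLikeNormedField]
    exact WithTop.coe_le_coe.2 (le_top : (2 : ℕ∞) ≤ ⊤)
  have hx : HasDerivAt (fun s : ℝ => (x, s)) ((0 : ℝ), (1 : ℝ)) t :=
    (hasDerivAt_const t x).prodMk (hasDerivAt_id t)
  have hy : HasDerivAt (fun y : ℝ => (y, t)) ((1 : ℝ), (0 : ℝ)) x :=
    (hasDerivAt_id x).prodMk (hasDerivAt_const x t)
  have a1 : NcILW.dT (NcILW.dX F) x t = fderiv ℝ (fderiv ℝ Φ) (x, t) (0, 1) (1, 0) := by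
    have e : (fun s => NcILW.dX F x s) =ᶠ[𝓝 t] fun s => fderiv ℝ Φ (x, s) (1, 0) := by
      filter_upwards [hJ.mem_nhds ht] with s hs
      exact hF.dX_eq hJ x hs
    rw [NcILW.dT, e.deriv_eq]
    have h3 : HasDerivAt (fun s => fderiv ℝ Φ (x, s)) _ t := h2.comp_hasDerivAt t hx
    exact ((ContinuousLinearMap.apply ℝ ℂ ((1 : ℝ), (0 : ℝ))).hasFDerivAt.comp_hasDerivAt t h3).deriv
  have a2 : NcILW.dX (NcILW.dT F) x t = fderiv ℝ (fderiv ℝ Φ) (x, t) (1, 0) (0, 1) := by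
    have e : (fun y => NcILW.dT F y t) = fun y => fderiv ℝ Φ (y, t) (0, 1) :=
      funext fun y => hF.dT_eq hJ y ht
    rw [NcILW.dX, e]
    have h3 : HasDerivAt (fun y => fderiv ℝ Φ (y, t)) _ x := h2.comp_hasDerivAt x hy
    exact ((ContinuousLinearMap.apply ℝ ℂ ((0 : ℝ), (1 : ℝ))).hasFDerivAt.comp_hasDerivAt x h3).deriv
  rw [a1, a2]
  exact hsym.eq _ _

theorem slice (hF : SmoothFamily L J F) {t : ℝ} (ht : t ∈ J) : SmoothPeriodic L fun x => F x t :=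
  ⟨hF.smooth.comp_contDiff (f := fun x : ℝ => (x, t)) (by fun_prop) fun _ => ⟨trivial, ht⟩,
    hF.periodic t ht⟩

theorem of_slice {f : ℝ → ℂ} (hf : SmoothPeriodic L f) : SmoothFamily L J fun x _ => f x :=
  ⟨(hf.1.comp contDiff_fst).contDiffOn, fun _ _ => hf.2⟩

theorem const (c : ℂ) : SmoothFamily L J fun _ _ => c :=
  of_slice ⟨contDiff_const, fun _ => rfl⟩

theorem add (hF : SmoothFamily L J F) (hG : SmoothFamily L J G) :
    SmoothFamily L J fun x t => F x t + G x t :=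
  ⟨hF.smooth.add hG.smooth, fun t ht => (hF.periodic t ht).add (hG.periodic t ht)⟩

theorem mul (hF : SmoothFamily L J F) (hG : SmoothFamily L J G) :
    SmoothFamily L J fun x t => F x t * G x t :=
  ⟨hF.smooth.mul hG.smooth, fun t ht => (hF.periodic t ht).mul (hG.periodic t ht)⟩

theorem const_mul (c : ℂ) (hF : SmoothFamily L J F) : SmoothFamily L J fun x t => c * F x t :=
  (const c).mul hF

theorem sum {ι : Type*} {s : Finset ι} {F : ι → ℝ → ℝ → ℂ} (h : ∀ i ∈ s, SmoothFamily L J (F i)) :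
    SmoothFamily L J fun x t => ∑ i ∈ s, F i x t := by
  classical
  induction s using Finset.induction_on with
  | empty => simpa using const 0
  | insert a s ha ih =>
    simp only [Finset.sum_insert ha]
    exact (h a (by simp)).add (ih fun i hi => h i (by simp [hi]))

theorem contDiff_one_slice (hF : SmoothFamily L J F) {t : ℝ} (ht : t ∈ J) :
    ContDiff ℝ 1 fun x => F x t := (hF.slice ht).1.of_le (by simp)

/-- This is the symmetric difference quotient `(F(x+s) - F(x-s))/s`, written as an average of `∂_x
F` so that it is smooth across `s = 0`. -/
theorem smooth_average (hJ : IsOpen J) (hF : SmoothFamily L J F) :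
    ContDiffOn ℝ ∞ (fun q : (ℝ × ℝ) × ℝ =>
      ∫ θ in (-1 : ℝ)..1, (1 : ℂ) • NcILW.dX F (q.1.1 + q.2 * θ) q.1.2)
      ((Set.univ ×ˢ J) ×ˢ Set.univ) := by
  refine contDiffOn_integral_kernel_mul (k := fun _ => (1 : ℂ))
    (Φ := fun z : ((ℝ × ℝ) × ℝ) × ℝ => NcILW.dX F (z.1.1.1 + z.1.2 * z.2) z.1.1.2)
    ((isOpen_univ.prod hJ).prod isOpen_univ) (by simp) ?_
  exact (hF.dX hJ).smooth.comp (f := fun z : ((ℝ × ℝ) × ℝ) × ℝ =>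
    (z.1.1.1 + z.1.2 * z.2, z.1.1.2)) (by fun_prop) fun z hz => ⟨trivial, hz.1.1.2⟩

theorem mul_average (hF : SmoothFamily L J F) (x s : ℝ) {t : ℝ} (ht : t ∈ J) :
    (s : ℂ) * ∫ θ in (-1 : ℝ)..1, (1 : ℂ) • NcILW.dX F (x + s * θ) t = F (x + s) t - F (x - s) t := by
  simp only [one_smul]
  exact (sub_eq_mul_integral_deriv (hF.contDiff_one_slice ht) x s).symm

theorem oddOp_eq (hF : SmoothFamily L J F) (K : ℝ → ℂ) (x : ℝ) {t : ℝ} (ht : t ∈ J) :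
    NcILW.oddOp L K (fun y => F y t) x = (1 / (Real.pi : ℂ)) * ∫ s in (0 : ℝ)..(L / 2),
      ((s : ℂ) * K s) • ∫ θ in (-1 : ℝ)..1, (1 : ℂ) • NcILW.dX F (x + s * θ) t := by
  rw [NcILW.oddOp]
  congr 1
  refine intervalIntegral.integral_congr fun s _ => ?_
  rw [← hF.mul_average x s ht, smul_eq_mul]
  ring

theorem oddOp (hL : 0 < L) (hJ : IsOpen J) {K : ℝ → ℂ} (hK : IsPoleKernel L K)
    (hF : SmoothFamily L J F) :
    SmoothFamily L J fun x t => NcILW.oddOp L K (fun y => F y t) x where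
  smooth := by
    have h := contDiffOn_integral_kernel_mul (isOpen_univ.prod hJ) (hK.intervalIntegrable hL)
      (hF.smooth_average hJ)
    exact (contDiffOn_const.mul h).congr fun p hp => hF.oddOp_eq K p.1 hp.2
  periodic t ht x := by
    have := hF.periodic t ht
    simp only [NcILW.oddOp]
    congr 1
    refine intervalIntegral.integral_congr fun s _ => ?_
    have h1 := this (x + s)
    have h2 := this (x - s)
    simp only at h1 h2
    rw [add_right_comm, h1, ← h2]
    congr 3
    ring

/-- Both `∂_x` and `∂_t` commute with the operator. They are treated at once as directional
derivatives in the parameter `(x, t)`. -/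
theorem fderiv_oddOp (hL : 0 < L) (hJ : IsOpen J) {K : ℝ → ℂ} (hK : IsPoleKernel L K)
    (hF : SmoothFamily L J F) (x : ℝ) {t : ℝ} (ht : t ∈ J) (v : ℝ × ℝ) :
    fderiv ℝ (fun p : ℝ × ℝ => NcILW.oddOp L K (fun y => F y p.2) p.1) (x, t) v =
      NcILW.oddOp L K (fun y => fderiv ℝ (fun p : ℝ × ℝ => F p.1 p.2) (y, t) v) x := by
  have hsm := hF.smooth_average hJ
  set Φ := fun q : (ℝ × ℝ) × ℝ =>
    ∫ θ in (-1 : ℝ)..1, (1 : ℂ) • NcILW.dX F (q.1.1 + q.2 * θ) q.1.2 with hΦ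
  have hU : IsOpen ((Set.univ : Set ℝ) ×ˢ J) := isOpen_univ.prod hJ
  have hmem : (x, t) ∈ (Set.univ : Set ℝ) ×ˢ J := ⟨trivial, ht⟩
  have hsm1 : ContDiffOn ℝ 1 Φ ((Set.univ ×ˢ J) ×ˢ Set.univ) := hsm.of_le (by simp)
  have h := hasFDerivAt_integral_kernel_mul hU (hK.intervalIntegrable hL) hsm1 hmem
  have hint : IntervalIntegrable (fun s : ℝ => ((s : ℂ) * K s) •
      fderiv ℝ (fun q => Φ (q, s)) (x, t)) volume 0 (L / 2) := by
    refine (hK.intervalIntegrable hL).smul_continuousOn (Continuous.continuousOn ?_)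
    have hUo : IsOpen (((Set.univ : Set ℝ) ×ˢ J) ×ˢ (Set.univ : Set ℝ)) := hU.prod isOpen_univ
    have hcd : ContinuousOn (fun z => (fderiv ℝ Φ z).comp (ContinuousLinearMap.inl ℝ (ℝ × ℝ) ℝ))
        ((Set.univ ×ˢ J) ×ˢ Set.univ) :=
      (hsm1.continuousOn_fderiv_of_isOpen hUo le_rfl).clm_comp continuousOn_const
    refine (hcd.comp_continuous (by fun_prop : Continuous fun s : ℝ => ((x, t), s))
      fun s => ⟨hmem, trivial⟩).congr fun s => ?_
    have h1 : HasFDerivAt Φ (fderiv ℝ Φ ((x, t), s)) ((x, t), s) :=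
      ((hsm1.differentiableOn one_ne_zero).differentiableAt
        (hUo.mem_nhds ⟨hmem, trivial⟩)).hasFDerivAt
    exact (hasFDerivAt_slice h1).fderiv.symm
  have hev : (fun p : ℝ × ℝ => NcILW.oddOp L K (fun y => F y p.2) p.1) =ᶠ[𝓝 (x, t)]
      fun p => (1 / (Real.pi : ℂ)) * ∫ s in (0 : ℝ)..(L / 2), ((s : ℂ) * K s) • Φ (p, s) := by
    filter_upwards [hU.mem_nhds hmem] with p hp
    exact hF.oddOp_eq K p.1 hp.2
  rw [hev.fderiv_eq, (h.const_mul (1 / (Real.pi : ℂ))).fderiv, NcILW.oddOp]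
  simp only [smul_apply, smul_eq_mul]
  congr 1
  rw [ContinuousLinearMap.intervalIntegral_apply hint]
  refine intervalIntegral.integral_congr fun s _ => ?_
  simp only [smul_apply, smul_eq_mul]
  have hd : HasFDerivAt (fun q => Φ (q, s)) (fderiv ℝ (fun q => Φ (q, s)) (x, t)) (x, t) := by
    refine DifferentiableAt.hasFDerivAt ?_
    have h1 : HasFDerivAt Φ (fderiv ℝ Φ ((x, t), s)) ((x, t), s) :=
      ((hsm1.differentiableOn one_ne_zero).differentiableAt
        ((hU.prod isOpen_univ).mem_nhds ⟨hmem, trivial⟩)).hasFDerivAt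
    exact (hasFDerivAt_slice h1).differentiableAt
  -- Differentiating both expressions for the symmetric difference identifies `s` times the
  -- derivative of `Φ`, without dividing by `s`; the kernel supplies the factor `s`.
  have hev2 : (fun q : ℝ × ℝ => (s : ℂ) * Φ (q, s)) =ᶠ[𝓝 (x, t)]
      fun q => F (q.1 + s) q.2 - F (q.1 - s) q.2 := by
    filter_upwards [hU.mem_nhds hmem] with p hp
    exact hF.mul_average p.1 s hp.2
  have e1 := (hd.const_mul (s : ℂ)).congr_of_eventuallyEq hev2.symm
  have g1 : HasFDerivAt (fun q : ℝ × ℝ => F (q.1 + s) q.2) (fderiv ℝ (fun p : ℝ × ℝ => F p.1 p.2)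
      (x + s, t)) (x, t) := by
    have ha : HasFDerivAt (fun q : ℝ × ℝ => q + (s, 0)) (ContinuousLinearMap.id ℝ (ℝ × ℝ)) (x, t) :=
      (hasFDerivAt_id _).add_const _
    have hb : HasFDerivAt (fun p : ℝ × ℝ => F p.1 p.2) (fderiv ℝ (fun p : ℝ × ℝ => F p.1 p.2)
      (x + s, t)) ((x, t) + (s, 0)) := by simpa using hF.hasFDerivAt hJ (x + s) ht
    have := hb.comp (x, t) ha
    simpa [Function.comp_def] using this
  have g2 : HasFDerivAt (fun q : ℝ × ℝ => F (q.1 - s) q.2) (fderiv ℝ (fun p : ℝ × ℝ => F p.1 p.2)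
      (x - s, t)) (x, t) := by
    have ha : HasFDerivAt (fun q : ℝ × ℝ => q - (s, 0)) (ContinuousLinearMap.id ℝ (ℝ × ℝ)) (x, t) :=
      (hasFDerivAt_id _).sub_const _
    have hb : HasFDerivAt (fun p : ℝ × ℝ => F p.1 p.2) (fderiv ℝ (fun p : ℝ × ℝ => F p.1 p.2)
      (x - s, t)) ((x, t) - (s, 0)) := by simpa using hF.hasFDerivAt hJ (x - s) ht
    have := hb.comp (x, t) ha
    simpa [Function.comp_def] using this
  have e2 := congrArg (fun A : ℝ × ℝ →L[ℝ] ℂ => A v) (e1.unique (g1.sub g2))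
  simp only [smul_apply, sub_apply, smul_eq_mul] at e2
  rw [← e2]
  ring

theorem dT_oddOp (hL : 0 < L) (hJ : IsOpen J) {K : ℝ → ℂ} (hK : IsPoleKernel L K)
    (hF : SmoothFamily L J F) (x : ℝ) {t : ℝ} (ht : t ∈ J) :
    NcILW.dT (fun x t => NcILW.oddOp L K (fun y => F y t) x) x t =
      NcILW.oddOp L K (fun y => NcILW.dT F y t) x := by
  rw [(hF.oddOp hL hJ hK).dT_eq hJ x ht, hF.fderiv_oddOp hL hJ hK x ht]
  congr 1
  exact funext fun y => (hF.dT_eq hJ y ht).symm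

theorem dX_oddOp (hL : 0 < L) (hJ : IsOpen J) {K : ℝ → ℂ} (hK : IsPoleKernel L K)
    (hF : SmoothFamily L J F) (x : ℝ) {t : ℝ} (ht : t ∈ J) :
    NcILW.dX (fun x t => NcILW.oddOp L K (fun y => F y t) x) x t =
      NcILW.oddOp L K (fun y => NcILW.dX F y t) x := by
  rw [(hF.oddOp hL hJ hK).dX_eq hJ x ht, hF.fderiv_oddOp hL hJ hK x ht]
  congr 1
  exact funext fun y => (hF.dX_eq hJ y ht).symm

end SmoothFamily

/-! ### Single smooth periodic functions, as families constant in time -/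

namespace SmoothPeriodic

variable {L : ℝ} {f g : ℝ → ℂ}

theorem const (c : ℂ) : SmoothPeriodic L fun _ => c := ⟨contDiff_const, fun _ => rfl⟩

theorem add (hf : SmoothPeriodic L f) (hg : SmoothPeriodic L g) : SmoothPeriodic L (f + g) :=
  ⟨hf.1.add hg.1, hf.2.add hg.2⟩

theorem mul (hf : SmoothPeriodic L f) (hg : SmoothPeriodic L g) : SmoothPeriodic L (f * g) :=
  ⟨hf.1.mul hg.1, hf.2.mul hg.2⟩

theorem deriv (hf : SmoothPeriodic L f) : SmoothPeriodic L (deriv f) :=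
  ((SmoothFamily.of_slice (J := Set.univ) hf).dX isOpen_univ).slice (Set.mem_univ 0)

theorem oddOp (hL : 0 < L) {K : ℝ → ℂ} (hK : IsPoleKernel L K) (hf : SmoothPeriodic L f) :
    SmoothPeriodic L (oddOp L K f) :=
  ((SmoothFamily.of_slice (J := Set.univ) hf).oddOp hL isOpen_univ hK).slice (Set.mem_univ 0)

theorem deriv_oddOp (hL : 0 < L) {K : ℝ → ℂ} (hK : IsPoleKernel L K) (hf : SmoothPeriodic L f) :
    _root_.deriv (NcILW.oddOp L K f) = NcILW.oddOp L K (_root_.deriv f) :=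
  funext fun x => (SmoothFamily.of_slice (J := Set.univ) hf).dX_oddOp hL isOpen_univ hK x
    (Set.mem_univ 0)

theorem contDiff_one (hf : SmoothPeriodic L f) : ContDiff ℝ 1 f := hf.1.of_le (by simp)

theorem continuous (hf : SmoothPeriodic L f) : Continuous f := hf.1.continuous

theorem hasDerivAt (hf : SmoothPeriodic L f) (x : ℝ) : HasDerivAt f (_root_.deriv f x) x :=
  (hf.contDiff_one.differentiable one_ne_zero x).hasDerivAt

theorem integral_deriv (hf : SmoothPeriodic L f) :
    ∫ x in (-(L / 2))..(L / 2), _root_.deriv f x = 0 := by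
  rw [intervalIntegral.integral_eq_sub_of_hasDerivAt (fun x _ => hf.hasDerivAt x)
    (hf.deriv.continuous.intervalIntegrable _ _)]
  have := hf.2 (-(L / 2))
  rw [show -(L / 2) + L = L / 2 by ring] at this
  rw [this, sub_self]

theorem opT_eq {δ : ℝ} (hL : 0 < L) (hδ : 0 < δ) (hf : SmoothPeriodic L f) :
    opT L δ f = NcILW.oddOp L (kerT L δ) f :=
  funext fun x => NcILW.opT_eq hL hδ hf.contDiff_one hf.2 x

theorem opTt_deriv_eq {δ : ℝ} (hL : 0 < L) (hδ : 0 < δ) (hf : SmoothPeriodic L f) :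
    opTt L δ (_root_.deriv f) = NcILW.oddOp L (kerTt L δ) (_root_.deriv f) :=
  funext fun x => NcILW.opTt_eq hL hδ hf.deriv.continuous hf.deriv.2 hf.integral_deriv x

end SmoothPeriodic

/-! ### Antisymmetry of odd convolutions -/

theorem integral_comp_add_of_periodic {L : ℝ} {f : ℝ → ℂ} (hf : Function.Periodic f L) (s : ℝ) :
    ∫ x in (-(L / 2))..(L / 2), f (x + s) = ∫ x in (-(L / 2))..(L / 2), f x := by
  rw [intervalIntegral.integral_comp_add_right]
  have := hf.intervalIntegral_add_eq (-(L / 2) + s) (-(L / 2))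
  rwa [show -(L / 2) + s + L = L / 2 + s by ring, show -(L / 2) + L = L / 2 by ring] at this

/-- Fubini applies because the symmetric difference of `f` is `O(s)`, so the integrand on the
product is bounded despite the pole. -/
theorem integral_integral_oddOp {L : ℝ} (hL : 0 < L) {K f g : ℝ → ℂ} (hK : IsPoleKernel L K)
    (hf : SmoothPeriodic L f) (hg : SmoothPeriodic L g) :
    ∫ x in (-(L / 2))..(L / 2), oddOp L K f x * g x = (1 / (Real.pi : ℂ)) *
      ∫ s in (0 : ℝ)..(L / 2), ∫ x in (-(L / 2))..(L / 2),
        K s * (f (x + s) - f (x - s)) * g x := by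
  have h1 : ∀ x, oddOp L K f x * g x = (1 / (Real.pi : ℂ)) *
      ∫ s in (0 : ℝ)..(L / 2), K s * (f (x + s) - f (x - s)) * g x := by
    intro x
    rw [oddOp, mul_assoc, intervalIntegral.integral_mul_const]
  simp only [h1]
  rw [intervalIntegral.integral_const_mul]
  congr 1
  have hp2 : 0 ≤ L / 2 := by positivity
  have hle : -(L / 2) ≤ L / 2 := by linarith
  simp only [intervalIntegral.integral_of_le hp2, intervalIntegral.integral_of_le hle]
  refine integral_integral_swap ?_
  rw [Measure.prod_restrict]
  have hcont : Continuous fun p : ℝ × ℝ =>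
      (∫ θ in (-1 : ℝ)..1, deriv f (p.1 + p.2 * θ)) * g p.1 :=
    (continuous_integral_deriv hf.contDiff_one).mul (hg.continuous.comp continuous_fst)
  obtain ⟨D, hD⟩ := ((isCompact_Icc (a := -(L / 2)) (b := L / 2)).prod
    (isCompact_Icc (a := 0) (b := L / 2))).exists_bound_of_continuousOn hcont.continuousOn
  obtain ⟨C, hC⟩ := hK.bound
  have hKm := hK.measurable
  have hfm := hf.continuous.measurable
  have hgm := hg.continuous.measurable
  refine Measure.integrableOn_of_bounded (M := C * D) ?_ ?_ ?_
  · rw [← Measure.volume_eq_prod, Measure.volume_eq_prod, Measure.prod_prod]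
    simp [ENNReal.mul_eq_top]
  · refine Measurable.aestronglyMeasurable ?_
    simp only [Function.uncurry_def]
    fun_prop
  · refine (ae_restrict_iff' (measurableSet_Ioc.prod measurableSet_Ioc)).2
      (Filter.Eventually.of_forall fun p hp => ?_)
    have e : Function.uncurry (fun x s => K s * (f (x + s) - f (x - s)) * g x) p =
        ((p.2 : ℂ) * K p.2) * ((∫ θ in (-1 : ℝ)..1, deriv f (p.1 + p.2 * θ)) * g p.1) := by
      simp only [Function.uncurry_def]
      rw [sub_eq_mul_integral_deriv hf.contDiff_one]
      ring
    rw [e, norm_mul]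
    have b1 := hC p.2 (Set.Ioc_subset_Icc_self hp.2)
    have b2 := hD p ⟨Set.Ioc_subset_Icc_self hp.1, Set.Ioc_subset_Icc_self hp.2⟩
    exact mul_le_mul b1 b2 (norm_nonneg _) ((norm_nonneg _).trans b1)

/-- For fixed `s`, translation over a period moves the shift from one factor to the other with
opposite sign. The symmetric difference is therefore antisymmetric before any integration in `s`. -/
theorem integral_oddOp_mul {L : ℝ} (hL : 0 < L) {K f g : ℝ → ℂ} (hK : IsPoleKernel L K)
    (hf : SmoothPeriodic L f) (hg : SmoothPeriodic L g) :
    ∫ x in (-(L / 2))..(L / 2), oddOp L K f x * g x =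
      -∫ x in (-(L / 2))..(L / 2), f x * oddOp L K g x := by
  have h2 := integral_integral_oddOp hL hK hg hf
  simp only [mul_comm (f _) (oddOp L K g _)]
  rw [integral_integral_oddOp hL hK hf hg, h2, ← mul_neg, ← intervalIntegral.integral_neg]
  congr 1
  refine intervalIntegral.integral_congr fun s _ => ?_
  have cf := hf.continuous
  have cg := hg.continuous
  have shift : ∀ {a b : ℝ → ℂ}, SmoothPeriodic L a → SmoothPeriodic L b →
      ∫ x in (-(L / 2))..(L / 2), a (x + s) * b x =
        ∫ x in (-(L / 2))..(L / 2), a x * b (x - s) := by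
    intro a b ha hb
    have hp : Function.Periodic (fun x => a x * b (x - s)) L := by
      intro x
      have := hb.2 (x - s)
      simp only
      rw [ha.2 x, ← this]
      congr 2
      ring
    rw [← integral_comp_add_of_periodic hp s]
    simp
  have expand : ∀ {a b : ℝ → ℂ}, SmoothPeriodic L a → SmoothPeriodic L b →
      ∫ x in (-(L / 2))..(L / 2), K s * (a (x + s) - a (x - s)) * b x =
        K s * ((∫ x in (-(L / 2))..(L / 2), a (x + s) * b x) -
          ∫ x in (-(L / 2))..(L / 2), b x * a (x - s)) := by
    intro a b ha hb
    have ca := ha.continuous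
    have cb := hb.continuous
    rw [← intervalIntegral.integral_sub (Continuous.intervalIntegrable (by fun_prop) _ _)
      (Continuous.intervalIntegrable (by fun_prop) _ _), ← intervalIntegral.integral_const_mul]
    refine intervalIntegral.integral_congr fun x _ => ?_
    ring
  rw [expand hf hg, expand hg hf, shift hf hg, shift hg hf]
  ring

/-! ### Fourier coefficients of smooth periodic functions -/

/-- The exponential `e^{2πimx/L}`. -/
noncomputable def expo (L : ℝ) (m : ℤ) (x : ℝ) : ℂ := Complex.exp (2 * Real.pi * Complex.I * m * x / L)

theorem expo_add (L : ℝ) (m n : ℤ) (x : ℝ) : expo L (m + n) x = expo L m x * expo L n x := by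
  rw [expo, expo, expo, ← Complex.exp_add]
  congr 1
  push_cast
  ring

theorem expo_add_right (L : ℝ) (m : ℤ) (x s : ℝ) : expo L m (x + s) = expo L m x * expo L m s := by
  rw [expo, expo, expo, ← Complex.exp_add]
  congr 1
  push_cast
  ring

theorem expo_neg (L : ℝ) (m : ℤ) (x : ℝ) : expo L (-m) x = expo L m (-x) := by
  rw [expo, expo]
  congr 1
  push_cast
  ring

theorem expo_eq (L : ℝ) (m : ℤ) (x : ℝ) :
    expo L m x = Complex.exp (((2 * Real.pi * m * x / L : ℝ) : ℂ) * Complex.I) := by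
  rw [expo]
  congr 1
  push_cast
  ring

theorem norm_expo (L : ℝ) (m : ℤ) (x : ℝ) : ‖expo L m x‖ = 1 := by
  rw [expo_eq, Complex.norm_exp_ofReal_mul_I]

theorem expo_sub_expo_neg (L : ℝ) (m : ℤ) (x : ℝ) :
    expo L m x - expo L m (-x) = 2 * Complex.I * Complex.sin ((2 * m * (Real.pi / L * x) : ℝ)) := by
  rw [expo_eq, expo_eq, Complex.sin]
  have e1 : ((2 * Real.pi * m * x / L : ℝ) : ℂ) = ((2 * m * (Real.pi / L * x) : ℝ) : ℂ) := by
    push_cast; ring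
  have e2 : ((2 * Real.pi * m * -x / L : ℝ) : ℂ) = -((2 * m * (Real.pi / L * x) : ℝ) : ℂ) := by
    push_cast; ring
  rw [e1, e2]
  linear_combination (Complex.exp (((2 * m * (Real.pi / L * x) : ℝ) : ℂ) * Complex.I)
    - Complex.exp (-((2 * m * (Real.pi / L * x) : ℝ) : ℂ) * Complex.I)) * Complex.I_sq

theorem smoothPeriodic_expo {L : ℝ} (hL : 0 < L) (m : ℤ) : SmoothPeriodic L (expo L m) := by
  constructor
  · have : ContDiff ℝ ∞ fun x : ℝ => ((2 * Real.pi * m * x / L : ℝ) : ℂ) * Complex.I := by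
      have h : ContDiff ℝ ∞ fun x : ℝ => 2 * Real.pi * m * x / L := by fun_prop
      exact (Complex.ofRealCLM.contDiff.comp h).mul contDiff_const
    simpa only [← expo_eq] using this.cexp
  · intro x
    rw [expo_add_right]
    have : expo L m L = 1 := by
      rw [expo, ← Complex.exp_int_mul_two_pi_mul_I m]
      congr 1
      have : (L : ℂ) ≠ 0 := by exact_mod_cast hL.ne'
      field_simp
    rw [this, mul_one]

theorem hasDerivAt_expo (L : ℝ) (m : ℤ) (x : ℝ) :
    HasDerivAt (expo L m) (2 * Real.pi * Complex.I * m / L * expo L m x) x := by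
  have h : HasDerivAt (fun x : ℝ => 2 * Real.pi * Complex.I * m * (x : ℂ) / L)
      (2 * Real.pi * Complex.I * m / L) x := by
    have := ((Complex.ofRealCLM.hasDerivAt (x := x)).const_mul
      (2 * Real.pi * Complex.I * m)).div_const (L : ℂ)
    simpa using this
  have := h.cexp
  rw [mul_comm (Complex.exp _)] at this
  exact this

/-- Fourier coefficients of an `L`-periodic function. -/
noncomputable def fc (L : ℝ) (f : ℝ → ℂ) (m : ℤ) : ℂ :=
  (1 / (L : ℂ)) * ∫ x in (-(L / 2))..(L / 2), f x * expo L (-m) x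

/-- The Fourier multiplier of `oddOp L K`. -/
noncomputable def mult (L : ℝ) (K : ℝ → ℂ) (m : ℤ) : ℂ :=
  (1 / (Real.pi : ℂ)) * ∫ s in (0 : ℝ)..(L / 2), K s * (expo L m s - expo L m (-s))

theorem mult_neg (L : ℝ) (K : ℝ → ℂ) (m : ℤ) : mult L K (-m) = -mult L K m := by
  rw [mult, mult, ← mul_neg, ← intervalIntegral.integral_neg]
  congr 1
  refine intervalIntegral.integral_congr fun s _ => ?_
  simp only [expo_neg, neg_neg]
  ring

theorem oddOp_expo (L : ℝ) (K : ℝ → ℂ) (m : ℤ) (x : ℝ) :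
    oddOp L K (expo L m) x = mult L K m * expo L m x := by
  rw [oddOp, mult, mul_assoc, ← intervalIntegral.integral_mul_const]
  congr 1
  refine intervalIntegral.integral_congr fun s _ => ?_
  simp only [sub_eq_add_neg x s, expo_add_right]
  ring

/-- Antisymmetry moves the operator onto `expo L (-m)`, an eigenfunction with eigenvalue `mult L K
(-m) = -mult L K m`; the two signs cancel. -/
theorem fc_oddOp {L : ℝ} (hL : 0 < L) {K f : ℝ → ℂ} (hK : IsPoleKernel L K)
    (hf : SmoothPeriodic L f) (m : ℤ) : fc L (oddOp L K f) m = mult L K m * fc L f m := by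
  have h : ∫ x in (-(L / 2))..(L / 2), f x * oddOp L K (expo L (-m)) x =
      -mult L K m * ∫ x in (-(L / 2))..(L / 2), f x * expo L (-m) x := by
    rw [← intervalIntegral.integral_const_mul]
    refine intervalIntegral.integral_congr fun x _ => ?_
    simp only [oddOp_expo, mult_neg]
    ring
  rw [fc, integral_oddOp_mul hL hK hf (smoothPeriodic_expo hL (-m)), fc, h]
  ring

theorem fc_deriv {L : ℝ} (hL : 0 < L) {f : ℝ → ℂ} (hf : SmoothPeriodic L f) (m : ℤ) :
    fc L (deriv f) m = 2 * Real.pi * Complex.I * m / L * fc L f m := by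
  have he := smoothPeriodic_expo hL (-m)
  have h0 := (hf.mul he).integral_deriv
  have hd : deriv (f * expo L (-m)) = fun x => deriv f x * expo L (-m) x +
      (-(2 * Real.pi * Complex.I * m / L)) * (f x * expo L (-m) x) := by
    funext x
    rw [((hf.hasDerivAt x).mul (hasDerivAt_expo L (-m) x)).deriv]
    push_cast
    ring
  have c1 := hf.continuous
  have c2 := hf.deriv.continuous
  have c3 := he.continuous
  rw [hd, intervalIntegral.integral_add (Continuous.intervalIntegrable (by fun_prop) _ _)
    (Continuous.intervalIntegrable (by fun_prop) _ _), intervalIntegral.integral_const_mul] at h0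
  rw [fc, fc]
  linear_combination (1 / (L : ℂ)) * h0

theorem exists_norm_fc_le {L : ℝ} (hL : 0 < L) {f : ℝ → ℂ} (hf : Continuous f) :
    ∃ C, ∀ m, ‖fc L f m‖ ≤ C := by
  obtain ⟨C, hC⟩ := (isCompact_Icc (a := -(L / 2)) (b := L / 2)).exists_bound_of_continuousOn
    hf.continuousOn
  refine ⟨‖1 / (L : ℂ)‖ * (C * |L / 2 - -(L / 2)|), fun m => ?_⟩
  rw [fc, norm_mul]
  refine mul_le_mul_of_nonneg_left ?_ (norm_nonneg _)
  refine intervalIntegral.norm_integral_le_of_norm_le_const fun x hx => ?_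
  rw [Set.uIoc_of_le (by linarith)] at hx
  rw [norm_mul, norm_expo, mul_one]
  exact hC x (Set.Ioc_subset_Icc_self hx)

/-- Two integrations by parts bound the coefficients by a multiple of `1/m²` away from `m = 0`. -/
theorem summable_fc {L : ℝ} (hL : 0 < L) {f : ℝ → ℂ} (hf : SmoothPeriodic L f) :
    Summable (fc L f) := by
  obtain ⟨C, hC⟩ := exists_norm_fc_le hL hf.deriv.deriv.continuous
  have h2 : Summable fun m : ℤ => (C * (L / (2 * Real.pi)) ^ 2) * (1 / (m : ℝ) ^ 2) :=
    (Real.summable_one_div_int_pow.2 one_lt_two).mul_left _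
  refine Summable.of_norm_bounded_eventually h2 ?_
  rw [Filter.eventually_cofinite]
  refine (Set.finite_singleton (0 : ℤ)).subset fun m hm => ?_
  by_contra hm0
  refine hm ?_
  have hm0' : (m : ℝ) ≠ 0 := by exact_mod_cast hm0
  have h := hC m
  rw [fc_deriv hL hf.deriv, fc_deriv hL hf, ← mul_assoc, norm_mul] at h
  have e : ‖2 * (Real.pi : ℂ) * Complex.I * m / L * (2 * Real.pi * Complex.I * m / L)‖ =
      (2 * Real.pi / L) ^ 2 * (m : ℝ) ^ 2 := by
    simp only [norm_mul, norm_div, Complex.norm_real, Complex.norm_I, Complex.norm_ofNat,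
      Complex.norm_intCast, Real.norm_eq_abs, abs_of_pos hL, abs_of_pos Real.pi_pos]
    rw [← sq_abs (m : ℝ)]
    ring
  rw [e] at h
  have hpos : 0 < (2 * Real.pi / L) ^ 2 * (m : ℝ) ^ 2 := by positivity
  have h3 : ‖fc L f m‖ ≤ C / ((2 * Real.pi / L) ^ 2 * (m : ℝ) ^ 2) := by
    rw [le_div_iff₀ hpos]
    linarith
  refine h3.trans_eq ?_
  field_simp

theorem hasSum_fc {L : ℝ} (hL : 0 < L) {f : ℝ → ℂ} (hf : SmoothPeriodic L f) (x : ℝ) :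
    HasSum (fun m => fc L f m * expo L m x) (f x) := by
  have : Fact (0 < L) := ⟨hL⟩
  let F : C(AddCircle L, ℂ) := ⟨hf.2.lift, by
    exact continuous_coinduced_dom.2 hf.continuous⟩
  have hF : ∀ y : ℝ, F y = f y := fun y => hf.2.lift_coe y
  have hcoe : fourierCoeff F = fc L f := by
    funext m
    rw [fourierCoeff_eq_intervalIntegral F m (-(L / 2)), fc, show -(L / 2) + L = L / 2 by ring]
    simp only [hF, fourier_coe_apply, smul_eq_mul, Complex.real_smul]
    push_cast
    congr 1
    refine intervalIntegral.integral_congr fun s _ => ?_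
    simp only [expo]
    push_cast
    ring
  have h := has_pointwise_sum_fourier_series_of_summable (f := F) (hcoe ▸ summable_fc hL hf) x
  rw [hcoe, hF] at h
  refine hasSum_of_eq (fun m => ?_) h
  rw [fourier_coe_apply, smul_eq_mul, expo]

theorem eq_zero_of_fc {L : ℝ} (hL : 0 < L) {f : ℝ → ℂ} (hf : SmoothPeriodic L f)
    (h : ∀ m, fc L f m = 0) : f = 0 := by
  funext x
  refine (hasSum_fc hL hf x).unique ?_
  simp [h, hasSum_zero]

/-- The Fourier series of `f` converges absolutely, so it can be integrated term by term against `g`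
times an exponential. -/
theorem hasSum_fc_mul {L : ℝ} (hL : 0 < L) {f g : ℝ → ℂ} (hf : SmoothPeriodic L f)
    (hg : SmoothPeriodic L g) (n : ℤ) :
    HasSum (fun k => fc L f k * fc L g (n - k)) (fc L (f * g) n) := by
  obtain ⟨C, hC⟩ := (isCompact_Icc (a := -(L / 2)) (b := L / 2)).exists_bound_of_continuousOn
    hg.continuous.continuousOn
  have hle : -(L / 2) ≤ L / 2 := by linarith
  have h := intervalIntegral.hasSum_integral_of_dominated_convergence
    (a := -(L / 2)) (b := L / 2) (μ := volume)
    (F := fun k x => fc L f k * expo L k x * (g x * expo L (-n) x))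
    (f := fun x => f x * (g x * expo L (-n) x)) (fun k _ => ‖fc L f k‖ * C) ?_ ?_ ?_ ?_ ?_
  · have h' := h.mul_left (1 / (L : ℂ))
    rw [show fc L (f * g) n = 1 / (L : ℂ) * ∫ x in (-(L / 2))..(L / 2),
      f x * (g x * expo L (-n) x) by simp only [fc, Pi.mul_apply, mul_assoc]]
    refine hasSum_of_eq (fun k => ?_) h'
    have e : ∫ x in (-(L / 2))..(L / 2), fc L f k * expo L k x * (g x * expo L (-n) x) =
        fc L f k * ∫ x in (-(L / 2))..(L / 2), g x * expo L (-(n - k)) x := by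
      rw [← intervalIntegral.integral_const_mul]
      refine intervalIntegral.integral_congr fun x _ => ?_
      simp only [show -(n - k) = k + -n by ring, expo_add]
      ring
    rw [e, fc, fc]
    ring
  · intro k
    have := (smoothPeriodic_expo hL k).continuous
    have := (smoothPeriodic_expo hL (-n)).continuous
    have := hg.continuous
    exact Continuous.aestronglyMeasurable (by fun_prop)
  · intro k
    refine Filter.Eventually.of_forall fun x hx => ?_
    rw [Set.uIoc_of_le hle] at hx
    rw [norm_mul, norm_mul, norm_mul, norm_expo, norm_expo, mul_one, mul_one]
    exact mul_le_mul_of_nonneg_left (hC x (Set.Ioc_subset_Icc_self hx)) (norm_nonneg _)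
  · exact Filter.Eventually.of_forall fun x _ => (summable_fc hL hf).norm.mul_right C
  · simp
  · exact Filter.Eventually.of_forall fun x _ => (hasSum_fc hL hf x).mul_right _

/-! ### Fourier multipliers of `T` and `T̃` -/

theorem integral_cos {L : ℝ} (hL : 0 < L) {p : ℤ} (hp : p ≠ 0) :
    ∫ s in (0 : ℝ)..(L / 2), Complex.cos ((2 * p * (Real.pi / L * s) : ℝ)) = 0 := by
  have hc : 2 * (p : ℝ) * (Real.pi / L) ≠ 0 := by
    have : (p : ℝ) ≠ 0 := by exact_mod_cast hp
    positivity
  have e : ∀ s : ℝ, Complex.cos ((2 * p * (Real.pi / L * s) : ℝ)) =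
      ((Real.cos (2 * p * (Real.pi / L) * s) : ℝ) : ℂ) := by
    intro s
    rw [← Complex.ofReal_cos, mul_assoc (2 * (p : ℝ))]
  simp only [e]
  rw [intervalIntegral.integral_ofReal, intervalIntegral.integral_comp_mul_left _ hc, _root_.integral_cos]
  have : 2 * (p : ℝ) * (Real.pi / L) * (L / 2) = p * Real.pi := by field_simp
  simp [this, Real.sin_int_mul_pi]

theorem integral_sin_mul_sin {L : ℝ} (hL : 0 < L) (j k : ℕ) :
    ∫ s in (0 : ℝ)..(L / 2), Complex.sin (2 * (j + 1) * ((Real.pi / L * s : ℝ) : ℂ)) *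
      Complex.sin (2 * (k + 1) * ((Real.pi / L * s : ℝ) : ℂ)) = if j = k then (L / 4 : ℂ) else 0 := by
  have e : ∀ s : ℝ, Complex.sin (2 * (j + 1) * ((Real.pi / L * s : ℝ) : ℂ)) *
      Complex.sin (2 * (k + 1) * ((Real.pi / L * s : ℝ) : ℂ)) =
      (1 / 2 : ℂ) * Complex.cos ((2 * ((j - k : ℤ) : ℝ) * (Real.pi / L * s) : ℝ)) -
      (1 / 2 : ℂ) * Complex.cos ((2 * ((j + k + 2 : ℤ) : ℝ) * (Real.pi / L * s) : ℝ)) := by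
    intro s
    have a1 : ((2 * ((j - k : ℤ) : ℝ) * (Real.pi / L * s) : ℝ) : ℂ) =
      2 * (j + 1) * ((Real.pi / L * s : ℝ) : ℂ) - 2 * (k + 1) * ((Real.pi / L * s : ℝ) : ℂ) := by
      push_cast; ring
    have a2 : ((2 * ((j + k + 2 : ℤ) : ℝ) * (Real.pi / L * s) : ℝ) : ℂ) =
      2 * (j + 1) * ((Real.pi / L * s : ℝ) : ℂ) + 2 * (k + 1) * ((Real.pi / L * s : ℝ) : ℂ) := by
      push_cast; ring
    rw [a1, a2, Complex.cos_sub, Complex.cos_add]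
    ring
  simp only [e]
  rw [intervalIntegral.integral_sub (Continuous.intervalIntegrable (by fun_prop) _ _)
    (Continuous.intervalIntegrable (by fun_prop) _ _), intervalIntegral.integral_const_mul,
    intervalIntegral.integral_const_mul, integral_cos hL (p := (j + k + 2 : ℤ)) (by omega)]
  split_ifs with h
  · subst h
    simp
    ring
  · rw [integral_cos hL (p := (j - k : ℤ)) (by omega)]
    simp

theorem integral_sineSeries_mul_sin {L a θ : ℝ} (hL : 0 < L) (ha : 0 < a) (hθ : 0 < θ) (k : ℕ) :
    ∫ s in (0 : ℝ)..(L / 2), sineSeries a θ (Real.pi / L * s) *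
      Complex.sin (2 * (k + 1) * ((Real.pi / L * s : ℝ) : ℂ)) = sineCoeff a θ k * (L / 4 : ℂ) := by
  have h := intervalIntegral.hasSum_integral_of_dominated_convergence
    (a := 0) (b := L / 2) (μ := volume)
    (F := fun (j : ℕ) (s : ℝ) => (sineCoeff a θ j : ℂ) *
      Complex.sin (2 * (j + 1) * ((Real.pi / L * s : ℝ) : ℂ)) *
      Complex.sin (2 * (k + 1) * ((Real.pi / L * s : ℝ) : ℂ)))
    (f := fun s => sineSeries a θ (Real.pi / L * s) *
      Complex.sin (2 * (k + 1) * ((Real.pi / L * s : ℝ) : ℂ)))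
    (fun j _ => sineCoeff a θ j) ?_ ?_ ?_ ?_ ?_
  · refine h.unique ?_
    simp only [mul_assoc, intervalIntegral.integral_const_mul]
    simp only [← mul_assoc, integral_sin_mul_sin hL]
    refine hasSum_of_eq (fun j => ?_) (hasSum_ite_eq k ((sineCoeff a θ k : ℂ) * (L / 4 : ℂ)))
    split_ifs with hjk
    · rw [hjk]
    · simp
  · intro j
    exact Continuous.aestronglyMeasurable (by fun_prop)
  · intro j
    refine Filter.Eventually.of_forall fun s _ => ?_
    rw [norm_mul]
    exact (mul_le_of_le_one_right (norm_nonneg _) (norm_sin_le k _)).trans (norm_sineTerm_le ha j _)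
  · exact Filter.Eventually.of_forall fun _ _ => summable_sineCoeff ha hθ
  · simp
  · refine Filter.Eventually.of_forall fun s _ => ?_
    have hs : Summable fun j : ℕ => (sineCoeff a θ j : ℂ) *
        Complex.sin (2 * (j + 1) * ((Real.pi / L * s : ℝ) : ℂ)) :=
      Summable.of_norm_bounded (summable_sineCoeff ha hθ) fun j => norm_sineTerm_le ha j _
    exact hs.hasSum.mul_right _

/-- Telescoping in `k`: `cot w (sin 2(k+1)w - sin 2kw) = cos 2(k+1)w + cos 2kw`. Integrability is
proved in the same induction, since the cotangent alone is not integrable at `0`. -/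
theorem intervalIntegrable_cot_mul_sin {L : ℝ} (hL : 0 < L) (k : ℕ) :
    IntervalIntegrable (fun s : ℝ => Complex.cot ((Real.pi / L * s : ℝ)) *
      Complex.sin (2 * k * ((Real.pi / L * s : ℝ) : ℂ))) volume 0 (L / 2) ∧
    ∫ s in (0 : ℝ)..(L / 2), Complex.cot ((Real.pi / L * s : ℝ)) *
      Complex.sin (2 * k * ((Real.pi / L * s : ℝ) : ℂ)) = if k = 0 then 0 else (L / 2 : ℂ) := by
  induction k with
  | zero => simp
  | succ k ih =>
    have hp2 : 0 ≤ L / 2 := by positivity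
    have e : Set.EqOn (fun s : ℝ => Complex.cot ((Real.pi / L * s : ℝ)) *
        Complex.sin (2 * k * ((Real.pi / L * s : ℝ) : ℂ)) +
        (Complex.cos ((2 * ((k + 1 : ℤ) : ℝ) * (Real.pi / L * s) : ℝ)) +
          Complex.cos ((2 * ((k : ℤ) : ℝ) * (Real.pi / L * s) : ℝ))))
        (fun s : ℝ => Complex.cot ((Real.pi / L * s : ℝ)) *
        Complex.sin (2 * (k + 1 : ℕ) * ((Real.pi / L * s : ℝ) : ℂ))) (Set.uIoc 0 (L / 2)) := by
      intro s hs
      rw [Set.uIoc_of_le hp2] at hs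
      have hx0 : 0 < Real.pi / L * s := mul_pos (by positivity) hs.1
      have hx1 : Real.pi / L * s < Real.pi := by
        have := mul_le_mul_of_nonneg_left hs.2 (by positivity : 0 ≤ Real.pi / L)
        have e : Real.pi / L * (L / 2) = Real.pi / 2 := by field_simp
        linarith [Real.pi_pos]
      have hsin : Complex.sin ((Real.pi / L * s : ℝ)) ≠ 0 := by
        rw [← Complex.ofReal_sin]
        exact_mod_cast (Real.sin_pos_of_pos_of_lt_pi hx0 hx1).ne'
      have a1 : ((2 * ((k + 1 : ℤ) : ℝ) * (Real.pi / L * s) : ℝ) : ℂ) =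
        2 * k * ((Real.pi / L * s : ℝ) : ℂ) + 2 * ((Real.pi / L * s : ℝ) : ℂ) := by
        push_cast; ring
      have a2 : ((2 * ((k : ℤ) : ℝ) * (Real.pi / L * s) : ℝ) : ℂ) =
        2 * k * ((Real.pi / L * s : ℝ) : ℂ) := by
        push_cast; ring
      have a3 : 2 * ((k + 1 : ℕ) : ℂ) * ((Real.pi / L * s : ℝ) : ℂ) =
        2 * k * ((Real.pi / L * s : ℝ) : ℂ) + 2 * ((Real.pi / L * s : ℝ) : ℂ) := by
        push_cast; ring
      simp only [a1, a2, a3]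
      generalize ((Real.pi / L * s : ℝ) : ℂ) = w at hsin
      have hw := Complex.sin_sq_add_cos_sq w
      rw [Complex.sin_add, Complex.cos_add, Complex.sin_two_mul, Complex.cos_two_mul, Complex.cot]
      field_simp
      linear_combination (-(Complex.sin (2 * k * w) * 2 * Complex.cos w)) * hw
    have i1 : IntervalIntegrable (fun s : ℝ =>
        Complex.cos ((2 * ((k + 1 : ℤ) : ℝ) * (Real.pi / L * s) : ℝ)) +
          Complex.cos ((2 * ((k : ℤ) : ℝ) * (Real.pi / L * s) : ℝ))) volume 0 (L / 2) :=
      Continuous.intervalIntegrable (by fun_prop) _ _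
    refine ⟨(ih.1.add i1).congr e, ?_⟩
    have e' := intervalIntegral.integral_congr_ae (μ := volume)
      (Filter.Eventually.of_forall fun s hs => e hs)
    rw [← e', intervalIntegral.integral_add ih.1 i1, ih.2,
      intervalIntegral.integral_add (Continuous.intervalIntegrable (by fun_prop) _ _)
      (Continuous.intervalIntegrable (by fun_prop) _ _), integral_cos hL (p := (k + 1 : ℤ)) (by omega)]
    -- Only the first increment contributes, through `cos 0 = 1`; all later cosines integrate to
    -- zero.
    by_cases hk : k = 0
    · subst hk
      simp
    · rw [integral_cos hL (p := (k : ℤ)) (by omega)]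
      simp [hk]

theorem mult_kerT_succ {L δ : ℝ} (hL : 0 < L) (hδ : 0 < δ) (k : ℕ) :
    mult L (kerT L δ) (k + 1 : ℕ) = Complex.I *
      (1 + 2 * sineCoeff (2 * Real.pi * δ / L) 1 k) := by
  have ha : 0 < 2 * Real.pi * δ / L := by positivity
  have hc := continuous_sineSeries ha one_pos
  have i1 := (intervalIntegrable_cot_mul_sin hL (k + 1)).1
  have i2 : IntervalIntegrable (fun s : ℝ => 4 * (sineSeries (2 * Real.pi * δ / L) 1
      (Real.pi / L * s) * Complex.sin (2 * (k + 1) * ((Real.pi / L * s : ℝ) : ℂ))))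
      volume 0 (L / 2) := Continuous.intervalIntegrable (by fun_prop) _ _
  have e : ∀ s : ℝ, kerT L δ s * (expo L (k + 1 : ℕ) s - expo L (k + 1 : ℕ) (-s)) =
      (2 * Complex.I * (Real.pi / L : ℝ)) * (Complex.cot ((Real.pi / L * s : ℝ)) *
      Complex.sin (2 * (k + 1 : ℕ) * ((Real.pi / L * s : ℝ) : ℂ)) +
      4 * (sineSeries (2 * Real.pi * δ / L) 1 (Real.pi / L * s) *
        Complex.sin (2 * (k + 1) * ((Real.pi / L * s : ℝ) : ℂ)))) := by
    intro s
    rw [expo_sub_expo_neg, kerT_eq hL hδ]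
    push_cast
    ring
  rw [mult]
  simp only [e]
  rw [intervalIntegral.integral_const_mul, intervalIntegral.integral_add i1 i2,
    intervalIntegral.integral_const_mul, integral_sineSeries_mul_sin hL ha one_pos,
    (intervalIntegrable_cot_mul_sin hL (k + 1)).2, if_neg (Nat.succ_ne_zero k)]
  have h1 : (L : ℂ) ≠ 0 := by exact_mod_cast hL.ne'
  have h2 : (Real.pi : ℂ) ≠ 0 := by exact_mod_cast Real.pi_ne_zero
  push_cast
  field_simp

theorem mult_kerTt_succ {L δ : ℝ} (hL : 0 < L) (hδ : 0 < δ) (k : ℕ) :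
    mult L (kerTt L δ) (k + 1 : ℕ) = Complex.I *
      (2 * sineCoeff (2 * Real.pi * δ / L) (1 / 2) k) := by
  have ha : 0 < 2 * Real.pi * δ / L := by positivity
  have e : ∀ s : ℝ, kerTt L δ s * (expo L (k + 1 : ℕ) s - expo L (k + 1 : ℕ) (-s)) =
      (8 * Complex.I * (Real.pi / L : ℝ)) *
      (sineSeries (2 * Real.pi * δ / L) (1 / 2) (Real.pi / L * s) *
        Complex.sin (2 * (k + 1) * ((Real.pi / L * s : ℝ) : ℂ))) := by
    intro s
    rw [expo_sub_expo_neg, kerTt]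
    push_cast
    ring
  rw [mult]
  simp only [e]
  rw [intervalIntegral.integral_const_mul, integral_sineSeries_mul_sin hL ha one_half_pos]
  have h1 : (L : ℂ) ≠ 0 := by exact_mod_cast hL.ne'
  have h2 : (Real.pi : ℂ) ≠ 0 := by exact_mod_cast Real.pi_ne_zero
  push_cast
  field_simp
  ring

/-- The ratio of the Fourier coefficients of the two boundary values of an analytic function. -/
noncomputable def ratio (L δ : ℝ) (m : ℤ) : ℂ := (Real.exp (-(2 * Real.pi * δ / L) * m) : ℝ)

theorem ratio_add (L δ : ℝ) (m n : ℤ) : ratio L δ (m + n) = ratio L δ m * ratio L δ n := by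
  rw [ratio, ratio, ratio, ← Complex.ofReal_mul, ← Real.exp_add]
  congr 2
  push_cast
  ring

theorem ratio_zero (L δ : ℝ) : ratio L δ 0 = 1 := by simp [ratio]

theorem one_sub_ratio_sq_ne_zero {L δ : ℝ} (hL : 0 < L) (hδ : 0 < δ) {m : ℤ} (hm : m ≠ 0) :
    1 - ratio L δ m ^ 2 ≠ 0 := by
  rw [sq, ← ratio_add, ratio, ← Complex.ofReal_one, ← Complex.ofReal_sub, Complex.ofReal_ne_zero,
    sub_ne_zero, ne_comm, Ne, Real.exp_eq_one_iff, mul_eq_zero, neg_eq_zero, not_or]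
  refine ⟨by positivity, ?_⟩
  have : m + m ≠ 0 := by omega
  exact_mod_cast this

/-- With `r = e^{-am}`, `a = 2πδ/L`, these are the multipliers `i coth(am)` and `i / sinh(am)` with
denominators cleared. Positive `m` comes from the sine coefficients, negative `m` from oddness. -/
theorem mult_mul_one_sub_ratio_sq {L δ : ℝ} (hL : 0 < L) (hδ : 0 < δ) {m : ℤ} (hm : m ≠ 0) :
    mult L (kerT L δ) m * (1 - ratio L δ m ^ 2) = Complex.I * (1 + ratio L δ m ^ 2) ∧
    mult L (kerTt L δ) m * (1 - ratio L δ m ^ 2) = Complex.I * (2 * ratio L δ m) := by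
  have key : ∀ k : ℕ, mult L (kerT L δ) (k + 1 : ℕ) * (1 - ratio L δ (k + 1 : ℕ) ^ 2) =
        Complex.I * (1 + ratio L δ (k + 1 : ℕ) ^ 2) ∧
      mult L (kerTt L δ) (k + 1 : ℕ) * (1 - ratio L δ (k + 1 : ℕ) ^ 2) =
        Complex.I * (2 * ratio L δ (k + 1 : ℕ)) := by
    intro k
    have hne := one_sub_ratio_sq_ne_zero hL hδ (m := ((k + 1 : ℕ) : ℤ)) (by omega)
    have e1 : ((sineCoeff (2 * Real.pi * δ / L) 1 k : ℝ) : ℂ) =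
        ratio L δ (k + 1 : ℕ) ^ 2 / (1 - ratio L δ (k + 1 : ℕ) ^ 2) := by
      rw [sq, ← ratio_add, ratio, sineCoeff, Complex.ofReal_div, Complex.ofReal_sub]
      push_cast
      ring_nf
    have e2 : ((sineCoeff (2 * Real.pi * δ / L) (1 / 2) k : ℝ) : ℂ) =
        ratio L δ (k + 1 : ℕ) / (1 - ratio L δ (k + 1 : ℕ) ^ 2) := by
      rw [sq, ← ratio_add, ratio, ratio, sineCoeff, Complex.ofReal_div, Complex.ofReal_sub]
      push_cast
      ring_nf
    rw [mult_kerT_succ hL hδ, mult_kerTt_succ hL hδ, e1, e2]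
    constructor
    · field_simp
      ring
    · field_simp
  rcases lt_or_gt_of_ne hm with h | h
  · obtain ⟨k, hk⟩ : ∃ k : ℕ, m = -((k + 1 : ℕ) : ℤ) := ⟨(-m - 1).toNat, by omega⟩
    subst hk
    -- Changing the sign of `m` inverts the ratio; after multiplication by `r²` the identities for
    -- `-m` become those for `m`.
    have hr : ratio L δ (-((k + 1 : ℕ) : ℤ)) * ratio L δ ((k + 1 : ℕ) : ℤ) = 1 := by
      rw [← ratio_add, neg_add_cancel, ratio_zero]
    obtain ⟨k1, k2⟩ := key k
    rw [mult_neg, mult_neg]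
    generalize ratio L δ (-((k + 1 : ℕ) : ℤ)) = r at *
    generalize ratio L δ ((k + 1 : ℕ) : ℤ) = ρ at *
    generalize mult L (kerT L δ) ((k + 1 : ℕ) : ℤ) = μ at *
    generalize mult L (kerTt L δ) ((k + 1 : ℕ) : ℤ) = ν at *
    constructor
    · linear_combination r ^ 2 * k1 + (μ + Complex.I) * (r * ρ + 1) * hr
    · linear_combination r ^ 2 * k2 + (ν * (r * ρ + 1) + 2 * Complex.I * r) * hr
  · obtain ⟨k, hk⟩ : ∃ k : ℕ, m = ((k + 1 : ℕ) : ℤ) := ⟨(m - 1).toNat, by omega⟩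
    subst hk
    exact key k

/-! ### Abstract Hilbert calculus: power series over it, evolution and traces -/

/-- A commutative algebra with a derivation `D`, an operator `H` of order one behaving like the
Hilbert transform composed with `D`, and a trace for which `D` is exact and `H` symmetric. -/
structure HilbertCalculus (R : Type*) [CommRing R] [Algebra ℂ R] where
  D : Derivation ℂ R R
  H : R →ₗ[ℂ] R
  tr : R →ₗ[ℂ] ℂ
  comm : ∀ f, H (D f) = D (H f)
  sq : ∀ f, H (H f) = -D (D f)
  plus : ∀ f g, H ((D f - Complex.I • H f) * (D g - Complex.I • H g)) =
    Complex.I • D ((D f - Complex.I • H f) * (D g - Complex.I • H g))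
  minus : ∀ f g, H ((D f + Complex.I • H f) * (D g + Complex.I • H g)) =
    -(Complex.I • D ((D f + Complex.I • H f) * (D g + Complex.I • H g)))
  tr_D : ∀ f, tr (D f) = 0
  tr_H : ∀ f, tr (H f) = 0
  tr_symm : ∀ f g, tr (f * H g) = tr (H f * g)

section Coefficientwise

variable {R : Type*} [CommRing R] [Algebra ℂ R]

/-- A linear operator acting on each coefficient of a power series. -/
noncomputable def cw (A : R →ₗ[ℂ] R) : PowerSeries R →ₗ[ℂ] PowerSeries R where
  toFun F := PowerSeries.mk fun n => A (PowerSeries.coeff n F)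
  map_add' F G := by ext n; simp
  map_smul' c F := by ext n; simp

@[simp]
theorem coeff_cw (A : R →ₗ[ℂ] R) (F : PowerSeries R) (n : ℕ) :
    PowerSeries.coeff n (cw A F) = A (PowerSeries.coeff n F) := by simp [cw]

theorem cw_X_mul (A : R →ₗ[ℂ] R) (F : PowerSeries R) :
    cw A (PowerSeries.X * F) = PowerSeries.X * cw A F := by
  ext n
  cases n <;> simp [PowerSeries.coeff_succ_X_mul]

theorem cw_C (A : R →ₗ[ℂ] R) (f : R) : cw A (PowerSeries.C f) = PowerSeries.C (A f) := by
  ext n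
  simp only [coeff_cw, PowerSeries.coeff_C]
  split_ifs <;> simp

theorem cw_derivation_mul (D : Derivation ℂ R R) (F G : PowerSeries R) :
    cw (D : R →ₗ[ℂ] R) (F * G) = F * cw (D : R →ₗ[ℂ] R) G + cw (D : R →ₗ[ℂ] R) F * G := by
  ext n
  simp only [coeff_cw, PowerSeries.coeff_mul, map_add, map_sum, Derivation.coeFn_coe,
    Derivation.leibniz, smul_eq_mul]
  rw [← Finset.sum_add_distrib]
  exact Finset.sum_congr rfl fun p _ => by ring

theorem cw_one (D : Derivation ℂ R R) : cw (D : R →ₗ[ℂ] R) 1 = 0 := by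
  have := cw_C (D : R →ₗ[ℂ] R) 1
  simpa using this

theorem cw_derivative (A : R →ₗ[ℂ] R) (F : PowerSeries R) :
    cw A (PowerSeries.derivative R F) = PowerSeries.derivative R (cw A F) := by
  ext n
  simp only [coeff_cw, PowerSeries.coeff_derivative]
  have h : (PowerSeries.coeff (n + 1) F) * ((n : R) + 1) =
      ((n : ℂ) + 1) • PowerSeries.coeff (n + 1) F := by
    rw [Algebra.smul_def]
    simp [mul_comm]
  rw [h, map_smul, Algebra.smul_def]
  simp [mul_comm]

/-- The logarithmic differential equation `E' = S' E` has only the zero solution with vanishing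
constant coefficient. -/
theorem eq_zero_of_derivative_eq {S F : PowerSeries R}
    (h : PowerSeries.derivative R F = PowerSeries.derivative R S * F)
    (h0 : PowerSeries.constantCoeff F = 0) : F = 0 := by
  have key : ∀ n, PowerSeries.coeff n F = 0 := by
    intro n
    induction n using Nat.strong_induction_on with
    | _ n ih =>
      cases n with
      | zero => simpa using h0
      | succ n =>
        have h1 := congrArg (PowerSeries.coeff n) h
        rw [PowerSeries.coeff_derivative, PowerSeries.coeff_mul, Finset.sum_eq_zero] at h1
        · have h2 : ((n : ℂ) + 1) • PowerSeries.coeff (n + 1) F = 0 := by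
            rw [Algebra.smul_def]
            simpa [mul_comm] using h1
          have h3 : (n : ℂ) + 1 ≠ 0 := by exact_mod_cast Nat.succ_ne_zero n
          rw [← one_smul ℂ (PowerSeries.coeff (n + 1) F), ← inv_mul_cancel₀ h3, mul_smul, h2,
            smul_zero]
        · intro p hp
          have := Finset.HasAntidiagonal.mem_antidiagonal.1 hp
          rw [ih p.2 (by omega), mul_zero]
  ext n
  simpa using key n

/-- The chain rule `D e^S = (D S) e^S` for a derivation of the coefficients. -/
theorem cw_exp (D : Derivation ℂ R R) {S E : PowerSeries R}
    (hE : PowerSeries.derivative R E = PowerSeries.derivative R S * E)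
    (hE0 : PowerSeries.constantCoeff E = 1) (hS0 : PowerSeries.constantCoeff S = 0) :
    cw (D : R →ₗ[ℂ] R) E = cw (D : R →ₗ[ℂ] R) S * E := by
  rw [← sub_eq_zero]
  -- The difference `DE - (DS)E` again solves `y' = S'y` in `ε`, because `D` commutes with `d/dε`,
  -- and it starts at `0`.
  refine eq_zero_of_derivative_eq (S := S) ?_ ?_
  · rw [map_sub, ← cw_derivative, hE, cw_derivation_mul, Derivation.leibniz, hE, ← cw_derivative]
    simp only [smul_eq_mul]
    ring
  · have e : ∀ F : PowerSeries R, PowerSeries.constantCoeff (cw (D : R →ₗ[ℂ] R) F) =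
        D (PowerSeries.constantCoeff F) := fun F => by
      rw [← PowerSeries.coeff_zero_eq_constantCoeff_apply, coeff_cw,
        PowerSeries.coeff_zero_eq_constantCoeff_apply, Derivation.coeFn_coe]
    simp [e, hE0, hS0]

end Coefficientwise

namespace HilbertCalculus

variable {R : Type*} [CommRing R] [Algebra ℂ R] (𝓗 : HilbertCalculus R)

/-- `D` on power series. -/
noncomputable abbrev Dc : PowerSeries R →ₗ[ℂ] PowerSeries R := cw (𝓗.D : R →ₗ[ℂ] R)

/-- `H` on power series. -/
noncomputable abbrev Hc : PowerSeries R →ₗ[ℂ] PowerSeries R := cw 𝓗.H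

theorem Hc_Dc (F : PowerSeries R) : 𝓗.Hc (𝓗.Dc F) = 𝓗.Dc (𝓗.Hc F) := by
  ext n; simp [𝓗.comm]

theorem Hc_Hc (F : PowerSeries R) : 𝓗.Hc (𝓗.Hc F) = -𝓗.Dc (𝓗.Dc F) := by
  ext n; simp [𝓗.sq]

theorem Hc_plus (F : PowerSeries R) :
    𝓗.Hc ((𝓗.Dc F - Complex.I • 𝓗.Hc F) * (𝓗.Dc F - Complex.I • 𝓗.Hc F)) =
    Complex.I • 𝓗.Dc ((𝓗.Dc F - Complex.I • 𝓗.Hc F) * (𝓗.Dc F - Complex.I • 𝓗.Hc F)) := by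
  ext n
  simp only [coeff_cw, PowerSeries.coeff_mul, map_sum, PowerSeries.coeff_smul, map_sub,
    Derivation.coeFn_coe, Finset.smul_sum]
  exact Finset.sum_congr rfl fun p _ => 𝓗.plus _ _

theorem Hc_minus (F : PowerSeries R) :
    𝓗.Hc ((𝓗.Dc F + Complex.I • 𝓗.Hc F) * (𝓗.Dc F + Complex.I • 𝓗.Hc F)) =
    -(Complex.I • 𝓗.Dc ((𝓗.Dc F + Complex.I • 𝓗.Hc F) * (𝓗.Dc F + Complex.I • 𝓗.Hc F))) := by
  ext n
  simp only [coeff_cw, PowerSeries.coeff_mul, map_sum, PowerSeries.coeff_smul, map_add, map_neg,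
    Derivation.coeFn_coe, Finset.smul_sum, ← Finset.sum_neg_distrib]
  exact Finset.sum_congr rfl fun p _ => 𝓗.minus _ _

/-- The product rule of the Hilbert transform. -/
theorem Hc_mul (F : PowerSeries R) : 𝓗.Hc (𝓗.Dc F * 𝓗.Hc F) =
    𝓗.Hc F * 𝓗.Dc (𝓗.Hc F) - 𝓗.Dc F * 𝓗.Dc (𝓗.Dc F) := by
  have hp := 𝓗.Hc_plus F
  have hm := 𝓗.Hc_minus F
  set d := 𝓗.Dc F
  set h := 𝓗.Hc F
  have hJ : algebraMap ℂ (PowerSeries R) Complex.I * algebraMap ℂ (PowerSeries R) Complex.I = -1 := by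
    rw [← map_mul, Complex.I_mul_I, map_neg, map_one]
  have e1 : (d - Complex.I • h) * (d - Complex.I • h) =
      (d * d - h * h) - Complex.I • (d * h + d * h) := by
    simp only [Algebra.smul_def]
    linear_combination h * h * hJ
  have e2 : (d + Complex.I • h) * (d + Complex.I • h) =
      (d * d - h * h) + Complex.I • (d * h + d * h) := by
    simp only [Algebra.smul_def]
    linear_combination h * h * hJ
  have e3 : 𝓗.Dc (d * d - h * h) = 2 * (d * 𝓗.Dc d - h * 𝓗.Dc h) := by
    rw [map_sub, cw_derivation_mul, cw_derivation_mul]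
    ring
  rw [e1, map_sub _ (d * d - h * h), map_sub _ (d * d - h * h), e3] at hp
  rw [e2, map_add _ (d * d - h * h), map_add _ (d * d - h * h), e3] at hm
  rw [map_smul, map_smul, map_add, map_add] at hp hm
  simp only [Algebra.smul_def] at hp hm
  -- The part `H(d² - h²)` and the term `D(dh)` drop out of `hp - hm`, leaving `-4i H(dh) = 2i D(d²
  -- - h²)`.
  refine smul_right_injective (PowerSeries R) (by norm_num : (4 : ℂ) ≠ 0) ?_
  simp only [Algebra.smul_def, map_ofNat]
  linear_combination (algebraMap ℂ (PowerSeries R) Complex.I) * (hp - hm) +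
    (4 * 𝓗.Hc (d * h) - 4 * (h * 𝓗.Dc h - d * 𝓗.Dc d)) * hJ

variable {𝓗}

/-- The factor `X` delays the right side by one order while `E` begins with `1`, so each coefficient
of `Y` is determined by the earlier ones and vanishes. -/
theorem eq_zero_of_linearised {E Y : PowerSeries R} (hE0 : PowerSeries.constantCoeff E = 1)
    (h : (2 : ℂ) • (E * Y) = PowerSeries.X * (𝓗.Hc Y + Complex.I • 𝓗.Dc Y)) : Y = 0 := by
  have key : ∀ n, PowerSeries.coeff n Y = 0 := by
    intro n
    induction n using Nat.strong_induction_on with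
    | _ n ih =>
      have h1 := congrArg (PowerSeries.coeff n) h
      have hl : PowerSeries.coeff n (E * Y) = PowerSeries.coeff n Y := by
        rw [PowerSeries.coeff_mul, Finset.sum_eq_single (0, n)]
        · simp [hE0]
        · intro p hp hne
          have hp' := Finset.HasAntidiagonal.mem_antidiagonal.1 hp
          have : p.2 < n := by
            rcases Nat.eq_zero_or_pos p.1 with h0 | h0
            · exact absurd (Prod.ext h0 (by omega)) hne
            · omega
          rw [ih p.2 this, mul_zero]
        · simp
      have hr : PowerSeries.coeff n (PowerSeries.X * (𝓗.Hc Y + Complex.I • 𝓗.Dc Y)) = 0 := by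
        cases n with
        | zero => simp
        | succ n =>
          rw [PowerSeries.coeff_succ_X_mul]
          simp [ih n (Nat.lt_succ_self n)]
      rw [PowerSeries.coeff_smul, hl, hr] at h1
      exact smul_right_injective R (two_ne_zero : (2 : ℂ) ≠ 0) (by simpa using h1)
  ext n
  simpa using key n

/-- If `U` evolves by `U_t = -2 U DU - H DU`, then the series `Ω` determined by
`ε U = 1 - e^{-Ω} - ε (H + i D) Ω / 2` evolves by the modified equation. -/
theorem evolution {Ω Ωt E : PowerSeries R} {U Ut : R}
    (hE0 : PowerSeries.constantCoeff E = 1) (hΩ0 : PowerSeries.constantCoeff Ω = 0)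
    (hE : PowerSeries.derivative R E = PowerSeries.derivative R (-Ω) * E)
    (hrel : 2 * (PowerSeries.X * PowerSeries.C U) =
      2 * (1 - E) - PowerSeries.X * (𝓗.Hc Ω + Complex.I • 𝓗.Dc Ω))
    (hrelt : 2 * (PowerSeries.X * PowerSeries.C Ut) =
      2 * (E * Ωt) - PowerSeries.X * (𝓗.Hc Ωt + Complex.I • 𝓗.Dc Ωt))
    (hU : Ut = -2 * (U * 𝓗.D U) - 𝓗.H (𝓗.D U)) :
    PowerSeries.X * Ωt = -2 * 𝓗.Dc Ω - 2 * 𝓗.Dc E +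
      PowerSeries.X * (-𝓗.Hc (𝓗.Dc Ω) + 𝓗.Dc Ω * 𝓗.Hc Ω) := by
  have hDE : 𝓗.Dc E = -(𝓗.Dc Ω * E) := by
    have := cw_exp 𝓗.D hE hE0 (by simp [hΩ0])
    rw [this, map_neg]
    ring
  set j := algebraMap ℂ (PowerSeries R) Complex.I with hj
  have hJ : j * j = -1 := by rw [hj, ← map_mul, Complex.I_mul_I, map_neg, map_one]
  have two : ∀ (A : R →ₗ[ℂ] R) (F : PowerSeries R), cw A (2 * F) = 2 * cw A F := by
    intro A F
    rw [two_mul, two_mul, map_add]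
  have cwj : ∀ (A : R →ₗ[ℂ] R) (F : PowerSeries R), cw A (j * F) = j * cw A F := by
    intro A F
    rw [hj, ← Algebra.smul_def, map_smul, Algebra.smul_def]
  -- The claimed right-hand side is shown to satisfy the differentiated Bäcklund relation that
  -- characterises `εΩ_t`; uniqueness for the linearised equation then gives equality.
  rw [← sub_eq_zero]
  refine eq_zero_of_linearised (𝓗 := 𝓗) hE0 ?_
  have hUc : (PowerSeries.C Ut : PowerSeries R) =
      -(2 * (PowerSeries.C U * 𝓗.Dc (PowerSeries.C U))) - 𝓗.Hc (𝓗.Dc (PowerSeries.C U)) := by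
    rw [cw_C, cw_C, hU, Derivation.coeFn_coe, map_sub, neg_mul, map_neg, map_mul, map_mul,
      map_ofNat]
  have hHh : 𝓗.Hc (𝓗.Hc Ω) = -𝓗.Dc (𝓗.Dc Ω) := 𝓗.Hc_Hc Ω
  have hHd : 𝓗.Hc (𝓗.Dc Ω) = 𝓗.Dc (𝓗.Hc Ω) := 𝓗.Hc_Dc Ω
  have hHd1 : 𝓗.Hc (𝓗.Dc (𝓗.Dc Ω)) = 𝓗.Dc (𝓗.Dc (𝓗.Hc Ω)) := by rw [𝓗.Hc_Dc, hHd]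
  have hHh1 : 𝓗.Hc (𝓗.Dc (𝓗.Hc Ω)) = -𝓗.Dc (𝓗.Dc (𝓗.Dc Ω)) := by rw [𝓗.Hc_Dc, hHh, map_neg]
  have hHdh := 𝓗.Hc_mul Ω
  rw [Algebra.smul_def] at hrel hrelt ⊢
  have d1 := congrArg 𝓗.Dc hrel
  rw [two, cw_X_mul, map_sub, two, map_sub, cw_one, hDE, cw_X_mul, map_add, cwj] at d1
  have d2 := congrArg 𝓗.Hc d1
  rw [two, cw_X_mul, map_sub, two, zero_sub, neg_neg, cw_X_mul, map_add, cwj, hHh1, hHd1] at d2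
  have hHK : 𝓗.Hc (-2 * 𝓗.Dc Ω - 2 * 𝓗.Dc E +
      PowerSeries.X * (-𝓗.Hc (𝓗.Dc Ω) + 𝓗.Dc Ω * 𝓗.Hc Ω)) =
      -(2 * 𝓗.Dc (𝓗.Hc Ω)) + 2 * 𝓗.Hc (𝓗.Dc Ω * E) + PowerSeries.X *
        (𝓗.Dc (𝓗.Dc (𝓗.Dc Ω)) + (𝓗.Hc Ω * 𝓗.Dc (𝓗.Hc Ω) - 𝓗.Dc Ω * 𝓗.Dc (𝓗.Dc Ω))) := by
    rw [map_add, map_sub, neg_mul, map_neg, two, two, cw_X_mul, map_add, map_neg, hHdh, hHd, hHh1,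
      hDE, map_neg]
    ring
  have hDK : 𝓗.Dc (-2 * 𝓗.Dc Ω - 2 * 𝓗.Dc E +
      PowerSeries.X * (-𝓗.Hc (𝓗.Dc Ω) + 𝓗.Dc Ω * 𝓗.Hc Ω)) =
      -(2 * 𝓗.Dc (𝓗.Dc Ω)) + 2 * (𝓗.Dc (𝓗.Dc Ω) * E - 𝓗.Dc Ω * (𝓗.Dc Ω * E)) + PowerSeries.X *
        (-𝓗.Dc (𝓗.Dc (𝓗.Hc Ω)) + 𝓗.Dc (𝓗.Dc Ω) * 𝓗.Hc Ω + 𝓗.Dc Ω * 𝓗.Dc (𝓗.Hc Ω)) := by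
    rw [map_add, map_sub, neg_mul, map_neg, two, two, cw_X_mul, map_add, map_neg,
      cw_derivation_mul, hHd, hDE, map_neg, cw_derivation_mul, hDE]
    ring
  rw [map_sub, map_sub, cw_X_mul, cw_X_mul, hHK, hDK, hHd, hDE, Algebra.smul_def, map_ofNat]
  -- The equation for `U_t` enters as `hUc`; `hrel`, `d1` and `d2` eliminate `U`, `DU` and `HDU`.
  -- The nonlocal product `H(DΩ·HΩ)` was already removed in `hHK` by `Hc_mul`.
  linear_combination -PowerSeries.X * hrelt + 2 * PowerSeries.X ^ 2 * hUc
    - 2 * PowerSeries.X * 𝓗.Dc (PowerSeries.C U) * hrel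
    - (2 * (1 - E) - PowerSeries.X * (𝓗.Hc Ω + j * 𝓗.Dc Ω)) * d1 - PowerSeries.X * d2
    - PowerSeries.X ^ 2 * 𝓗.Dc Ω * 𝓗.Dc (𝓗.Dc Ω) * hJ

theorem tr_mul_D (f g : R) : 𝓗.tr (f * 𝓗.D g) = -𝓗.tr (𝓗.D f * g) := by
  have h := 𝓗.tr_D (f * g)
  rw [Derivation.leibniz, map_add, smul_eq_mul, smul_eq_mul, mul_comm g] at h
  linear_combination h

/-- Integration by parts followed by symmetry of `H`, using that `H` and `D` commute. -/
theorem tr_D_mul_H (f g : R) : 𝓗.tr (𝓗.D f * 𝓗.H g) = -𝓗.tr (𝓗.H f * 𝓗.D g) := by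
  have h := tr_mul_D (𝓗 := 𝓗) f (𝓗.H g)
  rw [← 𝓗.comm, 𝓗.tr_symm] at h
  linear_combination h

/-- The factor `X` on the left means that `Ω_t` at order `n` is read off at order `n + 1`.
Everything there is `D`-exact except `DΩ·HΩ`. -/
theorem tr_evolution {Ω Ωt E : PowerSeries R}
    (h : PowerSeries.X * Ωt = -2 * 𝓗.Dc Ω - 2 * 𝓗.Dc E +
      PowerSeries.X * (-𝓗.Hc (𝓗.Dc Ω) + 𝓗.Dc Ω * 𝓗.Hc Ω)) (n : ℕ) :
    𝓗.tr (PowerSeries.coeff n Ωt) = 0 := by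
  have h1 := congrArg (PowerSeries.coeff (n + 1)) h
  have e2 : ∀ F : PowerSeries R, PowerSeries.coeff (n + 1) (2 * F) =
      (2 : ℂ) • PowerSeries.coeff (n + 1) F := by
    intro F
    rw [two_mul, map_add, two_smul]
  rw [PowerSeries.coeff_succ_X_mul, map_add, map_sub, PowerSeries.coeff_succ_X_mul, neg_mul, map_neg,
    e2, e2, map_add, map_neg, PowerSeries.coeff_mul] at h1
  simp only [coeff_cw, Derivation.coeFn_coe] at h1
  -- Reversing the antidiagonal and applying `tr_D_mul_H` changes the sign of the sum.
  have hanti : 𝓗.tr (∑ p ∈ Finset.HasAntidiagonal.antidiagonal n,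
      𝓗.D (PowerSeries.coeff p.1 Ω) * 𝓗.H (PowerSeries.coeff p.2 Ω)) = 0 := by
    have hs : 𝓗.tr (∑ p ∈ Finset.HasAntidiagonal.antidiagonal n,
        𝓗.D (PowerSeries.coeff p.1 Ω) * 𝓗.H (PowerSeries.coeff p.2 Ω)) =
        -𝓗.tr (∑ p ∈ Finset.HasAntidiagonal.antidiagonal n,
        𝓗.D (PowerSeries.coeff p.1 Ω) * 𝓗.H (PowerSeries.coeff p.2 Ω)) := by
      conv_lhs => rw [map_sum]
      conv_rhs => rw [← Finset.Nat.sum_antidiagonal_swap, map_sum, ← Finset.sum_neg_distrib]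
      refine Finset.sum_congr rfl fun p _ => ?_
      rw [tr_D_mul_H, mul_comm]
      rfl
    linear_combination (1 / 2 : ℂ) * hs
  rw [h1, map_add, map_sub, map_neg, map_add, map_neg, map_smul, map_smul, 𝓗.comm, 𝓗.tr_D, 𝓗.tr_D,
    𝓗.tr_D, hanti]
  simp

theorem tr_ofNat_mul (n : ℕ) [n.AtLeastTwo] (f : R) :
    𝓗.tr (ofNat(n) * f) = ofNat(n) * 𝓗.tr f := by
  have : (ofNat(n) * f : R) = (ofNat(n) : ℂ) • f := by rw [Algebra.smul_def, map_ofNat]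
  rw [this, map_smul, smul_eq_mul]

/-- The first four traces. -/
theorem tr_first_four {Ω E : PowerSeries R} {U : R}
    (hE0 : PowerSeries.constantCoeff E = 1) (hΩ0 : PowerSeries.constantCoeff Ω = 0)
    (hE : PowerSeries.derivative R E = PowerSeries.derivative R (-Ω) * E)
    (hrel : 2 * (PowerSeries.X * PowerSeries.C U) =
      2 * (1 - E) - PowerSeries.X * (𝓗.Hc Ω + Complex.I • 𝓗.Dc Ω)) :
    𝓗.tr (PowerSeries.coeff 1 Ω) = 𝓗.tr U ∧
    𝓗.tr (PowerSeries.coeff 2 Ω) = 1 / 2 * 𝓗.tr (U * U) ∧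
    𝓗.tr (PowerSeries.coeff 3 Ω) = 1 / 3 * 𝓗.tr (U * U * U) + 1 / 2 * 𝓗.tr (U * 𝓗.H U) ∧
    𝓗.tr (PowerSeries.coeff 4 Ω) = 1 / 4 * 𝓗.tr (U * U * U * U) +
      1 / 8 * 𝓗.tr (𝓗.D U * 𝓗.D U) + 3 / 8 * 𝓗.tr (𝓗.H U * 𝓗.H U) +
      3 / 4 * 𝓗.tr (U * U * 𝓗.H U) := by
  have hw0 : PowerSeries.coeff 0 Ω = 0 := by simpa using hΩ0
  have he0 : PowerSeries.coeff 0 E = 1 := by simpa using hE0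
  have two : ∀ (n : ℕ) (F : PowerSeries R), PowerSeries.coeff n (2 * F) =
      2 * PowerSeries.coeff n F := fun n F => by rw [two_mul, map_add, two_mul]
  set Q : R →ₗ[ℂ] R := 𝓗.H + Complex.I • (𝓗.D : R →ₗ[ℂ] R) with hQ
  have hQa : ∀ f, Q f = 𝓗.H f + Complex.I • 𝓗.D f := fun f => rfl
  have r : ∀ n, 2 * PowerSeries.coeff n (PowerSeries.C U) =
      -(2 * PowerSeries.coeff (n + 1) E) - Q (PowerSeries.coeff n Ω) := by
    intro n
    have h := congrArg (PowerSeries.coeff (n + 1)) hrel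
    rw [two, PowerSeries.coeff_succ_X_mul, map_sub, two, map_sub, PowerSeries.coeff_succ_X_mul,
      PowerSeries.coeff_one, if_neg (Nat.succ_ne_zero n)] at h
    rw [h, hQa]
    simp
  have r0 := r 0
  have r1 := r 1
  have r2 := r 2
  have r3 := r 3
  rw [hw0, map_zero, PowerSeries.coeff_zero_C] at r0
  rw [PowerSeries.coeff_C, if_neg (by norm_num)] at r1 r2 r3
  have q0 := congrArg (PowerSeries.coeff 0) hE
  have q1 := congrArg (PowerSeries.coeff 1) hE
  have q2 := congrArg (PowerSeries.coeff 2) hE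
  have q3 := congrArg (PowerSeries.coeff 3) hE
  simp only [PowerSeries.coeff_derivative, PowerSeries.coeff_mul, map_neg,
    Finset.Nat.sum_antidiagonal_eq_sum_range_succ_mk, Finset.sum_range_succ, Finset.sum_range_zero,
    zero_add, Nat.cast_zero, Nat.cast_one, Nat.cast_ofNat, he0, mul_one, Nat.reduceAdd,
    Nat.reduceSub, mul_zero, sub_zero] at q0 q1 q2 q3 r0 r1 r2 r3
  generalize PowerSeries.coeff 1 Ω = w1 at *
  generalize PowerSeries.coeff 2 Ω = w2 at *
  generalize PowerSeries.coeff 3 Ω = w3 at *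
  generalize PowerSeries.coeff 4 Ω = w4 at *
  generalize PowerSeries.coeff 1 E = e1 at *
  generalize PowerSeries.coeff 2 E = e2 at *
  generalize PowerSeries.coeff 3 E = e3 at *
  generalize PowerSeries.coeff 4 E = e4 at *
  have hw1 : w1 = U := by
    refine smul_right_injective R (two_ne_zero : (2 : ℂ) ≠ 0) ?_
    simp only [Algebra.smul_def, map_ofNat]
    linear_combination 2 * q0 - r0
  subst hw1
  have he1 : e1 = -w1 := by linear_combination q0
  -- These three recursions come from eliminating the coefficients of `E` between the logarithmic
  -- derivative equations `q` and the Bäcklund relations `r`.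
  have h2 : 2 * w2 = w1 * w1 + Q w1 := by
    linear_combination q1 - r1 - w1 * he1
  have h3 : 6 * w3 = 2 * (w1 * w1 * w1) + 3 * (w1 * Q w1) + 3 * Q w2 := by
    linear_combination 2 * q2 - 3 * r2 - w1 * r1 - 4 * w2 * he1 + 2 * w1 * h2
  have h4 : 8 * w4 = 4 * Q w3 + 2 * (w1 * w1 * w1 * w1) + 4 * (w1 * w1 * Q w1) + 4 * (w1 * Q w2) +
      Q w1 * Q w1 := by
    linear_combination 2 * q3 - 4 * r3 - w1 * r2 - 2 * w2 * r1 - 6 * w3 * he1 + w1 * h3 + Q w1 * h2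
  have hQ2 : 2 * Q w2 = Q (w1 * w1) + Q (Q w1) := by
    rw [← map_add, ← h2, two_mul, two_mul, map_add]
  have t3 : 𝓗.tr (w1 * w1 * 𝓗.D w1) = 0 := by
    have := 𝓗.tr_D (w1 * w1 * w1)
    rw [Derivation.leibniz, Derivation.leibniz] at this
    have e : (w1 * w1) • 𝓗.D w1 + w1 • (w1 • 𝓗.D w1 + w1 • 𝓗.D w1) =
        3 * (w1 * w1 * 𝓗.D w1) := by
      simp only [smul_eq_mul]
      ring
    rw [e, tr_ofNat_mul] at this
    simpa using this
  have tHD : 𝓗.tr (𝓗.H w1 * 𝓗.D w1) = 0 := by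
    have := tr_D_mul_H (𝓗 := 𝓗) w1 w1
    rw [mul_comm] at this
    linear_combination (1 / 2 : ℂ) * this
  -- Under the trace `Q = H + iD` is negligible alone; moved across a product it becomes `H - iD`.
  -- This accounts for the opposite signs of the `D w1 * D w1` terms in `s4` and `s5`.
  have tQ : ∀ f, 𝓗.tr (Q f) = 0 := by
    intro f
    rw [hQa, map_add, map_smul, 𝓗.tr_D, 𝓗.tr_H, smul_zero, add_zero]
  have tmQ : ∀ f g, 𝓗.tr (f * Q g) = 𝓗.tr (𝓗.H f * g) - Complex.I * 𝓗.tr (𝓗.D f * g) := by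
    intro f g
    rw [hQa, mul_add, mul_smul_comm, map_add, map_smul, 𝓗.tr_symm, tr_mul_D, smul_eq_mul]
    ring
  have tDD : 𝓗.tr (w1 * 𝓗.D w1) = 0 := by
    have := tr_mul_D (𝓗 := 𝓗) w1 w1
    rw [mul_comm (𝓗.D w1)] at this
    linear_combination (1 / 2 : ℂ) * this
  have s1 : 𝓗.tr (w1 * Q w1) = 𝓗.tr (w1 * 𝓗.H w1) := by
    rw [tmQ, ← 𝓗.tr_symm, mul_comm (𝓗.D w1), tDD]
    ring
  have s2 : 𝓗.tr (w1 * w1 * Q w1) = 𝓗.tr (w1 * w1 * 𝓗.H w1) := by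
    rw [hQa, mul_add, mul_smul_comm, map_add, map_smul, t3, smul_zero, add_zero]
  have s3 : 𝓗.tr (w1 * Q (w1 * w1)) = 𝓗.tr (w1 * w1 * 𝓗.H w1) := by
    rw [tmQ, mul_comm (𝓗.H w1), mul_comm (𝓗.D w1), t3]
    ring
  have s4 : 𝓗.tr (w1 * Q (Q w1)) = 𝓗.tr (𝓗.H w1 * 𝓗.H w1) + 𝓗.tr (𝓗.D w1 * 𝓗.D w1) := by
    rw [tmQ, hQa, mul_add, mul_add, mul_smul_comm, mul_smul_comm, map_add, map_add, map_smul,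
      map_smul, mul_comm (𝓗.D w1) (𝓗.H w1), tHD, smul_eq_mul, smul_eq_mul]
    linear_combination -𝓗.tr (𝓗.D w1 * 𝓗.D w1) * Complex.I_mul_I
  have s5 : 𝓗.tr (Q w1 * Q w1) = 𝓗.tr (𝓗.H w1 * 𝓗.H w1) - 𝓗.tr (𝓗.D w1 * 𝓗.D w1) := by
    rw [hQa, mul_add, add_mul, add_mul, smul_mul_assoc, mul_smul_comm, mul_smul_comm,
      smul_mul_assoc, map_add, map_add, map_add, map_smul, map_smul, map_smul, map_smul,
      mul_comm (𝓗.D w1) (𝓗.H w1), tHD]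
    simp only [smul_eq_mul]
    linear_combination 𝓗.tr (𝓗.D w1 * 𝓗.D w1) * Complex.I_mul_I
  have s6 : 2 * 𝓗.tr (w1 * Q w2) = 𝓗.tr (w1 * Q (w1 * w1)) + 𝓗.tr (w1 * Q (Q w1)) := by
    rw [← map_add, ← mul_add, ← hQ2, mul_left_comm, tr_ofNat_mul]
  have g2 := congrArg 𝓗.tr h2
  have g3 := congrArg 𝓗.tr h3
  have g4 := congrArg 𝓗.tr h4
  simp only [map_add, tr_ofNat_mul, tQ] at g2 g3 g4
  refine ⟨rfl, ?_, ?_, ?_⟩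
  · linear_combination (1 / 2 : ℂ) * g2
  · linear_combination (1 / 6 : ℂ) * g3 + (1 / 2 : ℂ) * s1
  · linear_combination (1 / 8 : ℂ) * (g4 + 4 * s2 + 2 * s6 + 2 * s3 + 2 * s4 + s5)

end HilbertCalculus

/-! ### Operators on the algebra of smooth periodic functions -/

/-- The algebra of smooth `L`-periodic functions. -/
def smoothAlg (L : ℝ) : Subalgebra ℂ (ℝ → ℂ) where
  carrier := {f | SmoothPeriodic L f}
  mul_mem' hf hg := hf.mul hg
  add_mem' hf hg := hf.add hg
  algebraMap_mem' c := SmoothPeriodic.const c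

theorem oddOp_add {L : ℝ} (hL : 0 < L) {K f g : ℝ → ℂ} (hK : IsPoleKernel L K)
    (hf : SmoothPeriodic L f) (hg : SmoothPeriodic L g) :
    oddOp L K (f + g) = oddOp L K f + oddOp L K g := by
  funext x
  rw [Pi.add_apply, oddOp, oddOp, oddOp, ← mul_add,
    ← intervalIntegral.integral_add (intervalIntegrable_oddOp hL hK hf.contDiff_one x)
      (intervalIntegrable_oddOp hL hK hg.contDiff_one x)]
  congr 1
  refine intervalIntegral.integral_congr fun s _ => ?_
  simp only [Pi.add_apply]
  ring

theorem oddOp_smul (L : ℝ) (K f : ℝ → ℂ) (c : ℂ) : oddOp L K (c • f) = c • oddOp L K f := by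
  funext x
  have h : c * ∫ s in (0 : ℝ)..(L / 2), K s * (f (x + s) - f (x - s)) =
      ∫ s in (0 : ℝ)..(L / 2), c * (K s * (f (x + s) - f (x - s))) :=
    (intervalIntegral.integral_const_mul _ _).symm
  rw [Pi.smul_apply, oddOp, oddOp, smul_eq_mul, mul_left_comm, h]
  congr 1
  refine intervalIntegral.integral_congr fun s _ => ?_
  simp only [Pi.smul_apply, smul_eq_mul]
  ring

theorem deriv_add_of_smooth {L : ℝ} {f g : ℝ → ℂ} (hf : SmoothPeriodic L f)
    (hg : SmoothPeriodic L g) : deriv (f + g) = deriv f + deriv g :=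
  funext fun x => ((hf.hasDerivAt x).add (hg.hasDerivAt x)).deriv

theorem deriv_smul_of_smooth {L : ℝ} {f : ℝ → ℂ} (hf : SmoothPeriodic L f) (c : ℂ) :
    deriv (c • f) = c • deriv f :=
  funext fun x => ((hf.hasDerivAt x).const_smul c).deriv

/-- Differentiation on smooth periodic functions. -/
noncomputable def derivS (L : ℝ) : smoothAlg L →ₗ[ℂ] smoothAlg L where
  toFun f := ⟨deriv f, f.2.deriv⟩
  map_add' f g := Subtype.ext (deriv_add_of_smooth f.2 g.2)
  map_smul' c f := Subtype.ext (deriv_smul_of_smooth f.2 c)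

theorem derivS_mul {L : ℝ} (f g : smoothAlg L) :
    derivS L (f * g) = f * derivS L g + g * derivS L f := by
  refine Subtype.ext (funext fun x => ?_)
  have := ((f.2.hasDerivAt x).mul (g.2.hasDerivAt x)).deriv
  simp only [derivS, LinearMap.coe_mk, AddHom.coe_mk, MulMemClass.coe_mul, AddMemClass.coe_add,
    Pi.add_apply, Pi.mul_apply]
  rw [this]
  ring

/-- The operator `f ↦ oddOp L K f'` on smooth periodic functions. -/
noncomputable def oddS {L : ℝ} (hL : 0 < L) {K : ℝ → ℂ} (hK : IsPoleKernel L K) :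
    smoothAlg L →ₗ[ℂ] smoothAlg L where
  toFun f := ⟨oddOp L K (deriv f), f.2.deriv.oddOp hL hK⟩
  map_add' f g := Subtype.ext <| (congrArg (oddOp L K) (deriv_add_of_smooth f.2 g.2)).trans
    (oddOp_add hL hK f.2.deriv g.2.deriv)
  map_smul' c f := Subtype.ext <| (congrArg (oddOp L K) (deriv_smul_of_smooth f.2 c)).trans
    (oddOp_smul L K (deriv f) c)

/-- Integration over a period. -/
noncomputable def intS (L : ℝ) : smoothAlg L →ₗ[ℂ] ℂ where
  toFun f := ∫ x in (-(L / 2))..(L / 2), (f : ℝ → ℂ) x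
  map_add' f g := intervalIntegral.integral_add (f.2.continuous.intervalIntegrable _ _)
    (g.2.continuous.intervalIntegrable _ _)
  map_smul' c _ := intervalIntegral.integral_smul c _

theorem intS_derivS {L : ℝ} (f : smoothAlg L) : intS L (derivS L f) = 0 := f.2.integral_deriv

theorem oddS_derivS {L : ℝ} (hL : 0 < L) {K : ℝ → ℂ} (hK : IsPoleKernel L K) (f : smoothAlg L) :
    oddS hL hK (derivS L f) = derivS L (oddS hL hK f) :=
  Subtype.ext (f.2.deriv.deriv_oddOp hL hK).symm

theorem intS_oddS {L : ℝ} (hL : 0 < L) {K : ℝ → ℂ} (hK : IsPoleKernel L K) (f : smoothAlg L) :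
    intS L (oddS hL hK f) = 0 := by
  have : oddS hL hK f = derivS L ⟨oddOp L K f, f.2.oddOp hL hK⟩ :=
    Subtype.ext (f.2.deriv_oddOp hL hK).symm
  rw [this, intS_derivS]

theorem intS_mul_derivS {L : ℝ} (f g : smoothAlg L) :
    intS L (f * derivS L g) = -intS L (g * derivS L f) := by
  have h := intS_derivS (f * g)
  rw [derivS_mul, map_add] at h
  linear_combination h

/-- The convolution and `∂` are both antisymmetric and they commute, so their composition is
symmetric. -/
theorem intS_mul_oddS {L : ℝ} (hL : 0 < L) {K : ℝ → ℂ} (hK : IsPoleKernel L K)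
    (f g : smoothAlg L) : intS L (f * oddS hL hK g) = intS L (oddS hL hK f * g) := by
  have h1 : intS L (f * oddS hL hK g) =
      -intS L (⟨oddOp L K f, f.2.oddOp hL hK⟩ * derivS L g) := by
    have := integral_oddOp_mul hL hK f.2 g.2.deriv
    rw [eq_comm, neg_eq_iff_eq_neg] at this
    exact this
  rw [h1, intS_mul_derivS, neg_neg, mul_comm]
  congr 2
  exact Subtype.ext (f.2.deriv_oddOp hL hK)

/-- Fourier coefficients on smooth periodic functions. -/
noncomputable def fcS {L : ℝ} (hL : 0 < L) (m : ℤ) : smoothAlg L →ₗ[ℂ] ℂ :=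
  (1 / (L : ℂ)) • (intS L ∘ₗ LinearMap.mulRight ℂ
    (⟨expo L (-m), smoothPeriodic_expo hL (-m)⟩ : smoothAlg L))

theorem fcS_apply {L : ℝ} (hL : 0 < L) (m : ℤ) (f : smoothAlg L) : fcS hL m f = fc L f m := rfl

/-- The symbol of differentiation. -/
noncomputable def symb (L : ℝ) (m : ℤ) : ℂ := 2 * Real.pi * Complex.I * m / L

theorem fcS_derivS {L : ℝ} (hL : 0 < L) (m : ℤ) (f : smoothAlg L) :
    fcS hL m (derivS L f) = symb L m * fcS hL m f := fc_deriv hL f.2 m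

theorem fcS_oddS {L : ℝ} (hL : 0 < L) {K : ℝ → ℂ} (hK : IsPoleKernel L K) (m : ℤ)
    (f : smoothAlg L) : fcS hL m (oddS hL hK f) = mult L K m * (symb L m * fcS hL m f) := by
  rw [← fcS_derivS]
  exact fc_oddOp hL hK f.2.deriv m

theorem ext_fcS {L : ℝ} (hL : 0 < L) {f g : smoothAlg L} (h : ∀ m, fcS hL m f = fcS hL m g) :
    f = g := by
  rw [← sub_eq_zero]
  refine Subtype.ext (eq_zero_of_fc hL (f - g).2 fun m => ?_)
  rw [← fcS_apply hL, map_sub, h, sub_self]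

theorem symb_zero (L : ℝ) : symb L 0 = 0 := by simp [symb]

theorem mult_eq_div {L δ : ℝ} (hL : 0 < L) (hδ : 0 < δ) {m : ℤ} (hm : m ≠ 0) :
    mult L (kerT L δ) m = Complex.I * (1 + ratio L δ m ^ 2) / (1 - ratio L δ m ^ 2) ∧
    mult L (kerTt L δ) m = Complex.I * (2 * ratio L δ m) / (1 - ratio L δ m ^ 2) := by
  have hne := one_sub_ratio_sq_ne_zero hL hδ hm
  obtain ⟨h1, h2⟩ := mult_mul_one_sub_ratio_sq hL hδ hm
  exact ⟨eq_div_of_mul_eq hne h1, eq_div_of_mul_eq hne h2⟩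

/-! ### Pairs of functions: the matrix operator and boundary values on a strip -/

section Calculus

variable {L δ : ℝ} (hL : 0 < L) (hδ : 0 < δ)

/-- The matrix operator built from `T ∂` and `T̃ ∂`. -/
noncomputable def matrixH : smoothAlg L × smoothAlg L →ₗ[ℂ] smoothAlg L × smoothAlg L where
  toFun f := (oddS hL (isPoleKernel_kerT hL hδ) f.1 - oddS hL (isPoleKernel_kerTt hL hδ) f.2,
    oddS hL (isPoleKernel_kerTt hL hδ) f.1 - oddS hL (isPoleKernel_kerT hL hδ) f.2)
  map_add' f g := by
    simp only [Prod.fst_add, Prod.snd_add, map_add, Prod.mk_add_mk]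
    congr 1 <;> abel
  map_smul' c f := by
    simp only [Prod.smul_fst, Prod.smul_snd, map_smul, RingHom.id_apply, Prod.smul_mk, smul_sub]

/-- Componentwise differentiation of pairs. -/
noncomputable def pairD (L : ℝ) :
    Derivation ℂ (smoothAlg L × smoothAlg L) (smoothAlg L × smoothAlg L) :=
  Derivation.mk' ((derivS L).prodMap (derivS L)) fun f g => by
    ext1 <;> simp [derivS_mul]

theorem pairD_fst (f : smoothAlg L × smoothAlg L) : (pairD L f).1 = derivS L f.1 := rfl

theorem pairD_snd (f : smoothAlg L × smoothAlg L) : (pairD L f).2 = derivS L f.2 := rfl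

theorem matrixH_fst (f : smoothAlg L × smoothAlg L) : (matrixH hL hδ f).1 =
    oddS hL (isPoleKernel_kerT hL hδ) f.1 - oddS hL (isPoleKernel_kerTt hL hδ) f.2 := rfl

theorem matrixH_snd (f : smoothAlg L × smoothAlg L) : (matrixH hL hδ f).2 =
    oddS hL (isPoleKernel_kerTt hL hδ) f.1 - oddS hL (isPoleKernel_kerT hL hδ) f.2 := rfl

/-- The pairs whose components are the two boundary values of a function analytic in a strip. -/
def IsBoundaryPair (δ : ℝ) (f : smoothAlg L × smoothAlg L) : Prop :=
  ∀ m, fcS hL m f.2 = ratio L δ m * fcS hL m f.1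

variable {hL} in
-- The ratio is a character of `ℤ` and Fourier coefficients of products are convolutions. This is
-- the Fourier form of the fact that a product of analytic functions is analytic.
theorem IsBoundaryPair.mul {f g : smoothAlg L × smoothAlg L} (hf : IsBoundaryPair hL δ f)
    (hg : IsBoundaryPair hL δ g) : IsBoundaryPair hL δ (f * g) := by
  intro m
  have h1 := hasSum_fc_mul hL f.1.2 g.1.2 m
  have h2 := hasSum_fc_mul hL f.2.2 g.2.2 m
  refine h2.unique (hasSum_of_eq (fun k => ?_) (h1.mul_left (ratio L δ m)))
  have a1 := hf k
  have a2 := hg (m - k)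
  rw [fcS_apply, fcS_apply] at a1 a2
  rw [a1, a2, show ratio L δ m = ratio L δ k * ratio L δ (m - k) by
    rw [← ratio_add, add_sub_cancel]]
  ring

/-- A check on each mode with the explicit multipliers. At `m = 0`, where they have no closed form,
the symbol of `D` vanishes. -/
theorem isBoundaryPair_projection (f : smoothAlg L × smoothAlg L) :
    IsBoundaryPair hL δ (pairD L f - Complex.I • matrixH hL hδ f) := by
  intro m
  simp only [Prod.fst_sub, Prod.snd_sub, Prod.smul_fst, Prod.smul_snd, pairD_fst, pairD_snd,
    matrixH_fst, matrixH_snd, map_sub, map_smul, fcS_derivS, fcS_oddS, smul_eq_mul]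
  by_cases hm : m = 0
  · subst hm
    simp [symb_zero]
  · have hne := one_sub_ratio_sq_ne_zero hL hδ hm
    obtain ⟨h1, h2⟩ := mult_eq_div hL hδ hm
    rw [h1, h2]
    field_simp
    simp only [Complex.I_sq]
    ring

theorem matrixH_of_isBoundaryPair {f : smoothAlg L × smoothAlg L} (hf : IsBoundaryPair hL δ f) :
    matrixH hL hδ f = Complex.I • pairD L f := by
  refine Prod.ext (ext_fcS hL fun m => ?_) (ext_fcS hL fun m => ?_) <;>
  · simp only [Prod.smul_fst, Prod.smul_snd, pairD_fst, pairD_snd,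
      matrixH_fst, matrixH_snd, map_sub, map_smul, fcS_derivS, fcS_oddS, smul_eq_mul, hf m]
    by_cases hm : m = 0
    · subst hm
      simp [symb_zero]
    · have hne := one_sub_ratio_sq_ne_zero hL hδ hm
      obtain ⟨h1, h2⟩ := mult_eq_div hL hδ hm
      rw [h1, h2]
      field_simp
      ring

/-- Exchanging the components reverses the sign of `H`, so the conjugate half of the calculus
follows from the analytic half. -/
theorem matrixH_swap (f : smoothAlg L × smoothAlg L) :
    matrixH hL hδ f.swap = -(matrixH hL hδ f).swap := by
  refine Prod.ext ?_ ?_ <;> simp [matrixH_fst, matrixH_snd]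

theorem pairD_swap (f : smoothAlg L × smoothAlg L) : pairD L f.swap = (pairD L f).swap := rfl

/-- On each mode this is `coth² - 1/sinh² = 1`; the off-diagonal entries cancel because the
multipliers commute. -/
theorem matrixH_matrixH (f : smoothAlg L × smoothAlg L) :
    matrixH hL hδ (matrixH hL hδ f) = -pairD L (pairD L f) := by
  refine Prod.ext (ext_fcS hL fun m => ?_) (ext_fcS hL fun m => ?_) <;>
  · simp only [Prod.fst_neg, Prod.snd_neg, pairD_fst, pairD_snd,
      matrixH_fst, matrixH_snd, map_sub, map_neg, fcS_derivS, fcS_oddS]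
    by_cases hm : m = 0
    · subst hm
      simp [symb_zero]
    · have hne := one_sub_ratio_sq_ne_zero hL hδ hm
      obtain ⟨h1, h2⟩ := mult_eq_div hL hδ hm
      rw [h1, h2]
      field_simp
      simp only [Complex.I_sq]
      ring

/-- Pairs of smooth periodic functions with the matrix operator and the difference of integrals. -/
noncomputable def pairCalculus : HilbertCalculus (smoothAlg L × smoothAlg L) where
  D := pairD L
  H := matrixH hL hδ
  tr := intS L ∘ₗ LinearMap.fst ℂ _ _ - intS L ∘ₗ LinearMap.snd ℂ _ _
  comm f := by
    refine Prod.ext ?_ ?_ <;>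
      simp only [pairD_fst, pairD_snd, matrixH_fst, matrixH_snd, oddS_derivS, map_sub]
  sq := matrixH_matrixH hL hδ
  plus f g := matrixH_of_isBoundaryPair hL hδ
    ((isBoundaryPair_projection hL hδ f).mul (isBoundaryPair_projection hL hδ g))
  minus f g := by
    have e : ∀ f : smoothAlg L × smoothAlg L, pairD L f + Complex.I • matrixH hL hδ f =
        (pairD L f.swap - Complex.I • matrixH hL hδ f.swap).swap := by
      intro f
      rw [matrixH_swap, pairD_swap]
      refine Prod.ext ?_ ?_ <;> simp
    have h := matrixH_of_isBoundaryPair hL hδ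
      ((isBoundaryPair_projection hL hδ f.swap).mul (isBoundaryPair_projection hL hδ g.swap))
    rw [e f, e g, ← Prod.swap_mul, matrixH_swap, h, pairD_swap]
    rfl
  tr_D f := by
    simp only [LinearMap.sub_apply, LinearMap.comp_apply, LinearMap.fst_apply, LinearMap.snd_apply,
      pairD_fst, pairD_snd, intS_derivS, sub_self]
  tr_H f := by
    simp only [LinearMap.sub_apply, LinearMap.comp_apply, LinearMap.fst_apply, LinearMap.snd_apply,
      matrixH_fst, matrixH_snd, map_sub, intS_oddS, sub_self]
  -- The minus sign in the trace compensates the opposite signs of the off-diagonal entries of `H`.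
  tr_symm f g := by
    simp only [LinearMap.sub_apply, LinearMap.comp_apply, LinearMap.fst_apply, LinearMap.snd_apply,
      Prod.fst_mul, Prod.snd_mul, matrixH_fst, matrixH_snd, mul_sub, sub_mul, map_sub,
      intS_mul_oddS]
    ring

end Calculus

/-! ### The formal exponential and the recursion for `W` and `Z` -/

/-- These two properties determine the exponential, and all later arguments use only them, not the
definition by substitution. -/
theorem formalExp_spec {S : PowerSeries (ℝ → ℂ)} (h : PowerSeries.coeff 0 S = 0) :
    PowerSeries.coeff 0 (formalExp S) = 1 ∧
    PowerSeries.derivative (ℝ → ℂ) (formalExp S) =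
      PowerSeries.derivative (ℝ → ℂ) S * formalExp S := by
  have hs : PowerSeries.HasSubst S := PowerSeries.HasSubst.of_constantCoeff_zero' (by simpa using h)
  constructor
  · rw [PowerSeries.coeff_zero_eq_constantCoeff_apply, formalExp]
    refine (PowerSeries.constantCoeff_subst hs _).trans ?_
    rw [finsum_eq_single _ 0]
    · simp
    · intro n hn
      have h0 : PowerSeries.constantCoeff S = 0 := by simpa using h
      have : PowerSeries.constantCoeff (S ^ n) = 0 := by
        rw [map_pow, h0, zero_pow hn]
      have e : MvPowerSeries.constantCoeff (S ^ n) = PowerSeries.constantCoeff (S ^ n) := rfl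
      rw [e, this, smul_zero]
  · rw [formalExp, PowerSeries.derivative_subst hs, PowerSeries.derivative_exp, mul_comm]

theorem coeff_formalExp_succ {S : PowerSeries (ℝ → ℂ)} (h : PowerSeries.coeff 0 S = 0) (n : ℕ)
    (x : ℝ) : ((n : ℂ) + 1) * PowerSeries.coeff (n + 1) (formalExp S) x =
      ∑ p ∈ Finset.HasAntidiagonal.antidiagonal n, ((p.1 : ℂ) + 1) *
        PowerSeries.coeff (p.1 + 1) S x * PowerSeries.coeff p.2 (formalExp S) x := by
  have h1 := congrFun (congrArg (PowerSeries.coeff n) (formalExp_spec h).2) x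
  rw [PowerSeries.coeff_derivative, PowerSeries.coeff_mul, Finset.sum_apply] at h1
  simp only [PowerSeries.coeff_derivative, Pi.mul_apply, Pi.add_apply, Pi.natCast_apply,
    Pi.one_apply] at h1
  rw [mul_comm, h1]
  exact Finset.sum_congr rfl fun p _ => by ring

theorem coeff_formalExp_congr {S S' : PowerSeries (ℝ → ℂ)} (h : PowerSeries.coeff 0 S = 0) {n : ℕ}
    (hS : ∀ k ≤ n, PowerSeries.coeff k S = PowerSeries.coeff k S') :
    ∀ k ≤ n, PowerSeries.coeff k (formalExp S) = PowerSeries.coeff k (formalExp S') := by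
  have h' : PowerSeries.coeff 0 S' = 0 := by rw [← hS 0 (Nat.zero_le n), h]
  intro k
  induction k using Nat.strong_induction_on with
  | _ k ih =>
    intro hk
    cases k with
    | zero => rw [(formalExp_spec h).1, (formalExp_spec h').1]
    | succ k =>
      funext x
      have hne : (k : ℂ) + 1 ≠ 0 := by exact_mod_cast Nat.succ_ne_zero k
      refine mul_left_cancel₀ hne ?_
      rw [coeff_formalExp_succ h, coeff_formalExp_succ h']
      refine Finset.sum_congr rfl fun p hp => ?_
      have hp' := Finset.HasAntidiagonal.mem_antidiagonal.1 hp
      rw [hS (p.1 + 1) (by omega), ih p.2 (by omega) (by omega)]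

/-- In the recursion for the exponential the new coefficient of `S` appears only multiplied by the
constant term `1`. It can thus be split off, which makes the Bäcklund relations solvable for the top
coefficient. -/
theorem coeff_formalExp_succ_sub {S S' : PowerSeries (ℝ → ℂ)} (h : PowerSeries.coeff 0 S = 0)
    {n : ℕ} (hS : ∀ k ≤ n, PowerSeries.coeff k S = PowerSeries.coeff k S') :
    PowerSeries.coeff (n + 1) (formalExp S) - PowerSeries.coeff (n + 1) S =
      PowerSeries.coeff (n + 1) (formalExp S') - PowerSeries.coeff (n + 1) S' := by
  have h' : PowerSeries.coeff 0 S' = 0 := by rw [← hS 0 (Nat.zero_le n), h]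
  funext x
  have hne : (n : ℂ) + 1 ≠ 0 := by exact_mod_cast Nat.succ_ne_zero n
  refine mul_left_cancel₀ hne ?_
  simp only [Pi.sub_apply, mul_sub]
  rw [coeff_formalExp_succ h, coeff_formalExp_succ h', Finset.Nat.sum_antidiagonal_eq_sum_range_succ_mk,
    Finset.Nat.sum_antidiagonal_eq_sum_range_succ_mk, Finset.sum_range_succ, Finset.sum_range_succ,
    Nat.sub_self, (formalExp_spec h).1, (formalExp_spec h').1]
  have e : ∑ k ∈ Finset.range n, ((k : ℂ) + 1) * PowerSeries.coeff (k + 1) S x *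
      PowerSeries.coeff (n - k) (formalExp S) x =
      ∑ k ∈ Finset.range n, ((k : ℂ) + 1) * PowerSeries.coeff (k + 1) S' x *
      PowerSeries.coeff (n - k) (formalExp S') x := by
    refine Finset.sum_congr rfl fun k hk => ?_
    have hk' := Finset.mem_range.1 hk
    rw [hS (k + 1) (by omega), coeff_formalExp_congr h hS (n - k) (by omega)]
  rw [e]
  simp only [Pi.one_apply]
  ring

theorem opT_zero (L δ x : ℝ) : opT L δ 0 x = 0 := by
  rw [opT]
  simp only [Pi.zero_apply, mul_zero, integral_zero]
  rw [Filter.Tendsto.limUnder_eq tendsto_const_nhds, mul_zero]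

theorem opTt_zero (L δ x : ℝ) : opTt L δ 0 x = 0 := by simp [opTt]

theorem deriv_zero_fun : deriv (0 : ℝ → ℂ) = 0 := funext fun x => deriv_const x 0

/-- The right-hand side of the recursion for the coefficients of `W`. -/
noncomputable def nextW (L δ : ℝ) (u : ℝ → ℂ) (W Z : PowerSeries (ℝ → ℂ)) (n : ℕ) (x : ℝ) : ℂ :=
  PowerSeries.coeff (n + 1) (formalExp (-(PowerSeries.trunc (n + 1) W : PowerSeries (ℝ → ℂ)))) x
    + Complex.I * opPminus L δ (deriv (PowerSeries.coeff n W)) x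
    + 1 / 2 * opTt L δ (deriv (PowerSeries.coeff n Z)) x + PowerSeries.coeff n (PowerSeries.C u) x

/-- The right-hand side of the recursion for the coefficients of `Z`. -/
noncomputable def nextZ (L δ : ℝ) (v : ℝ → ℂ) (W Z : PowerSeries (ℝ → ℂ)) (n : ℕ) (x : ℝ) : ℂ :=
  -PowerSeries.coeff (n + 1) (formalExp (PowerSeries.trunc (n + 1) Z : PowerSeries (ℝ → ℂ))) x
    - Complex.I * opPplus L δ (deriv (PowerSeries.coeff n Z)) x
    - 1 / 2 * opTt L δ (deriv (PowerSeries.coeff n W)) x + PowerSeries.coeff n (PowerSeries.C v) x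

theorem coeff_trunc_of_le {W : PowerSeries (ℝ → ℂ)} {n k : ℕ} (hk : k ≤ n) :
    PowerSeries.coeff k (PowerSeries.trunc (n + 1) W : PowerSeries (ℝ → ℂ)) =
      PowerSeries.coeff k W := by
  rw [Polynomial.coeff_coe, PowerSeries.coeff_trunc, if_pos (by omega)]

theorem coeff_trunc_succ (W : PowerSeries (ℝ → ℂ)) (n : ℕ) :
    PowerSeries.coeff (n + 1) (PowerSeries.trunc (n + 1) W : PowerSeries (ℝ → ℂ)) = 0 := by
  rw [Polynomial.coeff_coe, PowerSeries.coeff_trunc, if_neg (by omega)]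

theorem coeff_formalExp_trunc {W : PowerSeries (ℝ → ℂ)} (h : PowerSeries.coeff 0 W = 0) (n : ℕ) :
    PowerSeries.coeff (n + 1) (formalExp W) = PowerSeries.coeff (n + 1) W +
      PowerSeries.coeff (n + 1)
        (formalExp (PowerSeries.trunc (n + 1) W : PowerSeries (ℝ → ℂ))) := by
  have := coeff_formalExp_succ_sub h (S' := (PowerSeries.trunc (n + 1) W : PowerSeries (ℝ → ℂ)))
    (n := n) fun k hk => (coeff_trunc_of_le hk).symm
  rw [coeff_trunc_succ, sub_zero] at this
  rw [← this]
  abel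

theorem coeff_formalExp_neg_trunc {W : PowerSeries (ℝ → ℂ)} (h : PowerSeries.coeff 0 W = 0)
    (n : ℕ) : PowerSeries.coeff (n + 1) (formalExp (-W)) = -PowerSeries.coeff (n + 1) W +
      PowerSeries.coeff (n + 1)
        (formalExp (-(PowerSeries.trunc (n + 1) W : PowerSeries (ℝ → ℂ)))) := by
  have := coeff_formalExp_succ_sub (S := -W) (by rw [map_neg, h, neg_zero])
    (S' := -(PowerSeries.trunc (n + 1) W : PowerSeries (ℝ → ℂ)))
    (n := n) fun k hk => by rw [map_neg, map_neg, coeff_trunc_of_le hk]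
  rw [map_neg, map_neg, coeff_trunc_succ, neg_zero, sub_zero] at this
  rw [← this]
  abel

theorem isBacklundSeries_iff_coeff {L δ : ℝ} {u v : ℝ → ℂ} {W Z : PowerSeries (ℝ → ℂ)} :
    IsBacklundSeries L δ u v W Z ↔ PowerSeries.coeff 0 W = 0 ∧ PowerSeries.coeff 0 Z = 0 ∧
      ∀ n x, PowerSeries.coeff (n + 1) (formalExp (-W)) x = -PowerSeries.coeff n (PowerSeries.C u) x
        - Complex.I * opPminus L δ (deriv (PowerSeries.coeff n W)) x
        - 1 / 2 * opTt L δ (deriv (PowerSeries.coeff n Z)) x ∧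
      PowerSeries.coeff (n + 1) (formalExp Z) x = PowerSeries.coeff n (PowerSeries.C v) x
        - Complex.I * opPplus L δ (deriv (PowerSeries.coeff n Z)) x
        - 1 / 2 * opTt L δ (deriv (PowerSeries.coeff n W)) x := by
  have hu : ∀ (n : ℕ) (x : ℝ), (PowerSeries.coeff (n + 1) : PowerSeries (ℝ → ℂ) → ℝ → ℂ)
      ((1 - formalExp (-W))
      - PowerSeries.X * (Complex.I • coeffwise (fun f => opPminus L δ (deriv f)) W)
      - PowerSeries.X * ((1 / 2 : ℂ) • coeffwise (fun f => opTt L δ (deriv f)) Z)) x =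
      -PowerSeries.coeff (n + 1) (formalExp (-W)) x
        - Complex.I * opPminus L δ (deriv (PowerSeries.coeff n W)) x
        - 1 / 2 * opTt L δ (deriv (PowerSeries.coeff n Z)) x := by
    intro n x
    rw [map_sub, map_sub, map_sub, PowerSeries.coeff_succ_X_mul, PowerSeries.coeff_succ_X_mul,
      PowerSeries.coeff_one, if_neg (Nat.succ_ne_zero n), PowerSeries.coeff_smul,
      PowerSeries.coeff_smul, coeffwise, coeffwise, PowerSeries.coeff_mk, PowerSeries.coeff_mk]
    simp
  have hv : ∀ (n : ℕ) (x : ℝ), (PowerSeries.coeff (n + 1) : PowerSeries (ℝ → ℂ) → ℝ → ℂ)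
      (-(1 - formalExp Z)
      + PowerSeries.X * (Complex.I • coeffwise (fun f => opPplus L δ (deriv f)) Z)
      + PowerSeries.X * ((1 / 2 : ℂ) • coeffwise (fun f => opTt L δ (deriv f)) W)) x =
      PowerSeries.coeff (n + 1) (formalExp Z) x
        + Complex.I * opPplus L δ (deriv (PowerSeries.coeff n Z)) x
        + 1 / 2 * opTt L δ (deriv (PowerSeries.coeff n W)) x := by
    intro n x
    rw [map_add, map_add, map_neg, map_sub, PowerSeries.coeff_succ_X_mul,
      PowerSeries.coeff_succ_X_mul, PowerSeries.coeff_one, if_neg (Nat.succ_ne_zero n),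
      PowerSeries.coeff_smul, PowerSeries.coeff_smul, coeffwise, coeffwise, PowerSeries.coeff_mk,
      PowerSeries.coeff_mk]
    simp
  constructor
  · intro h
    refine ⟨by simpa using h.constCoeff_W, by simpa using h.constCoeff_Z, fun n x => ⟨?_, ?_⟩⟩
    · have h1 := congrFun (congrArg (PowerSeries.coeff (n + 1)) h.eq_u) x
      rw [hu, PowerSeries.coeff_succ_X_mul] at h1
      linear_combination h1
    · have h1 := congrFun (congrArg (PowerSeries.coeff (n + 1)) h.eq_v) x
      rw [hv, PowerSeries.coeff_succ_X_mul] at h1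
      linear_combination -h1
  · rintro ⟨hW, hZ, h⟩
    refine ⟨by simpa using hW, by simpa using hZ, ?_, ?_⟩
    · refine PowerSeries.ext fun n => ?_
      cases n with
      | zero =>
        have := (formalExp_spec (S := -W) (by rw [map_neg, hW, neg_zero])).1
        simp only [PowerSeries.coeff_zero_X_mul, map_sub, this, PowerSeries.coeff_zero_one, sub_self]
      | succ n =>
        funext x
        rw [hu, PowerSeries.coeff_succ_X_mul]
        linear_combination (h n x).1
    · refine PowerSeries.ext fun n => ?_
      cases n with
      | zero =>
        have := (formalExp_spec hZ).1
        simp only [PowerSeries.coeff_zero_X_mul, map_sub, map_add, map_neg, this,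
          PowerSeries.coeff_zero_one, sub_self, neg_zero, add_zero]
      | succ n =>
        funext x
        rw [hv, PowerSeries.coeff_succ_X_mul]
        linear_combination -(h n x).2

/-- The term `coeff n (C u)` is `u` for `n = 0` and zero afterwards, so one formula covers both the
initial value and the recursion. -/
theorem isBacklundSeries_iff {L δ : ℝ} {u v : ℝ → ℂ} {W Z : PowerSeries (ℝ → ℂ)} :
    IsBacklundSeries L δ u v W Z ↔ PowerSeries.coeff 0 W = 0 ∧ PowerSeries.coeff 0 Z = 0 ∧
      ∀ n, PowerSeries.coeff (n + 1) W = nextW L δ u W Z n ∧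
        PowerSeries.coeff (n + 1) Z = nextZ L δ v W Z n := by
  rw [isBacklundSeries_iff_coeff]
  refine and_congr_right fun hW => and_congr_right fun hZ => forall_congr' fun n => ?_
  rw [coeff_formalExp_trunc hZ, coeff_formalExp_neg_trunc hW, funext_iff, funext_iff,
    ← forall_and]
  refine forall_congr' fun x => and_congr ?_ ?_
  · rw [nextW, Pi.add_apply, Pi.neg_apply]
    constructor <;> intro h <;> linear_combination -h
  · rw [nextZ, Pi.add_apply]
    constructor <;> intro h <;> linear_combination h

theorem trunc_congr {W W' : PowerSeries (ℝ → ℂ)} {n : ℕ}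
    (h : ∀ k ≤ n, PowerSeries.coeff k W = PowerSeries.coeff k W') :
    PowerSeries.trunc (n + 1) W = PowerSeries.trunc (n + 1) W' := by
  ext1 k
  rw [PowerSeries.coeff_trunc, PowerSeries.coeff_trunc]
  split_ifs with hk
  · exact h k (by omega)
  · rfl

theorem next_congr {L δ : ℝ} {u v : ℝ → ℂ} {W Z W' Z' : PowerSeries (ℝ → ℂ)} {n : ℕ}
    (hW : ∀ k ≤ n, PowerSeries.coeff k W = PowerSeries.coeff k W')
    (hZ : ∀ k ≤ n, PowerSeries.coeff k Z = PowerSeries.coeff k Z') :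
    nextW L δ u W Z n = nextW L δ u W' Z' n ∧ nextZ L δ v W Z n = nextZ L δ v W' Z' n := by
  constructor <;> funext x
  · rw [nextW, nextW, trunc_congr hW, hW n le_rfl, hZ n le_rfl]
  · rw [nextZ, nextZ, trunc_congr hZ, hW n le_rfl, hZ n le_rfl]

theorem IsBacklundSeries.unique {L δ : ℝ} {u v : ℝ → ℂ} {W Z W' Z' : PowerSeries (ℝ → ℂ)}
    (h : IsBacklundSeries L δ u v W Z) (h' : IsBacklundSeries L δ u v W' Z') :
    W = W' ∧ Z = Z' := by
  obtain ⟨hW, hZ, hr⟩ := isBacklundSeries_iff.1 h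
  obtain ⟨hW', hZ', hr'⟩ := isBacklundSeries_iff.1 h'
  have key : ∀ n, PowerSeries.coeff n W = PowerSeries.coeff n W' ∧
      PowerSeries.coeff n Z = PowerSeries.coeff n Z' := by
    intro n
    induction n using Nat.strong_induction_on with
    | _ n ih =>
      cases n with
      | zero => exact ⟨hW.trans hW'.symm, hZ.trans hZ'.symm⟩
      | succ n =>
        obtain ⟨e1, e2⟩ := next_congr (L := L) (δ := δ) (u := u) (v := v) (n := n)
          (fun k hk => (ih k (by omega)).1) (fun k hk => (ih k (by omega)).2)
        rw [(hr n).1, (hr n).2, (hr' n).1, (hr' n).2]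
        exact ⟨e1, e2⟩
  exact ⟨PowerSeries.ext fun n => (key n).1, PowerSeries.ext fun n => (key n).2⟩

/-- Successive approximations to the series `(W, Z)`. -/
noncomputable def approxSeries (L δ : ℝ) (u v : ℝ → ℂ) :
    ℕ → PowerSeries (ℝ → ℂ) × PowerSeries (ℝ → ℂ)
  | 0 => (0, 0)
  | n + 1 =>
    let p := approxSeries L δ u v n
    (PowerSeries.mk fun k => if k = n + 1 then nextW L δ u p.1 p.2 n else PowerSeries.coeff k p.1,
      PowerSeries.mk fun k => if k = n + 1 then nextZ L δ v p.1 p.2 n else PowerSeries.coeff k p.2)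

theorem coeff_approxSeries_of_le (L δ : ℝ) (u v : ℝ → ℂ) {k n : ℕ} (h : k ≤ n) :
    PowerSeries.coeff k (approxSeries L δ u v n).1 = PowerSeries.coeff k (approxSeries L δ u v k).1 ∧
    PowerSeries.coeff k (approxSeries L δ u v n).2 =
      PowerSeries.coeff k (approxSeries L δ u v k).2 := by
  induction n, h using Nat.le_induction with
  | base => exact ⟨rfl, rfl⟩
  | succ n hn ih =>
    rw [approxSeries]
    simp only [PowerSeries.coeff_mk, if_neg (show k ≠ n + 1 by omega)]
    exact ih

/-- Stage `n` of the approximation changes only the coefficient of order `n`, so the diagonal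
coefficients satisfy the recursion. Smoothness plays no role here. -/
theorem exists_isBacklundSeries (L δ : ℝ) (u v : ℝ → ℂ) :
    ∃ W Z, IsBacklundSeries L δ u v W Z := by
  refine ⟨PowerSeries.mk fun n => PowerSeries.coeff n (approxSeries L δ u v n).1,
    PowerSeries.mk fun n => PowerSeries.coeff n (approxSeries L δ u v n).2,
    isBacklundSeries_iff.2 ⟨?_, ?_, fun n => ?_⟩⟩
  · simp [approxSeries]
  · simp [approxSeries]
  · obtain ⟨e1, e2⟩ := next_congr (L := L) (δ := δ) (u := u) (v := v) (n := n)
      (W := PowerSeries.mk fun n => PowerSeries.coeff n (approxSeries L δ u v n).1)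
      (Z := PowerSeries.mk fun n => PowerSeries.coeff n (approxSeries L δ u v n).2)
      (W' := (approxSeries L δ u v n).1) (Z' := (approxSeries L δ u v n).2)
      (fun k hk => by rw [PowerSeries.coeff_mk, (coeff_approxSeries_of_le L δ u v hk).1])
      (fun k hk => by rw [PowerSeries.coeff_mk, (coeff_approxSeries_of_le L δ u v hk).2])
    rw [e1, e2]
    simp [approxSeries]

theorem IsBacklundSeries.coeff_one {L δ : ℝ} {u v : ℝ → ℂ} {W Z : PowerSeries (ℝ → ℂ)}
    (h : IsBacklundSeries L δ u v W Z) : PowerSeries.coeff 1 W = u ∧ PowerSeries.coeff 1 Z = v := by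
  obtain ⟨hW, hZ, hr⟩ := isBacklundSeries_iff_coeff.1 h
  have hA : ∀ S : PowerSeries (ℝ → ℂ), PowerSeries.coeff 0 S = 0 → ∀ x,
      PowerSeries.coeff 1 (formalExp S) x = PowerSeries.coeff 1 S x := fun S hS x => by
    have := coeff_formalExp_succ hS 0 x
    simpa [(formalExp_spec hS).1, -PowerSeries.coeff_zero_eq_constantCoeff] using this
  constructor <;> funext x
  · have h1 := (hr 0 x).1
    rw [zero_add, hA _ (by rw [map_neg, hW, neg_zero]), hW, hZ, deriv_zero_fun, opPminus, opT_zero,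
      opTt_zero, PowerSeries.coeff_zero_C, map_neg, Pi.neg_apply, Pi.zero_apply] at h1
    linear_combination -h1
  · have h1 := (hr 0 x).2
    rw [zero_add, hA _ hZ, hW, hZ, deriv_zero_fun, opPplus, opT_zero,
      opTt_zero, PowerSeries.coeff_zero_C, Pi.zero_apply] at h1
    linear_combination h1

theorem IsBacklundSeries.coeff_succ {L δ : ℝ} {u v : ℝ → ℂ} {W Z : PowerSeries (ℝ → ℂ)}
    (h : IsBacklundSeries L δ u v W Z) {n : ℕ} (hn : 1 ≤ n) (x : ℝ) :
    PowerSeries.coeff (n + 1) W x =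
      PowerSeries.coeff (n + 1)
        (formalExp (-(PowerSeries.trunc (n + 1) W : PowerSeries (ℝ → ℂ)))) x
      + Complex.I * opPminus L δ (deriv (PowerSeries.coeff n W)) x
      + 1 / 2 * opTt L δ (deriv (PowerSeries.coeff n Z)) x ∧
    PowerSeries.coeff (n + 1) Z x =
      -PowerSeries.coeff (n + 1) (formalExp (PowerSeries.trunc (n + 1) Z : PowerSeries (ℝ → ℂ))) x
      - Complex.I * opPplus L δ (deriv (PowerSeries.coeff n Z)) x
      - 1 / 2 * opTt L δ (deriv (PowerSeries.coeff n W)) x := by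
  obtain ⟨-, -, hr⟩ := isBacklundSeries_iff.1 h
  have hC : ∀ w : ℝ → ℂ, PowerSeries.coeff n (PowerSeries.C w) x = 0 := fun w => by
    rw [PowerSeries.coeff_C, if_neg (by omega), Pi.zero_apply]
  rw [(hr n).1, (hr n).2, nextW, nextZ, hC, hC, add_zero, add_zero]
  exact ⟨rfl, rfl⟩

/-! ### Smoothness and time derivatives of the series -/

section Families

variable {L : ℝ} {J : Set ℝ}

theorem SmoothFamily.hasDerivAt_dT {F : ℝ → ℝ → ℂ} (hJ : IsOpen J) (hF : SmoothFamily L J F)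
    (x : ℝ) {t : ℝ} (ht : t ∈ J) : HasDerivAt (fun s => F x s) (NcILW.dT F x t) t :=
  (hF.hasDerivAt_right hJ x ht).differentiableAt.hasDerivAt

theorem dT_eq_of_hasDerivAt {G : ℝ → ℝ → ℂ} {f : ℝ → ℂ} (hJ : IsOpen J) {x t : ℝ} (ht : t ∈ J)
    (h : ∀ s ∈ J, G x s = f s) {c : ℂ} (hf : HasDerivAt f c t) : dT G x t = c :=
  (hf.congr_of_eventuallyEq (Filter.eventually_of_mem (hJ.mem_nhds ht) h)).deriv

theorem smoothFamily_formalExp {S : ℝ → PowerSeries (ℝ → ℂ)}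
    (h0 : ∀ t ∈ J, PowerSeries.coeff 0 (S t) = 0) {n : ℕ}
    (hS : ∀ k ≤ n, SmoothFamily L J fun x t => PowerSeries.coeff k (S t) x) :
    ∀ k ≤ n, SmoothFamily L J fun x t => PowerSeries.coeff k (formalExp (S t)) x := by
  intro k
  induction k using Nat.strong_induction_on with
  | _ k ih =>
    intro hk
    cases k with
    | zero =>
      exact (SmoothFamily.const 1).congr fun x t ht => by
        rw [(formalExp_spec (h0 t ht)).1, Pi.one_apply]
    | succ k =>
      have hne : (k : ℂ) + 1 ≠ 0 := by exact_mod_cast Nat.succ_ne_zero k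
      have hs : SmoothFamily L J fun x t => ((k : ℂ) + 1)⁻¹ *
          ∑ p ∈ Finset.HasAntidiagonal.antidiagonal k, ((p.1 : ℂ) + 1) *
          (PowerSeries.coeff (p.1 + 1) (S t) x * PowerSeries.coeff p.2 (formalExp (S t)) x) := by
        refine SmoothFamily.const_mul _ (SmoothFamily.sum fun p hp => SmoothFamily.const_mul _ ?_)
        have hp' := Finset.HasAntidiagonal.mem_antidiagonal.1 hp
        exact (hS _ (by omega)).mul (ih p.2 (by omega) (by omega))
      refine hs.congr fun x t ht => ?_
      rw [eq_inv_mul_iff_mul_eq₀ hne, coeff_formalExp_succ (h0 t ht)]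
      exact Finset.sum_congr rfl fun p _ => by ring

/-- Time derivative of a family of power series. -/
noncomputable def dTSeries (S : ℝ → PowerSeries (ℝ → ℂ)) (t : ℝ) : PowerSeries (ℝ → ℂ) :=
  PowerSeries.mk fun n x => dT (fun x t => PowerSeries.coeff n (S t) x) x t

theorem coeff_dTSeries (S : ℝ → PowerSeries (ℝ → ℂ)) (t : ℝ) (n : ℕ) (x : ℝ) :
    PowerSeries.coeff n (dTSeries S t) x = dT (fun x t => PowerSeries.coeff n (S t) x) x t := by
  rw [dTSeries, PowerSeries.coeff_mk]

/-- The same uniqueness argument as for a derivation of the coefficients: the difference of the two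
sides solves `y' = S'y` in `ε` with zero constant term. -/
theorem dTSeries_formalExp (hJ : IsOpen J) {S : ℝ → PowerSeries (ℝ → ℂ)}
    (h0 : ∀ t ∈ J, PowerSeries.coeff 0 (S t) = 0)
    (hS : ∀ k, SmoothFamily L J fun x t => PowerSeries.coeff k (S t) x) {t : ℝ} (ht : t ∈ J) :
    dTSeries (fun s => formalExp (S s)) t = formalExp (S t) * dTSeries S t := by
  have hE : ∀ k, SmoothFamily L J fun x t => PowerSeries.coeff k (formalExp (S t)) x := fun k =>
    smoothFamily_formalExp h0 (n := k) (fun j _ => hS j) k le_rfl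
  rw [← sub_eq_zero]
  have hd : PowerSeries.derivative (ℝ → ℂ) (dTSeries (fun s => formalExp (S s)) t) =
      PowerSeries.derivative (ℝ → ℂ) (S t) * dTSeries (fun s => formalExp (S s)) t +
      PowerSeries.derivative (ℝ → ℂ) (dTSeries S t) * formalExp (S t) := by
    refine PowerSeries.ext fun n => funext fun x => ?_
    rw [map_add, PowerSeries.coeff_mul, PowerSeries.coeff_mul, PowerSeries.coeff_derivative,
      ← Finset.sum_add_distrib, Finset.sum_apply]
    simp only [Pi.add_apply, Pi.mul_apply, PowerSeries.coeff_derivative, Pi.natCast_apply,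
      Pi.one_apply, coeff_dTSeries]
    have h1 := ((hE (n + 1)).hasDerivAt_dT hJ x ht).const_mul ((n : ℂ) + 1)
    have h2 : HasDerivAt (fun s => ∑ p ∈ Finset.HasAntidiagonal.antidiagonal n, ((p.1 : ℂ) + 1) *
        PowerSeries.coeff (p.1 + 1) (S s) x * PowerSeries.coeff p.2 (formalExp (S s)) x) _ t :=
      HasDerivAt.fun_sum fun p _ => (((hS (p.1 + 1)).hasDerivAt_dT hJ x ht).const_mul
        ((p.1 : ℂ) + 1)).fun_mul ((hE p.2).hasDerivAt_dT hJ x ht)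
    have h3 := h1.unique (h2.congr_of_eventuallyEq (Filter.eventually_of_mem (hJ.mem_nhds ht)
      fun s hs => coeff_formalExp_succ (h0 s hs) n x))
    rw [mul_comm, h3]
    exact Finset.sum_congr rfl fun p _ => by ring
  refine eq_zero_of_derivative_eq (S := S t) ?_ ?_
  · rw [map_sub, Derivation.leibniz, hd, (formalExp_spec (h0 t ht)).2, smul_eq_mul, smul_eq_mul]
    ring
  · have hz : ∀ T : ℝ → PowerSeries (ℝ → ℂ), ∀ c : ℂ,
        (∀ t ∈ J, ∀ x, PowerSeries.coeff 0 (T t) x = c) →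
        PowerSeries.coeff 0 (dTSeries T t) = 0 := fun T c hT => funext fun x => by
      rw [coeff_dTSeries]
      exact dT_eq_of_hasDerivAt hJ ht (f := fun _ => c) (fun s hs => hT s hs x)
        (hasDerivAt_const t c)
    have hz1 := hz S 0 fun t ht x => by rw [h0 t ht, Pi.zero_apply]
    have hz2 := hz (fun s => formalExp (S s)) 1 fun t ht x => by
      rw [(formalExp_spec (h0 t ht)).1, Pi.one_apply]
    rw [map_sub, map_mul, ← PowerSeries.coeff_zero_eq_constantCoeff_apply,
      ← PowerSeries.coeff_zero_eq_constantCoeff_apply,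
      ← PowerSeries.coeff_zero_eq_constantCoeff_apply, hz1, hz2, mul_zero, sub_zero]

variable {δ : ℝ}

theorem SmoothPeriodic.opPminus_deriv_eq {f : ℝ → ℂ} (hL : 0 < L) (hδ : 0 < δ)
    (hf : SmoothPeriodic L f) (x : ℝ) : opPminus L δ (_root_.deriv f) x =
      -(1 / 2) * (Complex.I * NcILW.oddOp L (kerT L δ) (_root_.deriv f) x - _root_.deriv f x) := by
  rw [opPminus, hf.deriv.opT_eq hL hδ]

theorem SmoothPeriodic.opPplus_deriv_eq {f : ℝ → ℂ} (hL : 0 < L) (hδ : 0 < δ)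
    (hf : SmoothPeriodic L f) (x : ℝ) : opPplus L δ (_root_.deriv f) x =
      -(1 / 2) * (Complex.I * NcILW.oddOp L (kerT L δ) (_root_.deriv f) x + _root_.deriv f x) := by
  rw [opPplus, hf.deriv.opT_eq hL hδ]

theorem smoothFamily_coeff_C {u : ℝ → ℝ → ℂ} (hu : SmoothFamily L J u) (n : ℕ) :
    SmoothFamily L J fun x t => PowerSeries.coeff n (PowerSeries.C fun y => u y t) x := by
  cases n with
  | zero => exact hu.congr fun x t _ => by rw [PowerSeries.coeff_zero_C]
  | succ n =>
    exact (SmoothFamily.const 0).congr fun x t _ => by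
      rw [PowerSeries.coeff_C, if_neg (Nat.succ_ne_zero n), Pi.zero_apply]

theorem smoothFamily_of_isBacklundSeries (hL : 0 < L) (hδ : 0 < δ) (hJ : IsOpen J)
    {u v : ℝ → ℝ → ℂ} (hu : SmoothFamily L J u) (hv : SmoothFamily L J v)
    {W Z : ℝ → PowerSeries (ℝ → ℂ)}
    (h : ∀ t ∈ J, IsBacklundSeries L δ (fun x => u x t) (fun x => v x t) (W t) (Z t)) (n : ℕ) :
    SmoothFamily L J (fun x t => PowerSeries.coeff n (W t) x) ∧
      SmoothFamily L J (fun x t => PowerSeries.coeff n (Z t) x) := by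
  induction n using Nat.strong_induction_on with
  | _ n ih =>
    cases n with
    | zero =>
      constructor
      · exact (SmoothFamily.const 0).congr fun x t ht => by
          rw [(isBacklundSeries_iff.1 (h t ht)).1, Pi.zero_apply]
      · exact (SmoothFamily.const 0).congr fun x t ht => by
          rw [(isBacklundSeries_iff.1 (h t ht)).2.1, Pi.zero_apply]
    | succ n =>
      -- The scalar `a` treats the two exponentials together: `a = -1` for `W` and `a = 1` for `Z`.
      have hT : ∀ (S : ℝ → PowerSeries (ℝ → ℂ)) (a : ℂ),
          (∀ t ∈ J, PowerSeries.coeff 0 (S t) = 0) →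
          (∀ k ≤ n, SmoothFamily L J fun x t => PowerSeries.coeff k (S t) x) →
          SmoothFamily L J fun x t => PowerSeries.coeff (n + 1)
            (formalExp (a • (PowerSeries.trunc (n + 1) (S t) : PowerSeries (ℝ → ℂ)))) x := by
        intro S a h0 hS
        refine smoothFamily_formalExp (fun t ht => ?_) (fun k hk => ?_) (n + 1) le_rfl
        · rw [PowerSeries.coeff_smul, coeff_trunc_of_le (Nat.zero_le n), h0 t ht, smul_zero]
        · rcases Nat.lt_or_ge n k with hk' | hk'
          · obtain rfl : k = n + 1 := by omega
            exact (SmoothFamily.const 0).congr fun x t ht => by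
              rw [PowerSeries.coeff_smul, coeff_trunc_succ, smul_zero, Pi.zero_apply]
          · exact ((hS k hk').const_mul a).congr fun x t ht => by
              rw [PowerSeries.coeff_smul, coeff_trunc_of_le hk', Pi.smul_apply, smul_eq_mul]
      have hWn := (ih n (by omega)).1
      have hZn := (ih n (by omega)).2
      have hA : ∀ {F : ℝ → ℝ → ℂ}, SmoothFamily L J F → ∀ {K : ℝ → ℂ}, IsPoleKernel L K →
          SmoothFamily L J fun x t => oddOp L K (fun y => dX F y t) x := fun hF _ hK =>
        (hF.dX hJ).oddOp hL hJ hK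
      have kT := isPoleKernel_kerT hL hδ
      have kTt := isPoleKernel_kerTt hL hδ
      constructor
      · refine ((((hT W (-1) (fun t ht => (isBacklundSeries_iff.1 (h t ht)).1) fun k hk =>
          (ih k (by omega)).1).add ((hA hWn kT).const_mul (1 / 2))).add
          (((hWn.dX hJ).const_mul (Complex.I / 2)).add ((hA hZn kTt).const_mul (1 / 2)))).add
          (smoothFamily_coeff_C hu n)).congr fun x t ht => ?_
        rw [((isBacklundSeries_iff.1 (h t ht)).2.2 n).1, nextW,
          (hWn.slice ht).opPminus_deriv_eq hL hδ, (hZn.slice ht).opTt_deriv_eq hL hδ, neg_one_smul]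
        simp only [dX]
        linear_combination (-(1 / 2 : ℂ) * oddOp L (kerT L δ)
          (deriv fun x => PowerSeries.coeff n (W t) x) x) * Complex.I_mul_I
      · refine (((((hT Z 1 (fun t ht => (isBacklundSeries_iff.1 (h t ht)).2.1) fun k hk =>
          (ih k (by omega)).2).const_mul (-1)).add ((hA hZn kT).const_mul (-(1 / 2)))).add
          (((hZn.dX hJ).const_mul (Complex.I / 2)).add ((hA hWn kTt).const_mul (-(1 / 2))))).add
          (smoothFamily_coeff_C hv n)).congr fun x t ht => ?_
        rw [((isBacklundSeries_iff.1 (h t ht)).2.2 n).2, nextZ,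
          (hZn.slice ht).opPplus_deriv_eq hL hδ, (hWn.slice ht).opTt_deriv_eq hL hδ, one_smul]
        simp only [dX]
        linear_combination ((1 / 2 : ℂ) * oddOp L (kerT L δ)
          (deriv fun x => PowerSeries.coeff n (Z t) x) x) * Complex.I_mul_I

/-- Inserting the definitions of the projections and doubling gives, in both components, the
combination `H + iD` of the pair calculus. -/
theorem IsBacklundSeries.relation (hL : 0 < L) (hδ : 0 < δ) {u v : ℝ → ℂ}
    {W Z : PowerSeries (ℝ → ℂ)} (h : IsBacklundSeries L δ u v W Z)
    (hW : ∀ n, SmoothPeriodic L (PowerSeries.coeff n W))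
    (hZ : ∀ n, SmoothPeriodic L (PowerSeries.coeff n Z)) (n : ℕ) (x : ℝ) :
    2 * PowerSeries.coeff (n + 1) (formalExp (-W)) x = -2 * PowerSeries.coeff n (PowerSeries.C u) x
      - (oddOp L (kerT L δ) (deriv (PowerSeries.coeff n W)) x
        + oddOp L (kerTt L δ) (deriv (PowerSeries.coeff n Z)) x
        + Complex.I * deriv (PowerSeries.coeff n W) x) ∧
    2 * PowerSeries.coeff (n + 1) (formalExp Z) x = 2 * PowerSeries.coeff n (PowerSeries.C v) x
      - (oddOp L (kerTt L δ) (deriv (PowerSeries.coeff n W)) x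
        + oddOp L (kerT L δ) (deriv (PowerSeries.coeff n Z)) x
        - Complex.I * deriv (PowerSeries.coeff n Z) x) := by
  obtain ⟨h1, h2⟩ := (isBacklundSeries_iff_coeff.1 h).2.2 n x
  rw [(hW n).opPminus_deriv_eq hL hδ, (hZ n).opTt_deriv_eq hL hδ] at h1
  rw [(hZ n).opPplus_deriv_eq hL hδ, (hW n).opTt_deriv_eq hL hδ] at h2
  constructor
  · linear_combination 2 * h1 + oddOp L (kerT L δ) (deriv (PowerSeries.coeff n W)) x *
      Complex.I_mul_I
  · linear_combination 2 * h2 + oddOp L (kerT L δ) (deriv (PowerSeries.coeff n Z)) x *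
      Complex.I_mul_I

/-- The case of a family constant in time. -/
theorem IsBacklundSeries.smoothPeriodic (hL : 0 < L) (hδ : 0 < δ) {u v : ℝ → ℂ}
    (hu : SmoothPeriodic L u) (hv : SmoothPeriodic L v) {W Z : PowerSeries (ℝ → ℂ)}
    (h : IsBacklundSeries L δ u v W Z) (n : ℕ) :
    SmoothPeriodic L (PowerSeries.coeff n W) ∧ SmoothPeriodic L (PowerSeries.coeff n Z) := by
  have := smoothFamily_of_isBacklundSeries hL hδ isOpen_univ (SmoothFamily.of_slice hu)
    (SmoothFamily.of_slice hv) (W := fun _ => W) (Z := fun _ => Z) (fun _ _ => h) n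
  exact ⟨this.1.slice (Set.mem_univ 0), this.2.slice (Set.mem_univ 0)⟩

theorem smoothPeriodic_formalExp {S : PowerSeries (ℝ → ℂ)} (h0 : PowerSeries.coeff 0 S = 0)
    (hS : ∀ n, SmoothPeriodic L (PowerSeries.coeff n S)) (n : ℕ) :
    SmoothPeriodic L (PowerSeries.coeff n (formalExp S)) :=
  (smoothFamily_formalExp (J := Set.univ) (S := fun _ => S) (fun _ _ => h0) (n := n)
    (fun k _ => SmoothFamily.of_slice (hS k)) n le_rfl).slice (Set.mem_univ 0)

end Families

/-! ### Transfer between series of functions and series of pairs -/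

section Pairs

variable {L : ℝ}

/-- Forgetting smoothness in the first component of a series of pairs. -/
noncomputable def fstSeries (L : ℝ) :
    PowerSeries (smoothAlg L × smoothAlg L) →+* PowerSeries (ℝ → ℂ) :=
  PowerSeries.map ((smoothAlg L).val.toRingHom.comp (RingHom.fst _ _))

/-- Forgetting smoothness in the second component of a series of pairs. -/
noncomputable def sndSeries (L : ℝ) :
    PowerSeries (smoothAlg L × smoothAlg L) →+* PowerSeries (ℝ → ℂ) :=
  PowerSeries.map ((smoothAlg L).val.toRingHom.comp (RingHom.snd _ _))

theorem coeff_fstSeries (F : PowerSeries (smoothAlg L × smoothAlg L)) (n : ℕ) :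
    PowerSeries.coeff n (fstSeries L F) = (PowerSeries.coeff n F).1 := by
  simp [fstSeries]

theorem coeff_sndSeries (F : PowerSeries (smoothAlg L × smoothAlg L)) (n : ℕ) :
    PowerSeries.coeff n (sndSeries L F) = (PowerSeries.coeff n F).2 := by
  simp [sndSeries]

theorem ext_series {F G : PowerSeries (smoothAlg L × smoothAlg L)}
    (h1 : fstSeries L F = fstSeries L G) (h2 : sndSeries L F = sndSeries L G) : F = G := by
  refine PowerSeries.ext fun n => Prod.ext (Subtype.ext ?_) (Subtype.ext ?_)
  · rw [← coeff_fstSeries, ← coeff_fstSeries, h1]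
  · rw [← coeff_sndSeries, ← coeff_sndSeries, h2]

theorem map_derivative_series {R S : Type*} [CommRing R] [CommRing S] (φ : R →+* S)
    (F : PowerSeries R) : PowerSeries.map φ (PowerSeries.derivative R F) =
      PowerSeries.derivative S (PowerSeries.map φ F) := by
  ext n
  simp [PowerSeries.coeff_derivative]

/-- The series of pairs with given smooth components. -/
noncomputable def liftSeries (F G : PowerSeries (ℝ → ℂ))
    (hF : ∀ n, SmoothPeriodic L (PowerSeries.coeff n F))
    (hG : ∀ n, SmoothPeriodic L (PowerSeries.coeff n G)) :
    PowerSeries (smoothAlg L × smoothAlg L) :=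
  PowerSeries.mk fun n => (⟨PowerSeries.coeff n F, hF n⟩, ⟨PowerSeries.coeff n G, hG n⟩)

variable {F G : PowerSeries (ℝ → ℂ)} (hF : ∀ n, SmoothPeriodic L (PowerSeries.coeff n F))
  (hG : ∀ n, SmoothPeriodic L (PowerSeries.coeff n G))

theorem coeff_liftSeries (n : ℕ) : PowerSeries.coeff n (liftSeries F G hF hG) =
    (⟨PowerSeries.coeff n F, hF n⟩, ⟨PowerSeries.coeff n G, hG n⟩) := by
  rw [liftSeries, PowerSeries.coeff_mk]

theorem fstSeries_liftSeries : fstSeries L (liftSeries F G hF hG) = F :=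
  PowerSeries.ext fun n => by rw [coeff_fstSeries, coeff_liftSeries]

theorem sndSeries_liftSeries : sndSeries L (liftSeries F G hF hG) = G :=
  PowerSeries.ext fun n => by rw [coeff_sndSeries, coeff_liftSeries]

end Pairs

theorem SmoothPeriodic.neg {L : ℝ} {f : ℝ → ℂ} (hf : SmoothPeriodic L f) :
    SmoothPeriodic L (-f) := ⟨hf.1.neg, fun x => by rw [Pi.neg_apply, Pi.neg_apply, hf.2 x]⟩

theorem smoothPeriodic_coeff_neg {L : ℝ} {F : PowerSeries (ℝ → ℂ)}
    (hF : ∀ n, SmoothPeriodic L (PowerSeries.coeff n F)) (n : ℕ) :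
    SmoothPeriodic L (PowerSeries.coeff n (-F)) := by
  rw [map_neg]
  exact (hF n).neg

/-- The pair of functions `(u, -v)`. -/
def signedPair {L : ℝ} {u v : ℝ → ℂ} (hu : SmoothPeriodic L u) (hv : SmoothPeriodic L v) :
    smoothAlg L × smoothAlg L := (⟨u, hu⟩, ⟨-v, hv.neg⟩)

section Calculus

variable {L δ : ℝ} (hL : 0 < L) (hδ : 0 < δ) {u v : ℝ → ℂ} {W Z E₁ E₂ : PowerSeries (ℝ → ℂ)}

theorem pairCalculus_H (f : smoothAlg L × smoothAlg L) :
    (pairCalculus hL hδ).H f = matrixH hL hδ f := rfl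

theorem oddS_coeff_neg {K : ℝ → ℂ} (hK : IsPoleKernel L K)
    (hZ : ∀ n, SmoothPeriodic L (PowerSeries.coeff n Z)) (n : ℕ) :
    oddS hL hK ⟨PowerSeries.coeff n (-Z), smoothPeriodic_coeff_neg hZ n⟩ =
      -oddS hL hK ⟨PowerSeries.coeff n Z, hZ n⟩ := by
  rw [← map_neg]
  congr 1

theorem derivS_coeff_neg (hZ : ∀ n, SmoothPeriodic L (PowerSeries.coeff n Z)) (n : ℕ) :
    derivS L ⟨PowerSeries.coeff n (-Z), smoothPeriodic_coeff_neg hZ n⟩ =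
      -derivS L ⟨PowerSeries.coeff n Z, hZ n⟩ := by
  rw [← map_neg]
  congr 1

/-- The pair of scalar relations between coefficients, as a relation between series of pairs. -/
theorem series_relation (hu : SmoothPeriodic L u) (hv : SmoothPeriodic L v)
    (hW : ∀ n, SmoothPeriodic L (PowerSeries.coeff n W))
    (hZ : ∀ n, SmoothPeriodic L (PowerSeries.coeff n Z))
    (h1 : PowerSeries.coeff 0 E₁ = 0) (h2 : PowerSeries.coeff 0 E₂ = 0)
    (h : ∀ n x, 2 * PowerSeries.coeff (n + 1) E₁ x = -2 * PowerSeries.coeff n (PowerSeries.C u) x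
      - (oddOp L (kerT L δ) (deriv (PowerSeries.coeff n W)) x
        + oddOp L (kerTt L δ) (deriv (PowerSeries.coeff n Z)) x
        + Complex.I * deriv (PowerSeries.coeff n W) x) ∧
      2 * PowerSeries.coeff (n + 1) E₂ x = 2 * PowerSeries.coeff n (PowerSeries.C v) x
      - (oddOp L (kerTt L δ) (deriv (PowerSeries.coeff n W)) x
        + oddOp L (kerT L δ) (deriv (PowerSeries.coeff n Z)) x
        - Complex.I * deriv (PowerSeries.coeff n Z) x))
    {E : PowerSeries (smoothAlg L × smoothAlg L)} (hE1 : fstSeries L E = E₁)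
    (hE2 : sndSeries L E = E₂) :
    2 * (PowerSeries.X * PowerSeries.C (signedPair hu hv)) = -(2 * E) - PowerSeries.X *
      ((pairCalculus hL hδ).Hc (liftSeries W (-Z) hW (smoothPeriodic_coeff_neg hZ)) +
        Complex.I • (pairCalculus hL hδ).Dc
          (liftSeries W (-Z) hW (smoothPeriodic_coeff_neg hZ))) := by
  rw [two_mul, two_mul]
  have e1 : ∀ n, ((PowerSeries.coeff n E).1 : ℝ → ℂ) = PowerSeries.coeff n E₁ := fun n => by
    rw [← coeff_fstSeries, hE1]
  have e2 : ∀ n, ((PowerSeries.coeff n E).2 : ℝ → ℂ) = PowerSeries.coeff n E₂ := fun n => by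
    rw [← coeff_sndSeries, hE2]
  refine PowerSeries.ext fun n => ?_
  cases n with
  | zero =>
    have : PowerSeries.coeff 0 E = 0 :=
      Prod.ext (Subtype.ext ((e1 0).trans h1)) (Subtype.ext ((e2 0).trans h2))
    rw [map_add, map_sub, map_neg, map_add, PowerSeries.coeff_zero_X_mul,
      PowerSeries.coeff_zero_X_mul, this]
    simp
  | succ n =>
    rw [map_add, map_sub, map_neg, map_add, PowerSeries.coeff_succ_X_mul,
      PowerSeries.coeff_succ_X_mul, map_add, PowerSeries.coeff_smul, coeff_cw, coeff_cw,
      coeff_liftSeries]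
    have c1 : ((PowerSeries.coeff n (PowerSeries.C (signedPair hu hv))).1 : ℝ → ℂ) =
        PowerSeries.coeff n (PowerSeries.C u) := by
      rw [PowerSeries.coeff_C, PowerSeries.coeff_C]
      split_ifs <;> rfl
    have c2 : ((PowerSeries.coeff n (PowerSeries.C (signedPair hu hv))).2 : ℝ → ℂ) =
        -PowerSeries.coeff n (PowerSeries.C v) := by
      rw [PowerSeries.coeff_C, PowerSeries.coeff_C]
      split_ifs
      · rfl
      · simp
    refine Prod.ext (Subtype.ext (funext fun x => ?_)) (Subtype.ext (funext fun x => ?_))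
    · have t : ((pairCalculus hL hδ).H (⟨PowerSeries.coeff n W, hW n⟩,
          ⟨PowerSeries.coeff n (-Z), smoothPeriodic_coeff_neg hZ n⟩)).1 =
          oddS hL (isPoleKernel_kerT hL hδ) ⟨PowerSeries.coeff n W, hW n⟩ +
          oddS hL (isPoleKernel_kerTt hL hδ) ⟨PowerSeries.coeff n Z, hZ n⟩ := by
        rw [pairCalculus_H, matrixH_fst, oddS_coeff_neg, sub_neg_eq_add]
      change ((PowerSeries.coeff n (PowerSeries.C (signedPair hu hv))).1 : ℝ → ℂ) x +
        ((PowerSeries.coeff n (PowerSeries.C (signedPair hu hv))).1 : ℝ → ℂ) x =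
        -(((PowerSeries.coeff (n + 1) E).1 : ℝ → ℂ) x + ((PowerSeries.coeff (n + 1) E).1 : ℝ → ℂ) x)
        - ((((pairCalculus hL hδ).H (⟨PowerSeries.coeff n W, hW n⟩,
          ⟨PowerSeries.coeff n (-Z), smoothPeriodic_coeff_neg hZ n⟩)).1 : ℝ → ℂ) x +
          Complex.I * deriv (PowerSeries.coeff n W) x)
      rw [c1, e1, t]
      change _ = _ - (oddOp L (kerT L δ) (deriv (PowerSeries.coeff n W)) x
        + oddOp L (kerTt L δ) (deriv (PowerSeries.coeff n Z)) x + _)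
      linear_combination (h n x).1
    · have t : ((pairCalculus hL hδ).H (⟨PowerSeries.coeff n W, hW n⟩,
          ⟨PowerSeries.coeff n (-Z), smoothPeriodic_coeff_neg hZ n⟩)).2 =
          oddS hL (isPoleKernel_kerTt hL hδ) ⟨PowerSeries.coeff n W, hW n⟩ +
          oddS hL (isPoleKernel_kerT hL hδ) ⟨PowerSeries.coeff n Z, hZ n⟩ := by
        rw [pairCalculus_H, matrixH_snd, oddS_coeff_neg, sub_neg_eq_add]
      change ((PowerSeries.coeff n (PowerSeries.C (signedPair hu hv))).2 : ℝ → ℂ) x +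
        ((PowerSeries.coeff n (PowerSeries.C (signedPair hu hv))).2 : ℝ → ℂ) x =
        -(((PowerSeries.coeff (n + 1) E).2 : ℝ → ℂ) x + ((PowerSeries.coeff (n + 1) E).2 : ℝ → ℂ) x)
        - ((((pairCalculus hL hδ).H (⟨PowerSeries.coeff n W, hW n⟩,
          ⟨PowerSeries.coeff n (-Z), smoothPeriodic_coeff_neg hZ n⟩)).2 : ℝ → ℂ) x +
          Complex.I * ((derivS L ⟨PowerSeries.coeff n (-Z),
            smoothPeriodic_coeff_neg hZ n⟩ : smoothAlg L) : ℝ → ℂ) x)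
      rw [c2, e2, t, derivS_coeff_neg hZ]
      change -_ + -_ = _ - (oddOp L (kerTt L δ) (deriv (PowerSeries.coeff n W)) x
        + oddOp L (kerT L δ) (deriv (PowerSeries.coeff n Z)) x
        + Complex.I * -deriv (PowerSeries.coeff n Z) x)
      linear_combination (h n x).2

end Calculus

theorem derivative_liftSeries {L : ℝ} {F G S T : PowerSeries (ℝ → ℂ)}
    (hF : ∀ n, SmoothPeriodic L (PowerSeries.coeff n F))
    (hG : ∀ n, SmoothPeriodic L (PowerSeries.coeff n G))
    (hS : ∀ n, SmoothPeriodic L (PowerSeries.coeff n S))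
    (hT : ∀ n, SmoothPeriodic L (PowerSeries.coeff n T))
    (h1 : PowerSeries.derivative _ F = PowerSeries.derivative _ S * F)
    (h2 : PowerSeries.derivative _ G = PowerSeries.derivative _ T * G) :
    PowerSeries.derivative _ (liftSeries F G hF hG) =
      PowerSeries.derivative _ (liftSeries S T hS hT) * liftSeries F G hF hG := by
  have d1 : ∀ E, fstSeries L (PowerSeries.derivative _ E) =
    PowerSeries.derivative _ (fstSeries L E) := fun E => map_derivative_series _ E
  have d2 : ∀ E, sndSeries L (PowerSeries.derivative _ E) =
    PowerSeries.derivative _ (sndSeries L E) := fun E => map_derivative_series _ E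
  refine ext_series ?_ ?_
  · rw [map_mul, d1, d1, fstSeries_liftSeries, fstSeries_liftSeries, h1]
  · rw [map_mul, d2, d2, sndSeries_liftSeries, sndSeries_liftSeries, h2]

theorem neg_liftSeries {L : ℝ} {F G F' G' : PowerSeries (ℝ → ℂ)}
    (hF : ∀ n, SmoothPeriodic L (PowerSeries.coeff n F))
    (hG : ∀ n, SmoothPeriodic L (PowerSeries.coeff n G))
    (hF' : ∀ n, SmoothPeriodic L (PowerSeries.coeff n F'))
    (hG' : ∀ n, SmoothPeriodic L (PowerSeries.coeff n G'))
    (h1 : F' = -F) (h2 : G' = -G) :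
    -liftSeries F G hF hG = liftSeries F' G' hF' hG' := by
  refine ext_series ?_ ?_
  · rw [map_neg, fstSeries_liftSeries, fstSeries_liftSeries, h1]
  · rw [map_neg, sndSeries_liftSeries, sndSeries_liftSeries, h2]

theorem constantCoeff_liftSeries_neg {L : ℝ} {W Z : PowerSeries (ℝ → ℂ)}
    (hW : ∀ n, SmoothPeriodic L (PowerSeries.coeff n W))
    (hZ : ∀ n, SmoothPeriodic L (PowerSeries.coeff n Z))
    (hW0 : PowerSeries.coeff 0 W = 0) (hZ0 : PowerSeries.coeff 0 Z = 0) : PowerSeries.constantCoeff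
    (liftSeries W (-Z) hW (smoothPeriodic_coeff_neg hZ)) = 0 := by
  rw [← PowerSeries.coeff_zero_eq_constantCoeff_apply, coeff_liftSeries]
  exact Prod.ext (Subtype.ext hW0) (Subtype.ext (by
    change PowerSeries.coeff 0 (-Z) = 0
    rw [map_neg, hZ0, neg_zero]))

section Fixed

variable {L δ : ℝ} (hL : 0 < L) (hδ : 0 < δ) {u v : ℝ → ℂ} {W Z : PowerSeries (ℝ → ℂ)}

/-- The exponential series attached to a pair of densities. -/
noncomputable def expPair (hW : ∀ n, SmoothPeriodic L (PowerSeries.coeff n W))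
    (hZ : ∀ n, SmoothPeriodic L (PowerSeries.coeff n Z))
    (hW0 : PowerSeries.coeff 0 W = 0) (hZ0 : PowerSeries.coeff 0 Z = 0) :
    PowerSeries (smoothAlg L × smoothAlg L) :=
  liftSeries (formalExp (-W)) (formalExp Z)
    (smoothPeriodic_formalExp (by rw [map_neg, hW0, neg_zero]) (smoothPeriodic_coeff_neg hW))
    (smoothPeriodic_formalExp hZ0 hZ)

variable (hW : ∀ n, SmoothPeriodic L (PowerSeries.coeff n W))
    (hZ : ∀ n, SmoothPeriodic L (PowerSeries.coeff n Z))
    (hW0 : PowerSeries.coeff 0 W = 0) (hZ0 : PowerSeries.coeff 0 Z = 0)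

theorem constantCoeff_expPair : PowerSeries.constantCoeff (expPair hW hZ hW0 hZ0) = 1 := by
  rw [← PowerSeries.coeff_zero_eq_constantCoeff_apply, expPair, coeff_liftSeries]
  exact Prod.ext (Subtype.ext (formalExp_spec (by rw [map_neg, hW0, neg_zero])).1)
    (Subtype.ext (formalExp_spec hZ0).1)

theorem derivative_expPair : PowerSeries.derivative _ (expPair hW hZ hW0 hZ0) =
    PowerSeries.derivative _ (-liftSeries W (-Z) hW (smoothPeriodic_coeff_neg hZ)) *
      expPair hW hZ hW0 hZ0 := by
  rw [neg_liftSeries (F' := -W) (G' := Z) _ _ (smoothPeriodic_coeff_neg hW) hZ rfl (neg_neg Z).symm]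
  exact derivative_liftSeries _ _ _ _ (formalExp_spec (by rw [map_neg, hW0, neg_zero])).2
    (formalExp_spec hZ0).2

theorem expPair_relation (hu : SmoothPeriodic L u) (hv : SmoothPeriodic L v)
    (h : IsBacklundSeries L δ u v W Z) :
    2 * (PowerSeries.X * PowerSeries.C (signedPair hu hv)) = 2 * (1 - expPair hW hZ hW0 hZ0) -
      PowerSeries.X *
      ((pairCalculus hL hδ).Hc (liftSeries W (-Z) hW (smoothPeriodic_coeff_neg hZ)) +
        Complex.I • (pairCalculus hL hδ).Dc
          (liftSeries W (-Z) hW (smoothPeriodic_coeff_neg hZ))) := by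
  have h1 : ∀ n, PowerSeries.coeff (n + 1) (1 : PowerSeries (ℝ → ℂ)) = 0 := fun n => by
    rw [PowerSeries.coeff_one, if_neg (Nat.succ_ne_zero n)]
  -- Subtracting `1` provides the vanishing constant terms required and leaves the higher
  -- coefficients unchanged.
  have := series_relation hL hδ (E₁ := formalExp (-W) - 1) (E₂ := formalExp Z - 1) hu hv hW hZ
    (by rw [map_sub, (formalExp_spec (by rw [map_neg, hW0, neg_zero])).1,
      PowerSeries.coeff_zero_one, sub_self])
    (by rw [map_sub, (formalExp_spec hZ0).1, PowerSeries.coeff_zero_one, sub_self])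
    (fun n x => by
      rw [map_sub, map_sub, h1, sub_zero, sub_zero]
      exact h.relation hL hδ hW hZ n x)
    (E := expPair hW hZ hW0 hZ0 - 1)
    (by rw [map_sub, map_one, expPair, fstSeries_liftSeries])
    (by rw [map_sub, map_one, expPair, sndSeries_liftSeries])
  rw [this]
  ring

theorem conservedIntegral_eq_tr (n : ℕ) : conservedIntegral L W Z n =
    (pairCalculus hL hδ).tr (PowerSeries.coeff n
      (liftSeries W (-Z) hW (smoothPeriodic_coeff_neg hZ))) := by
  rw [coeff_liftSeries]
  change _ = (∫ x in (-(L / 2))..(L / 2), PowerSeries.coeff n W x) -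
    ∫ x in (-(L / 2))..(L / 2), PowerSeries.coeff n (-Z) x
  rw [conservedIntegral, ← intervalIntegral.integral_sub ((hW n).continuous.intervalIntegrable _ _)
    ((smoothPeriodic_coeff_neg hZ n).continuous.intervalIntegrable _ _)]
  refine intervalIntegral.integral_congr fun x _ => ?_
  simp only [map_neg, Pi.neg_apply, sub_neg_eq_add]

end Fixed

/-! ### The Bäcklund relations differentiated in time -/

section Time

variable {L δ : ℝ} {J : Set ℝ} {u v : ℝ → ℝ → ℂ} {W Z : ℝ → PowerSeries (ℝ → ℂ)}

theorem dT_coeff_C (hJ : IsOpen J) (hu : SmoothFamily L J u) (n : ℕ) (x : ℝ) {t : ℝ} (ht : t ∈ J) :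
    dT (fun x t => PowerSeries.coeff n (PowerSeries.C fun y => u y t) x) x t =
      PowerSeries.coeff n (PowerSeries.C fun y => dT u y t) x := by
  cases n with
  | zero =>
    rw [PowerSeries.coeff_zero_C]
    exact dT_eq_of_hasDerivAt hJ ht (fun s _ => by rw [PowerSeries.coeff_zero_C])
      (hu.hasDerivAt_dT hJ x ht)
  | succ n =>
    rw [PowerSeries.coeff_C, if_neg (Nat.succ_ne_zero n)]
    exact dT_eq_of_hasDerivAt (f := fun _ => 0) hJ ht
      (fun s _ => by rw [PowerSeries.coeff_C, if_neg (Nat.succ_ne_zero n), Pi.zero_apply])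
      (hasDerivAt_const t 0)

theorem hasDerivAt_oddOp_dX (hL : 0 < L) (hJ : IsOpen J) {K : ℝ → ℂ} (hK : IsPoleKernel L K)
    {F : ℝ → ℝ → ℂ} (hF : SmoothFamily L J F) (x : ℝ) {t : ℝ} (ht : t ∈ J) :
    HasDerivAt (fun s => oddOp L K (fun y => dX F y s) x)
      (oddOp L K (deriv fun y => dT F y t) x) t := by
  have h := ((hF.dX hJ).oddOp hL hJ hK).hasDerivAt_dT hJ x ht
  rw [(hF.dX hJ).dT_oddOp hL hJ hK x ht] at h
  convert h using 2
  exact funext fun y => (hF.dT_dX hJ y ht).symm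

theorem hasDerivAt_dX (hJ : IsOpen J)
    {F : ℝ → ℝ → ℂ} (hF : SmoothFamily L J F) (x : ℝ) {t : ℝ} (ht : t ∈ J) :
    HasDerivAt (fun s => dX F x s) (deriv (fun y => dT F y t) x) t := by
  have h := (hF.dX hJ).hasDerivAt_dT hJ x ht
  rw [hF.dT_dX hJ x ht] at h
  exact h

/-- The relations are linear apart from the exponentials, and `∂_t` passes through `∂_x` and the
convolutions. Hence they keep their form, with the exponentials replaced by their time derivatives.
-/
theorem dTSeries_relation (hL : 0 < L) (hδ : 0 < δ) (hJ : IsOpen J)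
    (hu : SmoothFamily L J u) (hv : SmoothFamily L J v)
    (hW : ∀ n, SmoothFamily L J fun x t => PowerSeries.coeff n (W t) x)
    (hZ : ∀ n, SmoothFamily L J fun x t => PowerSeries.coeff n (Z t) x)
    (h : ∀ t ∈ J, IsBacklundSeries L δ (fun x => u x t) (fun x => v x t) (W t) (Z t))
    (n : ℕ) (x : ℝ) {t : ℝ} (ht : t ∈ J) :
    2 * PowerSeries.coeff (n + 1) (dTSeries (fun s => formalExp (-W s)) t) x =
      -2 * PowerSeries.coeff n (PowerSeries.C fun y => dT u y t) x
      - (oddOp L (kerT L δ) (deriv (PowerSeries.coeff n (dTSeries W t))) x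
        + oddOp L (kerTt L δ) (deriv (PowerSeries.coeff n (dTSeries Z t))) x
        + Complex.I * deriv (PowerSeries.coeff n (dTSeries W t)) x) ∧
    2 * PowerSeries.coeff (n + 1) (dTSeries (fun s => formalExp (Z s)) t) x =
      2 * PowerSeries.coeff n (PowerSeries.C fun y => dT v y t) x
      - (oddOp L (kerTt L δ) (deriv (PowerSeries.coeff n (dTSeries W t))) x
        + oddOp L (kerT L δ) (deriv (PowerSeries.coeff n (dTSeries Z t))) x
        - Complex.I * deriv (PowerSeries.coeff n (dTSeries Z t)) x) := by
  have kT := isPoleKernel_kerT hL hδ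
  have kTt := isPoleKernel_kerTt hL hδ
  have rel := fun s (hs : s ∈ J) => (h s hs).relation hL hδ (fun n => (hW n).slice hs)
    (fun n => (hZ n).slice hs) n x
  have cu := (smoothFamily_coeff_C hu n).hasDerivAt_dT hJ x ht
  have cv := (smoothFamily_coeff_C hv n).hasDerivAt_dT hJ x ht
  rw [dT_coeff_C hJ hu n x ht] at cu
  rw [dT_coeff_C hJ hv n x ht] at cv
  rw [coeff_dTSeries, coeff_dTSeries]
  have cw : ∀ S : ℝ → PowerSeries (ℝ → ℂ), PowerSeries.coeff n (dTSeries S t) =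
      fun y => dT (fun x t => PowerSeries.coeff n (S t) x) y t := fun S =>
    funext fun y => coeff_dTSeries S t n y
  rw [cw W, cw Z]
  constructor
  · rw [mul_comm, ← eq_div_iff two_ne_zero]
    refine dT_eq_of_hasDerivAt hJ ht (fun s hs => ?_) (((cu.const_mul (-2)).fun_sub
      (((hasDerivAt_oddOp_dX hL hJ kT (hW n) x ht).fun_add
        (hasDerivAt_oddOp_dX hL hJ kTt (hZ n) x ht)).fun_add
        ((hasDerivAt_dX hJ (hW n) x ht).const_mul Complex.I))).div_const 2)
    rw [eq_div_iff two_ne_zero, mul_comm]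
    exact (rel s hs).1
  · rw [mul_comm, ← eq_div_iff two_ne_zero]
    refine dT_eq_of_hasDerivAt hJ ht (fun s hs => ?_) (((cv.const_mul 2).fun_sub
      (((hasDerivAt_oddOp_dX hL hJ kTt (hW n) x ht).fun_add
        (hasDerivAt_oddOp_dX hL hJ kT (hZ n) x ht)).fun_sub
        ((hasDerivAt_dX hJ (hZ n) x ht).const_mul Complex.I))).div_const 2)
    rw [eq_div_iff two_ne_zero, mul_comm]
    exact (rel s hs).2

end Time

/-! ### Conservation along solutions -/

section Conservation

variable {L δ : ℝ} {J : Set ℝ} {u v : ℝ → ℝ → ℂ} {W Z : ℝ → PowerSeries (ℝ → ℂ)}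

theorem dTSeries_neg (S : ℝ → PowerSeries (ℝ → ℂ)) (t : ℝ) :
    dTSeries (fun s => -S s) t = -dTSeries S t := by
  refine PowerSeries.ext fun n => funext fun x => ?_
  rw [map_neg, Pi.neg_apply, coeff_dTSeries, coeff_dTSeries, dT, dT, ← deriv.fun_neg]
  simp only [map_neg, Pi.neg_apply]

theorem smoothPeriodic_dTSeries (hJ : IsOpen J) {S : ℝ → PowerSeries (ℝ → ℂ)}
    (hS : ∀ n, SmoothFamily L J fun x t => PowerSeries.coeff n (S t) x) {t : ℝ} (ht : t ∈ J)
    (n : ℕ) : SmoothPeriodic L (PowerSeries.coeff n (dTSeries S t)) := by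
  rw [dTSeries, PowerSeries.coeff_mk]
  exact ((hS n).dT hJ).slice ht

theorem coeff_zero_dTSeries_formalExp (hJ : IsOpen J) {S : ℝ → PowerSeries (ℝ → ℂ)}
    (h0 : ∀ t ∈ J, PowerSeries.coeff 0 (S t) = 0) {t : ℝ} (ht : t ∈ J) :
    PowerSeries.coeff 0 (dTSeries (fun s => formalExp (S s)) t) = 0 := funext fun x => by
  rw [coeff_dTSeries]
  exact dT_eq_of_hasDerivAt hJ ht (f := fun _ => 1)
    (fun s hs => by rw [(formalExp_spec (h0 s hs)).1, Pi.one_apply]) (hasDerivAt_const t 1)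

theorem IsSolution.smoothFamily (h : IsSolution L δ J u v) :
    SmoothFamily L J u ∧ SmoothFamily L J v :=
  ⟨⟨h.smooth_u, h.periodic_u⟩, ⟨h.smooth_v, h.periodic_v⟩⟩

/-- The sign in `(u, -v)` merges the two equations: it makes the quadratic terms agree and turns the
couplings into the off-diagonal entries of `H`. -/
theorem IsSolution.signedPair_dT (h : IsSolution L δ J u v) (hL : 0 < L) (hδ : 0 < δ) {t : ℝ}
    (ht : t ∈ J) (hu : SmoothPeriodic L fun x => u x t) (hv : SmoothPeriodic L fun x => v x t)
    (hut : SmoothPeriodic L fun x => dT u x t) (hvt : SmoothPeriodic L fun x => dT v x t) :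
    signedPair hut hvt = -2 * (signedPair hu hv * (pairCalculus hL hδ).D (signedPair hu hv)) -
      (pairCalculus hL hδ).H ((pairCalculus hL hδ).D (signedPair hu hv)) := by
  have kT := isPoleKernel_kerT hL hδ
  have kTt := isPoleKernel_kerTt hL hδ
  set a : smoothAlg L := ⟨fun x => u x t, hu⟩ with ha
  set b : smoothAlg L := ⟨fun x => v x t, hv⟩ with hb
  have hs : signedPair hu hv = (a, -b) := rfl
  have hD : (pairCalculus hL hδ).D (a, -b) = (derivS L a, -derivS L b) := by
    rw [← map_neg]
    rfl
  have hH : (pairCalculus hL hδ).H (derivS L a, -derivS L b) =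
      (oddS hL kT (derivS L a) + oddS hL kTt (derivS L b),
        oddS hL kTt (derivS L a) + oddS hL kT (derivS L b)) := by
    rw [pairCalculus_H]
    refine Prod.ext ?_ ?_
    · rw [matrixH_fst, map_neg, sub_neg_eq_add]
    · rw [matrixH_snd, map_neg, sub_neg_eq_add]
  rw [hs, hD, hH]
  refine Prod.ext (Subtype.ext (funext fun x => ?_)) (Subtype.ext (funext fun x => ?_))
  · have e := h.eq_u x t ht
    rw [hu.deriv.deriv.opT_eq hL hδ, hv.deriv.opTt_deriv_eq hL hδ] at e
    change dT u x t = -2 * (u x t * deriv (fun y => u y t) x) -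
      (oddOp L (kerT L δ) (deriv (deriv fun y => u y t)) x +
        oddOp L (kerTt L δ) (deriv (deriv fun y => v y t)) x)
    rw [dT]
    linear_combination e
  · have e := h.eq_v x t ht
    rw [hv.deriv.deriv.opT_eq hL hδ, hu.deriv.opTt_deriv_eq hL hδ] at e
    change -dT v x t = -2 * (-v x t * -deriv (fun y => v y t) x) -
      (oddOp L (kerTt L δ) (deriv (deriv fun y => u y t)) x +
        oddOp L (kerT L δ) (deriv (deriv fun y => v y t)) x)
    rw [dT]
    linear_combination -e

theorem IsSolution.integral_dT (hsol : IsSolution L δ J u v) (hL : 0 < L) (hδ : 0 < δ)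
    (hJ : IsOpen J)
    (h : ∀ t ∈ J, IsBacklundSeries L δ (fun x => u x t) (fun x => v x t) (W t) (Z t))
    (n : ℕ) {t : ℝ} (ht : t ∈ J) : conservedIntegral L (dTSeries W t) (dTSeries Z t) n = 0 := by
  obtain ⟨hu, hv⟩ := hsol.smoothFamily
  have hW := fun n => (smoothFamily_of_isBacklundSeries hL hδ hJ hu hv h n).1
  have hZ := fun n => (smoothFamily_of_isBacklundSeries hL hδ hJ hu hv h n).2
  have hW0 : ∀ t ∈ J, PowerSeries.coeff 0 (W t) = 0 := fun t ht => (isBacklundSeries_iff.1 (h t ht)).1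
  have hZ0 : ∀ t ∈ J, PowerSeries.coeff 0 (Z t) = 0 := fun t ht =>
    (isBacklundSeries_iff.1 (h t ht)).2.1
  have hW0' : ∀ t ∈ J, PowerSeries.coeff 0 (-W t) = 0 := fun t ht => by
    rw [map_neg, hW0 t ht, neg_zero]
  have sW : ∀ n, SmoothPeriodic L (PowerSeries.coeff n (W t)) := fun n => (hW n).slice ht
  have sZ : ∀ n, SmoothPeriodic L (PowerSeries.coeff n (Z t)) := fun n => (hZ n).slice ht
  have sWt := smoothPeriodic_dTSeries hJ hW ht
  have sZt := smoothPeriodic_dTSeries hJ hZ ht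
  have hWn : ∀ k, SmoothFamily L J fun x t => PowerSeries.coeff k (-W t) x := fun k =>
    ((hW k).const_mul (-1)).congr fun x t _ => by rw [map_neg, Pi.neg_apply, neg_one_mul]
  have e1 := dTSeries_formalExp hJ hW0' hWn ht
  have e2 := dTSeries_formalExp hJ hZ0 hZ ht
  rw [dTSeries_neg] at e1
  rw [conservedIntegral_eq_tr hL hδ sWt sZt]
  refine HilbertCalculus.tr_evolution (HilbertCalculus.evolution
    (constantCoeff_expPair sW sZ (hW0 t ht) (hZ0 t ht))
    (constantCoeff_liftSeries_neg sW sZ (hW0 t ht) (hZ0 t ht))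
    (derivative_expPair sW sZ (hW0 t ht) (hZ0 t ht))
    (expPair_relation hL hδ sW sZ (hW0 t ht) (hZ0 t ht) (hu.slice ht) (hv.slice ht) (h t ht)) ?_
    (hsol.signedPair_dT hL hδ ht (hu.slice ht) (hv.slice ht) ((hu.dT hJ).slice ht)
      ((hv.dT hJ).slice ht))) n
  -- The relation lemma is reused with the time derivatives of the exponentials; as a pair series
  -- they equal `-e^{-Ω} Ω_t`.
  have := series_relation hL hδ (E₁ := dTSeries (fun s => formalExp (-W s)) t)
    (E₂ := dTSeries (fun s => formalExp (Z s)) t) ((hu.dT hJ).slice ht) ((hv.dT hJ).slice ht)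
    sWt sZt (coeff_zero_dTSeries_formalExp hJ hW0' ht) (coeff_zero_dTSeries_formalExp hJ hZ0 ht)
    (fun n x => dTSeries_relation hL hδ hJ hu hv hW hZ h n x ht)
    (E := -(expPair sW sZ (hW0 t ht) (hZ0 t ht) *
      liftSeries (dTSeries W t) (-dTSeries Z t) sWt (smoothPeriodic_coeff_neg sZt)))
    (by rw [map_neg, map_mul, expPair, fstSeries_liftSeries, fstSeries_liftSeries, e1, mul_neg])
    (by rw [map_neg, map_mul, expPair, sndSeries_liftSeries, sndSeries_liftSeries, e2, mul_neg,
      neg_neg])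
  rw [this]
  ring

theorem SmoothFamily.hasDerivAt_integral (hJ : IsOpen J) {F : ℝ → ℝ → ℂ}
    (hF : SmoothFamily L J F) {a b t : ℝ} (ht : t ∈ J) :
    HasDerivAt (fun s => ∫ x in a..b, F x s) (∫ x in a..b, NcILW.dT F x t) t := by
  have hΦ : ContDiffOn ℝ 1 (fun z : ℝ × ℝ => F z.2 z.1) (J ×ˢ Set.univ) :=
    (hF.smooth.of_le (by simp)).comp (f := fun z : ℝ × ℝ => (z.2, z.1)) (by fun_prop)
      fun z hz => ⟨trivial, hz.1⟩
  have h := (hasFDerivAt_integral_kernel_mul (a := a) (b := b) (k := fun _ => (1 : ℂ)) hJ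
    (by simp) hΦ ht).hasDerivAt
  simp only [one_smul] at h
  have e : ∀ x, fderiv ℝ (fun q => F x q) t =
      ContinuousLinearMap.toSpanSingleton ℝ (NcILW.dT F x t) := fun x =>
    toSpanSingleton_deriv.symm
  have hc : Continuous fun x => ContinuousLinearMap.toSpanSingleton ℝ (NcILW.dT F x t) :=
    (ContinuousLinearMap.toSpanSingletonCLE (𝕜 := ℝ) (E := ℂ)).continuous.comp
      ((hF.dT hJ).slice ht).continuous
  simp only [e] at h
  rw [ContinuousLinearMap.intervalIntegral_apply (hc.intervalIntegrable _ _)] at h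
  simpa using h

theorem IsSolution.conservedIntegral_eq (hsol : IsSolution L δ J u v) (hL : 0 < L) (hδ : 0 < δ)
    (hJ : IsOpen J) (hJ' : J.OrdConnected)
    (h : ∀ t ∈ J, IsBacklundSeries L δ (fun x => u x t) (fun x => v x t) (W t) (Z t))
    (n : ℕ) {s t : ℝ} (hs : s ∈ J) (ht : t ∈ J) :
    conservedIntegral L (W s) (Z s) n = conservedIntegral L (W t) (Z t) n := by
  obtain ⟨hu, hv⟩ := hsol.smoothFamily
  obtain ⟨hW, hZ⟩ := smoothFamily_of_isBacklundSeries hL hδ hJ hu hv h n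
  have hd : ∀ r ∈ J, HasDerivAt (fun r => conservedIntegral L (W r) (Z r) n) 0 r := by
    intro r hr
    have h1 := (hW.add hZ).hasDerivAt_integral hJ (a := -(L / 2)) (b := L / 2) hr
    have h2 : ∫ x in (-(L / 2))..(L / 2), dT (fun x t => PowerSeries.coeff n (W t) x +
        PowerSeries.coeff n (Z t) x) x r = 0 := by
      rw [← hsol.integral_dT hL hδ hJ h n hr, conservedIntegral]
      refine intervalIntegral.integral_congr fun x _ => ?_
      rw [coeff_dTSeries, coeff_dTSeries]
      exact ((hW.hasDerivAt_dT hJ x hr).add (hZ.hasDerivAt_dT hJ x hr)).deriv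
    rw [h2] at h1
    exact h1
  exact hJ.is_const_of_deriv_eq_zero hJ'.isPreconnected
    (fun r hr => (hd r hr).differentiableAt.differentiableWithinAt) (fun r hr => (hd r hr).deriv)
    hs ht

end Conservation

/-! ### The first four integrals -/

section FirstFour

variable {L δ : ℝ} {u v : ℝ → ℂ} {W Z : PowerSeries (ℝ → ℂ)}

/-- Both operators are Fourier multipliers. -/
theorem oddS_comm (hL : 0 < L) {K K' : ℝ → ℂ} (hK : IsPoleKernel L K) (hK' : IsPoleKernel L K')
    (f : smoothAlg L) : oddS hL hK (oddS hL hK' f) = oddS hL hK' (oddS hL hK f) :=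
  ext_fcS hL fun m => by
    rw [fcS_oddS, fcS_oddS, fcS_oddS, fcS_oddS]
    ring

theorem intS_oddS_mul_oddS (hL : 0 < L) {K K' : ℝ → ℂ} (hK : IsPoleKernel L K)
    (hK' : IsPoleKernel L K') (f g : smoothAlg L) :
    intS L (oddS hL hK f * oddS hL hK' g) = intS L (oddS hL hK' f * oddS hL hK g) := by
  rw [intS_mul_oddS, intS_mul_oddS, oddS_comm]

theorem IsBacklundSeries.first_four (hL : 0 < L) (hδ : 0 < δ) (hu : SmoothPeriodic L u)
    (hv : SmoothPeriodic L v) (h : IsBacklundSeries L δ u v W Z) :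
    conservedIntegral L W Z 1 = ∫ x in (-(L / 2))..(L / 2), (u x + v x) ∧
    conservedIntegral L W Z 2 = ∫ x in (-(L / 2))..(L / 2), 1 / 2 * (u x ^ 2 - v x ^ 2) ∧
    conservedIntegral L W Z 3 = ∫ x in (-(L / 2))..(L / 2), density3 L δ u v x ∧
    conservedIntegral L W Z 4 = ∫ x in (-(L / 2))..(L / 2), density4 L δ u v x := by
  have sW := fun n => (h.smoothPeriodic hL hδ hu hv n).1
  have sZ := fun n => (h.smoothPeriodic hL hδ hu hv n).2
  obtain ⟨hW0, hZ0, -⟩ := isBacklundSeries_iff.1 h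
  have key := HilbertCalculus.tr_first_four (constantCoeff_expPair sW sZ hW0 hZ0)
    (constantCoeff_liftSeries_neg sW sZ hW0 hZ0) (derivative_expPair sW sZ hW0 hZ0)
    (expPair_relation hL hδ sW sZ hW0 hZ0 hu hv h)
  have kT := isPoleKernel_kerT hL hδ
  have kTt := isPoleKernel_kerTt hL hδ
  set a : smoothAlg L := ⟨u, hu⟩ with ha
  set b : smoothAlg L := ⟨v, hv⟩ with hb
  have hs : signedPair hu hv = (a, -b) := rfl
  have hD : (pairCalculus hL hδ).D (a, -b) = (derivS L a, -derivS L b) := by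
    rw [← map_neg]
    rfl
  have hH : (pairCalculus hL hδ).H (a, -b) =
      (oddS hL kT a + oddS hL kTt b, oddS hL kTt a + oddS hL kT b) := by
    rw [pairCalculus_H]
    refine Prod.ext ?_ ?_
    · rw [matrixH_fst, map_neg, sub_neg_eq_add]
    · rw [matrixH_snd, map_neg, sub_neg_eq_add]
  have tr : ∀ f g : smoothAlg L, (pairCalculus hL hδ).tr (f, g) = intS L f - intS L g :=
    fun f g => rfl
  rw [← conservedIntegral_eq_tr hL hδ sW sZ, ← conservedIntegral_eq_tr hL hδ sW sZ,
    ← conservedIntegral_eq_tr hL hδ sW sZ, ← conservedIntegral_eq_tr hL hδ sW sZ] at key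
  simp only [hs, hD, hH, Prod.mk_mul_mk, tr] at key
  obtain ⟨k1, k2, k3, k4⟩ := key
  have e1 : ∫ x in (-(L / 2))..(L / 2), (u x + v x) = intS L (a + b) := rfl
  have e2 : ∫ x in (-(L / 2))..(L / 2), 1 / 2 * (u x ^ 2 - v x ^ 2) =
      intS L ((1 / 2 : ℂ) • (a * a - b * b)) := by
    refine intervalIntegral.integral_congr fun x _ => ?_
    change _ = (1 / 2 : ℂ) * (u x * u x - v x * v x)
    ring
  have e3 : ∫ x in (-(L / 2))..(L / 2), density3 L δ u v x =
      intS L ((1 / 3 : ℂ) • (a * a * a + b * b * b) + (1 / 2 : ℂ) •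
        (a * oddS hL kT a + b * oddS hL kT b + a * oddS hL kTt b + b * oddS hL kTt a)) := by
    refine intervalIntegral.integral_congr fun x _ => ?_
    simp only [density3]
    rw [hu.deriv.opT_eq hL hδ, hv.deriv.opT_eq hL hδ, hu.opTt_deriv_eq hL hδ,
      hv.opTt_deriv_eq hL hδ]
    change _ = (1 / 3 : ℂ) * (u x * u x * u x + v x * v x * v x) + (1 / 2 : ℂ) *
      (u x * oddOp L (kerT L δ) (deriv u) x + v x * oddOp L (kerT L δ) (deriv v) x +
      u x * oddOp L (kerTt L δ) (deriv v) x + v x * oddOp L (kerTt L δ) (deriv u) x)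
    ring
  have e4 : ∫ x in (-(L / 2))..(L / 2), density4 L δ u v x =
      intS L ((1 / 4 : ℂ) • (a * a * a * a - b * b * b * b) +
        (1 / 8 : ℂ) • (derivS L a * derivS L a - derivS L b * derivS L b) +
        (3 / 8 : ℂ) • (oddS hL kT a * oddS hL kT a - oddS hL kT b * oddS hL kT b -
          oddS hL kTt a * oddS hL kTt a + oddS hL kTt b * oddS hL kTt b) +
        (3 / 4 : ℂ) • (a * a * oddS hL kT a - b * b * oddS hL kT b) +
        (3 / 4 : ℂ) • (a * a * oddS hL kTt b - b * b * oddS hL kTt a)) := by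
    refine intervalIntegral.integral_congr fun x _ => ?_
    simp only [density4]
    rw [hu.deriv.opT_eq hL hδ, hv.deriv.opT_eq hL hδ, hu.opTt_deriv_eq hL hδ,
      hv.opTt_deriv_eq hL hδ]
    change _ = (1 / 4 : ℂ) * (u x * u x * u x * u x - v x * v x * v x * v x) +
      (1 / 8 : ℂ) * (deriv u x * deriv u x - deriv v x * deriv v x) +
      (3 / 8 : ℂ) * (oddOp L (kerT L δ) (deriv u) x * oddOp L (kerT L δ) (deriv u) x -
        oddOp L (kerT L δ) (deriv v) x * oddOp L (kerT L δ) (deriv v) x -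
        oddOp L (kerTt L δ) (deriv u) x * oddOp L (kerTt L δ) (deriv u) x +
        oddOp L (kerTt L δ) (deriv v) x * oddOp L (kerTt L δ) (deriv v) x) +
      (3 / 4 : ℂ) * (u x * u x * oddOp L (kerT L δ) (deriv u) x -
        v x * v x * oddOp L (kerT L δ) (deriv v) x) +
      (3 / 4 : ℂ) * (u x * u x * oddOp L (kerTt L δ) (deriv v) x -
        v x * v x * oddOp L (kerTt L δ) (deriv u) x)
    ring
  -- The trace of `(HU)²` contains `2∫(T u_x · T̃ v_x - T̃ u_x · T v_x)`, absent from the stated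
  -- density. It vanishes by symmetry and commutativity; its weight `3/8` gives the final
  -- coefficient `3/4`.
  have cross := intS_oddS_mul_oddS hL kT kTt a b
  have nm : ∀ f g : smoothAlg L, -f * g = -(f * g) := fun f g => by ring
  have mn : ∀ f g : smoothAlg L, f * -g = -(f * g) := fun f g => by ring
  have nn : ∀ f : smoothAlg L, -(-f) = f := fun f => by ring
  rw [e1, e2, e3, e4, k1, k2, k3, k4]
  simp only [map_add, map_sub, map_smul, smul_eq_mul, mul_add, add_mul, mn, nm, nn, map_neg,
    mul_comm (oddS hL kTt b) (oddS hL kT a), mul_comm (oddS hL kT b) (oddS hL kTt a)]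
    at cross ⊢
  refine ⟨by ring, trivial, by ring, ?_⟩
  linear_combination (3 / 4 : ℂ) * cross

end FirstFour

/-! ### Linear independence, tested on constant functions -/

section Independence

/-- The series `-log (1 - c ε)` of constant functions. -/
noncomputable def logSeries (c : ℂ) : PowerSeries (ℝ → ℂ) :=
  PowerSeries.mk fun n _ => c ^ n / n

theorem logSeries_zero (c : ℂ) : PowerSeries.coeff 0 (logSeries c) = 0 := by
  rw [logSeries, PowerSeries.coeff_mk]
  funext x
  simp

/-- The series `1 - cε` has logarithmic derivative `-c/(1 - cε)`, that of the exponential in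
question, and the same constant term. -/
theorem formalExp_neg_logSeries (c : ℂ) (n : ℕ) (x : ℝ) :
    PowerSeries.coeff (n + 1) (formalExp (-logSeries c)) x =
      -PowerSeries.coeff n (PowerSeries.C fun _ : ℝ => c) x := by
  have h0 : PowerSeries.coeff 0 (-logSeries c) = 0 := by rw [map_neg, logSeries_zero, neg_zero]
  set F : PowerSeries (ℝ → ℂ) := 1 - PowerSeries.X * PowerSeries.C fun _ : ℝ => c with hF
  have hF1 : ∀ n, PowerSeries.coeff (n + 1) F = -PowerSeries.coeff n (PowerSeries.C fun _ : ℝ => c) :=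
    fun n => by
      rw [hF, map_sub, PowerSeries.coeff_succ_X_mul, PowerSeries.coeff_one,
        if_neg (Nat.succ_ne_zero n), zero_sub]
  have hl : ∀ n, PowerSeries.coeff n (PowerSeries.derivative _ (logSeries c)) =
      fun _ => c ^ (n + 1) := fun n => by
    funext x
    have hne : (n : ℂ) + 1 ≠ 0 := by exact_mod_cast Nat.succ_ne_zero n
    rw [PowerSeries.coeff_derivative, logSeries, PowerSeries.coeff_mk]
    simp only [Pi.mul_apply, Pi.add_apply, Pi.natCast_apply, Pi.one_apply, Nat.cast_add,
      Nat.cast_one]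
    field_simp
  have hd : PowerSeries.derivative _ F = PowerSeries.derivative _ (-logSeries c) * F := by
    refine PowerSeries.ext fun n => funext fun x => ?_
    rw [PowerSeries.coeff_derivative, hF1, hF, mul_sub, mul_one, map_neg, map_sub, map_neg, hl,
      ← mul_assoc, mul_comm _ PowerSeries.X, mul_assoc]
    cases n with
    | zero => simp
    | succ n =>
      rw [PowerSeries.coeff_succ_X_mul, PowerSeries.coeff_mul_C, map_neg, hl, PowerSeries.coeff_C,
        if_neg (Nat.succ_ne_zero n)]
      simp only [Pi.sub_apply, Pi.neg_apply, Pi.mul_apply, Pi.zero_apply]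
      ring
  have : formalExp (-logSeries c) - F = 0 := by
    refine eq_zero_of_derivative_eq (S := -logSeries c) ?_ ?_
    · rw [map_sub, (formalExp_spec h0).2, hd]
      ring
    · rw [map_sub, ← PowerSeries.coeff_zero_eq_constantCoeff_apply, (formalExp_spec h0).1, hF]
      simp
  rw [sub_eq_zero.1 this, hF1, Pi.neg_apply]

theorem isBacklundSeries_logSeries (L δ : ℝ) (c : ℂ) :
    IsBacklundSeries L δ (fun _ => c) 0 (logSeries c) 0 := by
  refine isBacklundSeries_iff_coeff.2 ⟨logSeries_zero c, map_zero _, fun n x => ?_⟩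
  have hd : deriv (PowerSeries.coeff n (logSeries c)) = 0 := by
    rw [logSeries, PowerSeries.coeff_mk]
    exact funext fun x => deriv_const x _
  have h0 := coeff_formalExp_succ (S := 0) (map_zero _) n x
  have hne : (n : ℂ) + 1 ≠ 0 := by exact_mod_cast Nat.succ_ne_zero n
  have h1 : PowerSeries.coeff (n + 1) (formalExp 0) x = 0 := by
    refine mul_left_cancel₀ hne ?_
    rw [h0]
    simp
  rw [h1, hd, map_zero, deriv_zero_fun, opTt_zero, opPminus, opPplus, opT_zero,
    formalExp_neg_logSeries]
  constructor <;> simp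

theorem conservedIntegral_logSeries (L : ℝ) (c : ℂ) (n : ℕ) :
    conservedIntegral L (logSeries c) 0 n = L / n * c ^ n := by
  rw [conservedIntegral, logSeries]
  simp only [PowerSeries.coeff_mk, map_zero, Pi.zero_apply, add_zero,
    intervalIntegral.integral_const, Complex.real_smul]
  push_cast
  ring

/-- On `u = z`, `v = 0` a linear relation becomes a polynomial in `z` vanishing on all of `ℂ`, so
each coefficient `c n * (L / n)` is zero. -/
theorem linearIndependent_conservedIntegral {L δ : ℝ} (hL : 0 < L) {N : ℕ} {c : ℕ → ℂ}
    (h : ∀ u v : ℝ → ℂ, SmoothPeriodic L u → SmoothPeriodic L v →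
      ∀ W Z : PowerSeries (ℝ → ℂ), IsBacklundSeries L δ u v W Z →
        ∑ n ∈ Finset.Icc 1 N, c n * conservedIntegral L W Z n = 0) :
    ∀ n ∈ Finset.Icc 1 N, c n = 0 := by
  have hP : ∑ n ∈ Finset.Icc 1 N, Polynomial.monomial n (c n * (L / n)) = 0 := by
    refine Polynomial.funext fun z => ?_
    rw [Polynomial.eval_finsetSum, Polynomial.eval_zero,
      ← h _ _ (SmoothPeriodic.const z) (SmoothPeriodic.const 0) _ _
        (isBacklundSeries_logSeries L δ z)]
    refine Finset.sum_congr rfl fun n _ => ?_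
    rw [Polynomial.eval_monomial, conservedIntegral_logSeries]
    ring
  intro n hn
  have hc := congrArg (fun p => Polynomial.coeff p n) hP
  simp only [Polynomial.finsetSum_coeff, Polynomial.coeff_monomial, Finset.sum_ite_eq',
    if_pos hn, Polynomial.coeff_zero] at hc
  have hn0 : (n : ℂ) ≠ 0 := by
    have := (Finset.mem_Icc.1 hn).1
    exact_mod_cast (by omega : n ≠ 0)
  have hL0 : (L : ℂ) ≠ 0 := by exact_mod_cast hL.ne'
  exact (mul_eq_zero.1 hc).resolve_right (div_ne_zero hL0 hn0)

end Independence

end NcILW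

/-! ### Assembly of the theorem -/

theorem mainTheorem6 (L δ : ℝ) (hL : 0 < L) (hδ : 0 < δ) :
    -- the formal relations determine the densities, and they do so recursively
    (∀ u v : ℝ → ℂ, NcILW.SmoothPeriodic L u → NcILW.SmoothPeriodic L v →
      (∃! p : PowerSeries (ℝ → ℂ) × PowerSeries (ℝ → ℂ),
        NcILW.IsBacklundSeries L δ u v p.1 p.2) ∧
      ∀ W Z : PowerSeries (ℝ → ℂ), NcILW.IsBacklundSeries L δ u v W Z →
        (∀ n : ℕ, NcILW.SmoothPeriodic L (PowerSeries.coeff n W) ∧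
          NcILW.SmoothPeriodic L (PowerSeries.coeff n Z)) ∧
        PowerSeries.coeff 1 W = u ∧
        PowerSeries.coeff 1 Z = v ∧
        (∀ n : ℕ, 1 ≤ n → ∀ x : ℝ,
          PowerSeries.coeff (n + 1) W x =
            PowerSeries.coeff (n + 1)
              (NcILW.formalExp (-(PowerSeries.trunc (n + 1) W : PowerSeries (ℝ → ℂ)))) x
            + Complex.I * NcILW.opPminus L δ (deriv (PowerSeries.coeff n W)) x
            + 1 / 2 * NcILW.opTt L δ (deriv (PowerSeries.coeff n Z)) x ∧
          PowerSeries.coeff (n + 1) Z x =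
            -PowerSeries.coeff (n + 1)
              (NcILW.formalExp (PowerSeries.trunc (n + 1) Z : PowerSeries (ℝ → ℂ))) x
            - Complex.I * NcILW.opPplus L δ (deriv (PowerSeries.coeff n Z)) x
            - 1 / 2 * NcILW.opTt L δ (deriv (PowerSeries.coeff n W)) x) ∧
        -- the first four integrals
        NcILW.conservedIntegral L W Z 1 = ∫ x in (-(L / 2))..(L / 2), (u x + v x) ∧
        NcILW.conservedIntegral L W Z 2 =
          ∫ x in (-(L / 2))..(L / 2), 1 / 2 * (u x ^ 2 - v x ^ 2) ∧
        NcILW.conservedIntegral L W Z 3 =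
          ∫ x in (-(L / 2))..(L / 2), NcILW.density3 L δ u v x ∧
        NcILW.conservedIntegral L W Z 4 =
          ∫ x in (-(L / 2))..(L / 2), NcILW.density4 L δ u v x) ∧
    -- every `I_n` is constant in time along solutions
    (∀ (J : Set ℝ) (u v : ℝ → ℝ → ℂ), IsOpen J → J.OrdConnected →
      NcILW.IsSolution L δ J u v →
      ∀ W Z : ℝ → PowerSeries (ℝ → ℂ),
        (∀ t ∈ J, NcILW.IsBacklundSeries L δ (fun x => u x t) (fun x => v x t) (W t) (Z t)) →
        ∀ n : ℕ, 1 ≤ n → ∀ s ∈ J, ∀ t ∈ J,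
          NcILW.conservedIntegral L (W s) (Z s) n = NcILW.conservedIntegral L (W t) (Z t) n) ∧
    -- the functionals `I_1, I_2, …` are linearly independent, hence infinite in number
    (∀ (N : ℕ) (c : ℕ → ℂ),
      (∀ u v : ℝ → ℂ, NcILW.SmoothPeriodic L u → NcILW.SmoothPeriodic L v →
        ∀ W Z : PowerSeries (ℝ → ℂ), NcILW.IsBacklundSeries L δ u v W Z →
          ∑ n ∈ Finset.Icc 1 N, c n * NcILW.conservedIntegral L W Z n = 0) →
      ∀ n ∈ Finset.Icc 1 N, c n = 0) := by
  refine ⟨fun u v hu hv => ⟨?_, fun W Z h => ?_⟩, fun J u v hJ hJ' hsol W Z h n _ s hs t ht =>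
    hsol.conservedIntegral_eq hL hδ hJ hJ' h n hs ht,
    fun N c h => NcILW.linearIndependent_conservedIntegral hL h⟩
  · obtain ⟨W, Z, h⟩ := NcILW.exists_isBacklundSeries L δ u v
    exact ⟨(W, Z), h, fun p hp => Prod.ext (hp.unique h).1 (hp.unique h).2⟩
  · exact ⟨h.smoothPeriodic hL hδ hu hv, h.coeff_one.1, h.coeff_one.2,
      fun n hn x => h.coeff_succ hn x, h.first_four hL hδ hu hv⟩
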